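/- **Setting.** Let $n\ge 2$ and let $\Omega\subset\mathbb R^n$ be a bounded convex open set with boundary of class $C^{4,\alpha}$ for some $\alpha\in(0,1)$. Put $\mathcal C=\Omega\times(0,+\infty)$, with points $X=(x,y)$, $x\in\Omega$, $y>0$; $\nabla$ is the gradient in $\mathbb R^{n+1}$, $\nabla_x$ and $D_x$ are derivatives in $x$ only, and $\nu$ is the outer unit normal of $\Omega$. Let $f\in C^{2,\beta}_{\rm loc}(\mathbb R)$ for some $\beta\in(0,1)$. Let $g(y,s)$ be continuous in $y\in(0,+\infty)$ and locally Lipschitz in $s\in\mathbb R$; $g_u(y,s)$ denotes its derivative in $s$, with value $0$ where $g(y,\cdot)$ is not differentiable. Let $a\in C((0,+\infty)\times[0,+\infty))\cap C^1((0,+\infty)\times(0,+\infty))$ satisfy, with $a_t=\partial_t a(y,t)$ and the convention $t\,a_t(y,t)=0$ at $t=0$, $$a>0,\qquad a+t\,a_t>0,\qquad t\,|a_t|\le C_a\,a\qquad\text{for all }y>0,\ t\ge0,$$ for some constant $C_a>0$, and $\lim_{t\to0^+}t\,a_t(y,t)=0$ for every $y>0$. **Traces.** A function $\varphi$ on $\mathcal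 C$ has trace $\tau\in L^2(\Omega)$ on $\Omega\times\{0\}$ if $\frac1h\int_0^h\int_\Omega|\varphi(x,y)-\tau(x)|\,dx\,dy\to0$ as $h\to0^+$; we then write $\varphi|_{\Omega\times\{0\}}=\tau$. **Solutions.** Consider $$\begin{cases}\operatorname{div}(a(y,|\nabla u|)\nabla u)=g(y,u)&\text{in }\mathcal C,\\ \partial_\nu u=0&\text{on }\partial\Omega\times(0,+\infty),\\ -a(y,|\nabla u|)\,\partial_yu=f(u)&\text{on }\Omega\times\{0\}.\end{cases}\qquad(1)$$ A solution of (1) is a function $u\in C(\overline\Omega\times[0,+\infty))\cap C^2(\overline\Omega\times(0,+\infty))$ such that * all components of $\nabla_xu$ and $D_x^2u$ have traces in $L^2(\Omega)$ on $\Omega\times\{0\}$; * $\partial_\nu u(x,y)=0$ for all $(x,y)\in\partial\Omega\times[0,+\infty)$, as a one-sided derivative of $u(\cdot,y)$ at $x$ along the inward normal; * the components of $D_x^2u$ have weak gradients in $L^1_{\rm loc}(\mathcal C)$ (which gives $D^3_xu$ and $D^2_xu_y$), and for every $R>0$ $$a(y,|\nabla u|)\big(|\nabla u|^2+|D_x^2u|^2+|\nabla_xu_y|^2+|D_x^3u|^2+|D_x^2u_y|^2\big)\in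 L^1(\Omega\times(0,R));$$ * for every $\varphi\in\mathcal A$, $g(y,u)\varphi\in L^1(\mathcal C)$ and $$\int_{\mathcal C}a(y,|\nabla u|)\,\nabla u\cdot\nabla\varphi+\int_{\mathcal C}g(y,u)\,\varphi=\int_{\Omega}f(u(x,0))\,\varphi|_{\Omega\times\{0\}}\,dx,$$ where $\mathcal A$ is the set of $\varphi\in W^{1,1}_{\rm loc}(\mathcal C)$ that vanish for $y$ large, satisfy $a(y,|\nabla u|)|\nabla\varphi|^2\in L^1(\mathcal C)$, and have a trace $\varphi|_{\Omega\times\{0\}}\in L^2(\Omega)$. A solution $u$ is stable if, for every $\varphi\in\mathcal A$, $g_u(y,u)\varphi^2\in L^1(\mathcal C)$ and $$\int_{\mathcal C}\langle\mathcal B(y,\nabla u)\nabla\varphi,\nabla\varphi\rangle+\int_{\mathcal C}g_u(y,u)\,\varphi^2-\int_{\Omega}f'(u(x,0))\,\big(\varphi|_{\Omega\times\{0\}}\big)^2dx\ge0,$$ where $\mathcal B(y,\eta)_{ij}=a(y,|\eta|)\delta_{ij}+\frac{a_t(y,|\eta|)}{|\eta|}\eta_i\eta_j$ for $1\le i,j\le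 n+1$, the last term being $0$ if $\eta=0$. **Theorem 1.2.** Assume that all principal curvatures of $\partial\Omega$ (with the sign that makes those of spheres bounding balls positive) are strictly positive at every point of $\partial\Omega$. Let $u$ be a stable solution of (1) for which there is a constant $C>0$ such that $$\int_{\Omega\times(0,R)}a(y,|\nabla u|)\,|\nabla_xu|^2\,dX\le C\,R^2\qquad\text{for all }R\ge1.$$ Then $u$ depends only on $y$: there is a function $v$ with $u(x,y)=v(y)$ for all $x\in\overline\Omega$, $y\ge0$. -/

import Mathlib

open MeasureTheory Set Filter Topology
open scoped RealInnerProductSpace ContDiff NNReal ENNReal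

namespace BoundaryReaction

noncomputable section

/-- The horizontal space `ℝⁿ`. -/
abbrev E (n : ℕ) : Type := EuclideanSpace ℝ (Fin n)

/-- Vectors of `ℝⁿ⁺¹ = ℝⁿ × ℝ` with the Euclidean norm and inner product. Points `X = (x, y)`
are written in the plain product `E n × ℝ`, whose volume is Lebesgue measure; gradients
and matrices act in `V n`. -/
abbrev V (n : ℕ) : Type := WithLp 2 (E n × ℝ)

/-- `h` is of class `C^{k,α}_loc`: `k` times continuously differentiable, with a `k`-th
derivative that is `α`-Hölder continuous on compact sets. -/
def IsCkAlpha {F : Type*} [NormedAddCommGroup F] [NormedSpace ℝ F] (k : ℕ) (α : ℝ≥0)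
    (h : F → ℝ) : Prop :=
  ContDiff ℝ k h ∧
    ∀ K : Set F, IsCompact K → ∃ C : ℝ≥0, HolderOnWith C α (iteratedFDeriv ℝ k h) K

/- Geometry of the domain. -/

/-- Near `p`, `Ω` is the sublevel set `{ρ < 0}` of a function with nonzero gradient at `p`. -/
def IsLocalDefiningFunction {n : ℕ} (Ω : Set (E n)) (p : E n) (ρ : E n → ℝ) : Prop :=
  gradient ρ p ≠ 0 ∧ ∀ᶠ x in 𝓝 p, (x ∈ Ω ↔ ρ x < 0)

/-- `∂Ω` is of class `C^{k,α}`, with `Ω` locally on one side of its boundary. -/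
def HasCkAlphaBoundary {n : ℕ} (k : ℕ) (α : ℝ≥0) (Ω : Set (E n)) : Prop :=
  ∀ p ∈ frontier Ω, ∃ ρ : E n → ℝ, IsCkAlpha k α ρ ∧ IsLocalDefiningFunction Ω p ρ

/-- The unit vector `∇ρ / |∇ρ|` (for `ρ` a local defining function, and at a point of the
boundary, the outer unit normal). -/
def unitNormal {n : ℕ} (ρ : E n → ℝ) (x : E n) : E n := ‖gradient ρ x‖⁻¹ • gradient ρ x

/-- `ν` is the outer unit normal of `Ω` at the boundary point `p`. -/
def IsOuterUnitNormal {n : ℕ} (Ω : Set (E n)) (p ν : E n) : Prop :=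
  ∃ ρ : E n → ℝ, ContDiff ℝ 1 ρ ∧ IsLocalDefiningFunction Ω p ρ ∧ ν = unitNormal ρ p

/-- `κ` is a principal curvature of `∂Ω` at `p`: an eigenvalue of the differential of the outer
unit normal field (the shape operator) on the tangent space of `∂Ω` at `p`. The sign is
such that spheres bounding balls have positive curvatures. -/
def IsPrincipalCurvature {n : ℕ} (Ω : Set (E n)) (p : E n) (κ : ℝ) : Prop :=
  ∃ ρ : E n → ℝ, ContDiff ℝ 2 ρ ∧ IsLocalDefiningFunction Ω p ρ ∧
    ∃ v : E n, v ≠ 0 ∧ ⟪v, gradient ρ p⟫ = 0 ∧ fderiv ℝ (unitNormal ρ) p v = κ • v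

/-- The cylinder `𝒞 = Ω × (0, +∞)`. -/
def cyl {n : ℕ} (Ω : Set (E n)) : Set (E n × ℝ) := Ω ×ˢ Ioi 0

/- Derivatives. -/

/-- The partial derivative `∂w/∂xᵢ`. -/
def dx {n : ℕ} (i : Fin n) (w : E n × ℝ → ℝ) (X : E n × ℝ) : ℝ :=
  fderiv ℝ w X (EuclideanSpace.single i 1, 0)

/-- The partial derivative `∂w/∂y`. -/
def dy {n : ℕ} (w : E n × ℝ → ℝ) (X : E n × ℝ) : ℝ := fderiv ℝ w X (0, 1)

/-- The horizontal gradient `∇ₓ w`. -/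
def gradx {n : ℕ} (w : E n × ℝ → ℝ) (X : E n × ℝ) : E n := WithLp.toLp 2 fun i => dx i w X

/-- The full gradient `∇w = (∇ₓ w, ∂_y w)`. -/
def grad {n : ℕ} (w : E n × ℝ → ℝ) (X : E n × ℝ) : V n := WithLp.toLp 2 (gradx w X, dy w X)

/-- `φ ∈ W^{1,1}_loc(U)`, with weak gradient `G`. -/
structure HasWeakGradient {n : ℕ} (U : Set (E n × ℝ)) (φ : E n × ℝ → ℝ)
    (G : E n × ℝ → V n) : Prop where
  locallyIntegrable : LocallyIntegrableOn φ U
  locallyIntegrable_grad : LocallyIntegrableOn G U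
  integral_eq : ∀ η : E n × ℝ → ℝ, ContDiff ℝ ∞ η → HasCompactSupport η → tsupport η ⊆ U →
    ∫ X in U, φ X • grad η X = -∫ X in U, η X • G X

/-- `τ ∈ L²(Ω)` is the trace of `φ` on the bottom `Ω × {0}` of the cylinder: the mean over
`y ∈ (0, h)` of the `L¹(Ω)` distance of `φ(·, y)` from `τ` tends to `0` as `h → 0⁺`. -/
def HasL2Trace {n : ℕ} (Ω : Set (E n)) (φ : E n × ℝ → ℝ) (τ : E n → ℝ) : Prop :=
  MemLp τ 2 (volume.restrict Ω) ∧
    Tendsto (fun h : ℝ => (∫⁻ X in Ω ×ˢ Ioo 0 h, ‖φ X - τ X.1‖ₑ) / ENNReal.ofReal h)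
      (𝓝[>] 0) (𝓝 0)

/- Data of the problem. -/

/-- The structural conditions on the diffusion coefficient `a(y, t)`; `a_t` is
`deriv (a y) t`, and its (irrelevant) value at `t = 0` only occurs multiplied by `t = 0`. -/
structure IsDiffusionCoefficient (a : ℝ → ℝ → ℝ) : Prop where
  continuousOn : ContinuousOn (fun p : ℝ × ℝ => a p.1 p.2) (Ioi 0 ×ˢ Ici 0)
  contDiffOn : ContDiffOn ℝ 1 (fun p : ℝ × ℝ => a p.1 p.2) (Ioi 0 ×ˢ Ioi 0)
  pos : ∀ y > 0, ∀ t ≥ 0, 0 < a y t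
  elliptic : ∀ y > 0, ∀ t ≥ 0, 0 < a y t + t * deriv (a y) t
  bound : ∃ C > 0, ∀ y > 0, ∀ t ≥ 0, t * |deriv (a y) t| ≤ C * a y t
  tendsto_zero : ∀ y > 0, Tendsto (fun t => t * deriv (a y) t) (𝓝[>] 0) (𝓝 0)

/-- The interior reaction `g(y, s)`: continuous in `y`, locally Lipschitz in `s`. -/
structure IsInteriorReaction (g : ℝ → ℝ → ℝ) : Prop where
  continuousOn : ∀ s, ContinuousOn (fun y => g y s) (Ioi 0)
  locallyLipschitz : ∀ y > 0, LocallyLipschitz (g y)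

/-- The matrix `ℬ(y, η) = a(y,|η|) Id + (a_t(y,|η|) / |η|) η ⊗ η` applied to `ξ`; the second
term is `0` if `η = 0`. -/
def matB {n : ℕ} (a : ℝ → ℝ → ℝ) (y : ℝ) (η ξ : V n) : V n :=
  a y ‖η‖ • ξ + (deriv (a y) ‖η‖ / ‖η‖ * ⟪η, ξ⟫) • η

/- Solutions. -/

/-- The regularity required of solutions. The functions `G i j` are the weak gradients of the
second derivatives `u_{xᵢxⱼ}`, so that the sum of their squares is `|D³ₓu|² + |D²ₓu_y|²`. -/
structure IsRegular {n : ℕ} (Ω : Set (E n)) (a : ℝ → ℝ → ℝ) (u : E n × ℝ → ℝ) : Prop where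
  continuousOn : ContinuousOn u (closure Ω ×ˢ Ici 0)
  contDiffOn : ContDiffOn ℝ 2 u (closure Ω ×ˢ Ioi 0)
  trace_dx : ∀ i, ∃ τ, HasL2Trace Ω (dx i u) τ
  trace_dxx : ∀ i j, ∃ τ, HasL2Trace Ω (dx i (dx j u)) τ
  neumann : ∀ p ∈ frontier Ω, ∀ ν, IsOuterUnitNormal Ω p ν → ∀ y ≥ 0,
    HasDerivWithinAt (fun t : ℝ => u (p - t • ν, y)) 0 (Ici 0) 0
  integrable : ∃ G : Fin n → Fin n → E n × ℝ → V n,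
    (∀ i j, HasWeakGradient (cyl Ω) (dx i (dx j u)) (G i j)) ∧
    ∀ R > 0, IntegrableOn
      (fun X => a X.2 ‖grad u X‖ *
        (‖grad u X‖ ^ 2 + ∑ i, ∑ j, dx i (dx j u) X ^ 2 + ∑ i, dx i (dy u) X ^ 2
          + ∑ i, ∑ j, ‖G i j X‖ ^ 2))
      (Ω ×ˢ Ioo 0 R)

/-- `φ` belongs to the class `𝒜` of test functions of `u`, with weak gradient `G` and bottom
trace `τ`. (Both are determined by `φ` up to null sets.) -/
structure IsTest {n : ℕ} (Ω : Set (E n)) (a : ℝ → ℝ → ℝ) (u φ : E n × ℝ → ℝ)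
    (G : E n × ℝ → V n) (τ : E n → ℝ) : Prop where
  weakGradient : HasWeakGradient (cyl Ω) φ G
  bounded_support : ∃ M : ℝ, ∀ X ∈ cyl Ω, M < X.2 → φ X = 0
  integrable : IntegrableOn (fun X => a X.2 ‖grad u X‖ * ‖G X‖ ^ 2) (cyl Ω)
  trace : HasL2Trace Ω φ τ

/-- `u` is a weak solution of `div(a(y,|∇u|)∇u) = g(y,u)` in the cylinder, `∂_ν u = 0` on its
lateral boundary, `-a(y,|∇u|)∂_y u = f(u)` on its bottom. The term with `g` has to be a
convergent integral; the two others always are. -/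
structure IsSolution {n : ℕ} (Ω : Set (E n)) (a g : ℝ → ℝ → ℝ) (f : ℝ → ℝ)
    (u : E n × ℝ → ℝ) : Prop where
  regular : IsRegular Ω a u
  weak : ∀ φ G τ, IsTest Ω a u φ G τ →
    IntegrableOn (fun X => g X.2 (u X) * φ X) (cyl Ω) ∧
    (∫ X in cyl Ω, a X.2 ‖grad u X‖ * ⟪grad u X, G X⟫) + (∫ X in cyl Ω, g X.2 (u X) * φ X)
      = ∫ x in Ω, f (u (x, 0)) * τ x

/-- `u` is a stable solution: the second variation is nonnegative on `𝒜`. The term with `g_u`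
has to be a convergent integral; the two others always are. Here `g_u(y, s)` is the derivative
of `g(y, ·)` at `s`, with value `0` at the points where `g(y, ·)` is not differentiable. -/
structure IsStableSolution {n : ℕ} (Ω : Set (E n)) (a g : ℝ → ℝ → ℝ) (f : ℝ → ℝ)
    (u : E n × ℝ → ℝ) : Prop where
  solution : IsSolution Ω a g f u
  stable : ∀ φ G τ, IsTest Ω a u φ G τ →
    IntegrableOn (fun X => deriv (g X.2) (u X) * φ X ^ 2) (cyl Ω) ∧
    0 ≤ (∫ X in cyl Ω, ⟪matB a X.2 (grad u X) (G X), G X⟫)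
        + (∫ X in cyl Ω, deriv (g X.2) (u X) * φ X ^ 2)
        - ∫ x in Ω, deriv f (u (x, 0)) * τ x ^ 2

end

end BoundaryReaction

open BoundaryReaction

namespace BoundaryReaction

noncomputable section

/-! Write `uᵢ` for the horizontal derivatives of `u`. The proof plays two facts against each other.
Testing the equation with `η(y)² uᵢᵢ`, summing over `i` and integrating by parts horizontally on the
slices gives `energy_identity`. The lateral boundary contributes nothing there because of the
Neumann condition, and on the bottom the same integration by parts survives for the traces
(`integral_trace_laplacian`). Stability with the test function `η |∇ₓu|` gives `stability_norm`. The
terms with `g_u`, with `f'` and with the product `η η'` occur in both with opposite signs, so their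
sum, `energy_inequality`, reads `∫ η² (Σ ⟨ℬ∇uᵢ, ∇uᵢ⟩ - ⟨ℬ∇|∇ₓu|, ∇|∇ₓu|⟩) - ∫ η² (a⟨∇u, Σ ∇uᵢᵢ⟩ + Σ
⟨ℬ∇uᵢ, ∇uᵢ⟩) ≤ ∫ η'² |∇ₓu|² ⟨ℬe_y, e_y⟩`.

Both terms on the left have a sign. The first bracket is nonnegative by Cauchy–Schwarz for the
positive form `ℬ` (`hessianForm_sub_normForm`). The second is the horizontal divergence of the field
with components `a⟨∇u, ∇uᵢ⟩`, so its integral over a slice is a flux through `∂Ω`. Differentiating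
the Neumann condition along `∇u`, which is tangent to the lateral boundary, turns this flux into a
negative multiple of the second fundamental form evaluated on `∇ₓu`
(`normalFlux_eq_of_mem_frontier`). It is therefore nonpositive, and negative unless `∇ₓu` vanishes
on all of `∂Ω`. Logarithmic cutoffs make the right-hand side arbitrarily small, thanks to the
quadratic growth of the energy. Hence both terms vanish (`integral_slices_eq_zero`).

Equality in Cauchy–Schwarz makes all the `∇uᵢ` parallel, and then `∇ₓu` does not change along
segments orthogonal to it (`gradx_eq_of_orthogonal`). Since `n ≥ 2`, such a segment starts at every
point of a slice. It ends on `∂Ω`, where `∇ₓu = 0`, so `∇ₓu` vanishes everywhere (`gradx_eq_zero`).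

The technical weight lies in the low regularity. No surface measure is used: boundary integrals are
limits of integrals over thin interior layers, weighted by `layerKernel` and controlled by the
divergence theorem for radial fields. Third derivatives are only weak, and the flux is inserted as a
test function of which only a bounded measurable line derivative is used. -/

instance instIsAddHaarMeasureProd (n : ℕ) : (volume : Measure (E n × ℝ)).IsAddHaarMeasure :=
  inferInstanceAs ((volume : Measure (E n)).prod (volume : Measure ℝ)).IsAddHaarMeasure

/-! ### Coordinates, gradients and Riesz representatives in `V n`. -/

variable {n : ℕ}

/-- The horizontal coordinate vector `(eᵢ, 0)`. -/
def eX (i : Fin n) : E n × ℝ := (EuclideanSpace.single i 1, 0)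

/-- The Riesz representative in `V n` of a linear form on `E n × ℝ`. -/
def toV (n : ℕ) : ((E n × ℝ) →L[ℝ] ℝ) →L[ℝ] V n :=
  (WithLp.prodContinuousLinearEquiv 2 ℝ (E n) ℝ).symm.toContinuousLinearMap.comp
    (((EuclideanSpace.equiv (Fin n) ℝ).symm.toContinuousLinearMap.comp
      (ContinuousLinearMap.pi fun i => ContinuousLinearMap.apply ℝ ℝ (eX i))).prod
        (ContinuousLinearMap.apply ℝ ℝ ((0 : E n), (1 : ℝ))))

theorem grad_eq (w : E n × ℝ → ℝ) (X : E n × ℝ) : grad w X = toV n (fderiv ℝ w X) := rfl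

theorem sum_single_smul (x : E n) : ∑ i, x i • EuclideanSpace.single i (1 : ℝ) = x := by
  simpa using (EuclideanSpace.basisFun (Fin n) ℝ).sum_repr x

theorem sum_eX (x : E n) : ∑ i, x i • (eX i : E n × ℝ) = (x, 0) := by
  ext1
  · simp only [Prod.fst_sum, Prod.smul_fst, eX, sum_single_smul]
  · simp [Prod.snd_sum, eX]

theorem inner_toV (L : (E n × ℝ) →L[ℝ] ℝ) (ξ : V n) : ⟪toV n L, ξ⟫ = L (WithLp.ofLp ξ) := by
  have h : WithLp.ofLp ξ = ∑ i, (WithLp.ofLp ξ).1 i • (eX i : E n × ℝ)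
      + (WithLp.ofLp ξ).2 • ((0 : E n), (1 : ℝ)) := by
    rw [sum_eX]; ext1 <;> simp
  conv_rhs => rw [h]
  rw [map_add, map_sum, WithLp.prod_inner_apply]
  simp only [map_smul, smul_eq_mul]
  congr 1

theorem inner_grad (w : E n × ℝ → ℝ) (X : E n × ℝ) (ξ : V n) :
    ⟪grad w X, ξ⟫ = fderiv ℝ w X (WithLp.ofLp ξ) := inner_toV _ _

theorem norm_sq_grad (w : E n × ℝ → ℝ) (X : E n × ℝ) :
    ‖grad w X‖ ^ 2 = ‖gradx w X‖ ^ 2 + dy w X ^ 2 := by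
  rw [WithLp.prod_norm_sq_eq_of_L2, ← sq_abs (dy w X)]
  rfl

theorem norm_sq_gradx (w : E n × ℝ → ℝ) (X : E n × ℝ) :
    ‖gradx w X‖ ^ 2 = ∑ i, dx i w X ^ 2 := by
  rw [EuclideanSpace.norm_sq_eq]
  simp [gradx]

/- The matrix `ℬ`. -/

section Flux

variable {H : Type*} [NormedAddCommGroup H] [InnerProductSpace ℝ H]

/-- The differential of the flux `η ↦ b(|η|) η`. -/
def fluxDeriv (b : ℝ → ℝ) (η : H) : H →L[ℝ] H :=
  b ‖η‖ • ContinuousLinearMap.id ℝ H + (deriv b ‖η‖ / ‖η‖) • (innerSL ℝ η).smulRight η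

theorem fluxDeriv_apply (b : ℝ → ℝ) (η ξ : H) :
    fluxDeriv b η ξ = b ‖η‖ • ξ + (deriv b ‖η‖ / ‖η‖ * ⟪η, ξ⟫) • η := by
  simp [fluxDeriv, smul_smul]

theorem inner_fluxDeriv (b : ℝ → ℝ) (η ξ ζ : H) :
    ⟪fluxDeriv b η ξ, ζ⟫ = b ‖η‖ * ⟪ξ, ζ⟫ + deriv b ‖η‖ / ‖η‖ * ⟪η, ξ⟫ * ⟪η, ζ⟫ := by
  simp [fluxDeriv_apply, inner_add_left, real_inner_smul_left]

theorem inner_fluxDeriv_comm (b : ℝ → ℝ) (η ξ ζ : H) :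
    ⟪fluxDeriv b η ξ, ζ⟫ = ⟪fluxDeriv b η ζ, ξ⟫ := by
  rw [inner_fluxDeriv, inner_fluxDeriv, real_inner_comm]; ring

/-- The operator acts as `b` on the orthogonal complement of `η` and as `b + |η| b'` along `η`. If
`b' ≥ 0` the rank-one term only helps; if `b' ≤ 0`, Cauchy–Schwarz reduces to the worst case of `ξ`
parallel to `η`. -/
theorem inner_fluxDeriv_self_pos {b : ℝ → ℝ} {η : H} (hp : 0 < b ‖η‖)
    (he : 0 < b ‖η‖ + ‖η‖ * deriv b ‖η‖) {ξ : H} (hξ : ξ ≠ 0) : 0 < ⟪fluxDeriv b η ξ, ξ⟫ := by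
  have hξ' : 0 < ‖ξ‖ ^ 2 := by positivity
  rw [inner_fluxDeriv, real_inner_self_eq_norm_sq, mul_assoc, ← sq]
  rcases eq_or_ne η 0 with h0 | h0
  · subst h0; simp at hp ⊢; positivity
  have hη : 0 < ‖η‖ := norm_pos_iff.2 h0
  have hcs : ⟪η, ξ⟫ ^ 2 ≤ ‖η‖ ^ 2 * ‖ξ‖ ^ 2 := by
    rw [← mul_pow]
    exact sq_le_sq' (by linarith [neg_abs_le ⟪η, ξ⟫, abs_real_inner_le_norm η ξ])
      (real_inner_le_norm _ _)
  rcases le_total 0 (deriv b ‖η‖) with hd | hd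
  · have : 0 ≤ deriv b ‖η‖ / ‖η‖ * ⟪η, ξ⟫ ^ 2 := by positivity
    nlinarith [mul_pos hp hξ']
  · have h1 : deriv b ‖η‖ / ‖η‖ * (‖η‖ ^ 2 * ‖ξ‖ ^ 2) ≤ deriv b ‖η‖ / ‖η‖ * ⟪η, ξ⟫ ^ 2 :=
      mul_le_mul_of_nonpos_left hcs (div_nonpos_of_nonpos_of_nonneg hd hη.le)
    have h2 : deriv b ‖η‖ / ‖η‖ * (‖η‖ ^ 2 * ‖ξ‖ ^ 2) = ‖η‖ * deriv b ‖η‖ * ‖ξ‖ ^ 2 := by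
      field_simp
    nlinarith [mul_pos he hξ']

/-- The rank-one part has norm `|η| |b'|`, which the structural bound compares with `b`. Every
integral involving `ℬ` is dominated through this estimate by the weight `a` times a quadratic
expression. -/
theorem norm_fluxDeriv_le {b : ℝ → ℝ} {C : ℝ} {η : H} (hp : 0 < b ‖η‖)
    (hc : ‖η‖ * |deriv b ‖η‖| ≤ C * b ‖η‖) (ξ : H) :
    ‖fluxDeriv b η ξ‖ ≤ (1 + C) * b ‖η‖ * ‖ξ‖ := by
  rw [fluxDeriv_apply]
  have h1 : ‖b ‖η‖ • ξ‖ = b ‖η‖ * ‖ξ‖ := by rw [norm_smul, Real.norm_of_nonneg hp.le]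
  have h2 : ‖(deriv b ‖η‖ / ‖η‖ * ⟪η, ξ⟫) • η‖ ≤ C * b ‖η‖ * ‖ξ‖ := by
    rw [norm_smul, Real.norm_eq_abs, abs_mul, abs_div, abs_norm]
    rcases eq_or_ne η 0 with h0 | h0
    · subst h0
      simp only [norm_zero, mul_zero, div_zero, zero_mul] at hc ⊢
      exact mul_nonneg hc (norm_nonneg _)
    have hη : 0 < ‖η‖ := norm_pos_iff.2 h0
    calc |deriv b ‖η‖| / ‖η‖ * |⟪η, ξ⟫| * ‖η‖
        ≤ |deriv b ‖η‖| / ‖η‖ * (‖η‖ * ‖ξ‖) * ‖η‖ := by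
          gcongr; exact abs_real_inner_le_norm _ _
      _ = ‖η‖ * |deriv b ‖η‖| * ‖ξ‖ := by field_simp
      _ ≤ _ := by gcongr
  calc _ ≤ _ := norm_add_le _ _
    _ ≤ b ‖η‖ * ‖ξ‖ + C * b ‖η‖ * ‖ξ‖ := by rw [h1]; gcongr
    _ = _ := by ring

theorem hasFDerivAt_norm_of_ne_zero {η : H} (h0 : η ≠ 0) :
    HasFDerivAt (fun x : H => ‖x‖) (‖η‖⁻¹ • innerSL ℝ η) η := by
  have hη : 0 < ‖η‖ := norm_pos_iff.2 h0
  have := (hasStrictFDerivAt_norm_sq η).hasFDerivAt.sqrt (by positivity)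
  have h2 : (fun x : H => √(‖x‖ ^ 2)) = fun x => ‖x‖ := by
    ext1 x; exact Real.sqrt_sq (norm_nonneg _)
  rw [h2] at this
  convert this using 1
  rw [Real.sqrt_sq hη.le, ← Nat.cast_smul_eq_nsmul ℝ, smul_smul]
  congr 1; push_cast; field_simp

/-- At the origin continuity of `b` suffices: the remainder is `(b(|h|) - b(0)) h = o(h)`, and the
rank-one term of `fluxDeriv` is zero there. Elsewhere this is the product rule with the derivative
of the norm. -/
theorem hasFDerivAt_flux {b : ℝ → ℝ} {η : H}
    (h : (η = 0 ∧ ContinuousWithinAt b (Ici 0) 0) ∨ (η ≠ 0 ∧ DifferentiableAt ℝ b ‖η‖)) :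
    HasFDerivAt (fun η : H => b ‖η‖ • η) (fluxDeriv b η) η := by
  rcases h with ⟨h0, hb⟩ | ⟨h0, hd⟩
  · subst h0
    rw [hasFDerivAt_iff_isLittleO_nhds_zero]
    have hc : Tendsto (fun h : H => b ‖h‖ - b 0) (𝓝 0) (𝓝 0) := by
      have h2 : Tendsto (fun h : H => ‖h‖) (𝓝 0) (𝓝[Ici 0] 0) :=
        tendsto_nhdsWithin_of_tendsto_nhds_of_eventually_within _ tendsto_norm_zero
          (Eventually.of_forall fun h => norm_nonneg _)
      simpa using (hb.tendsto.comp h2).sub_const (b 0)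
    have : (fun h : H => b ‖0 + h‖ • (0 + h) - b ‖(0 : H)‖ • (0 : H) - fluxDeriv b 0 h)
        = fun h => (b ‖h‖ - b 0) • h := by
      ext1 h; simp [fluxDeriv, sub_smul]
    rw [this]
    simpa using ((Asymptotics.isLittleO_one_iff ℝ).2 hc).smul_isBigO
      (Asymptotics.isBigO_refl (fun h : H => h) _)
  · have hn := hasFDerivAt_norm_of_ne_zero h0
    have h3 := (hd.hasDerivAt.comp_hasFDerivAt η hn).smul (hasFDerivAt_id η)
    refine h3.congr_fderiv ?_
    ext1 ξ
    simp [fluxDeriv, Function.comp, smul_smul, div_eq_mul_inv, mul_assoc]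

end Flux

/-- `matB` as a continuous linear map in its last argument. -/
def matBL (a : ℝ → ℝ → ℝ) (y : ℝ) (η : V n) : V n →L[ℝ] V n := fluxDeriv (a y) η

theorem matBL_apply (a : ℝ → ℝ → ℝ) (y : ℝ) (η ξ : V n) : matBL a y η ξ = matB a y η ξ :=
  fluxDeriv_apply _ _ _

theorem inner_matB_comm (a : ℝ → ℝ → ℝ) (y : ℝ) (η ξ ζ : V n) :
    ⟪matB a y η ξ, ζ⟫ = ⟪matB a y η ζ, ξ⟫ := by
  rw [← matBL_apply, ← matBL_apply]; exact inner_fluxDeriv_comm _ _ _ _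

theorem inner_matB_self_pos {a : ℝ → ℝ → ℝ} (ha : IsDiffusionCoefficient a) {y : ℝ} (hy : 0 < y)
    (η : V n) {ξ : V n} (hξ : ξ ≠ 0) : 0 < ⟪matB a y η ξ, ξ⟫ := by
  rw [← matBL_apply]
  exact inner_fluxDeriv_self_pos (ha.pos y hy _ (norm_nonneg _))
    (ha.elliptic y hy _ (norm_nonneg _)) hξ

theorem inner_matB_self_nonneg {a : ℝ → ℝ → ℝ} (ha : IsDiffusionCoefficient a) {y : ℝ}
    (hy : 0 < y) (η ξ : V n) : 0 ≤ ⟪matB a y η ξ, ξ⟫ := by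
  rcases eq_or_ne ξ 0 with h | h
  · rw [h, inner_zero_right]
  · exact (inner_matB_self_pos ha hy η h).le

theorem norm_matB_le {a : ℝ → ℝ → ℝ} (ha : IsDiffusionCoefficient a) {C : ℝ}
    (hC : ∀ y > 0, ∀ t ≥ 0, t * |deriv (a y) t| ≤ C * a y t) {y : ℝ} (hy : 0 < y) (η ξ : V n) :
    ‖matB a y η ξ‖ ≤ (1 + C) * a y ‖η‖ * ‖ξ‖ := by
  rw [← matBL_apply]
  exact norm_fluxDeriv_le (ha.pos y hy _ (norm_nonneg _)) (hC y hy _ (norm_nonneg _)) ξ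

/-- The differential of the flux `η ↦ a(y, |η|) η` is `ℬ(y, η)`. -/
theorem hasFDerivAt_flux_matBL {a : ℝ → ℝ → ℝ} (ha : IsDiffusionCoefficient a) {y : ℝ}
    (hy : 0 < y) (η : V n) : HasFDerivAt (fun η : V n => a y ‖η‖ • η) (matBL a y η) η := by
  apply hasFDerivAt_flux
  rcases eq_or_ne η 0 with h0 | h0
  · refine Or.inl ⟨h0, ?_⟩
    have h1 : ContinuousWithinAt (fun p : ℝ × ℝ => a p.1 p.2) (Ioi 0 ×ˢ Ici 0) (y, 0) :=
      ha.continuousOn (y, 0) ⟨hy, Set.mem_Ici.2 (le_refl (0:ℝ))⟩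
    exact h1.comp (f := fun t : ℝ => (y, t)) (by fun_prop) fun t ht => ⟨hy, ht⟩
  · refine Or.inr ⟨h0, ?_⟩
    have hm : Ioi (0 : ℝ) ×ˢ Ioi (0 : ℝ) ∈ 𝓝 (y, ‖η‖) :=
      (isOpen_Ioi.prod isOpen_Ioi).mem_nhds ⟨hy, norm_pos_iff.2 h0⟩
    have h1 : DifferentiableAt ℝ (fun p : ℝ × ℝ => a p.1 p.2) (y, ‖η‖) :=
      (ha.contDiffOn.contDiffAt hm).differentiableAt one_ne_zero
    exact h1.comp (f := fun t : ℝ => (y, t)) ‖η‖ (by fun_prop)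

/-! ### Integration by parts and mollification of test functions. -/

section IntegrationByParts

variable {D : Type*} [NormedAddCommGroup D] [NormedSpace ℝ D] [MeasurableSpace D] [BorelSpace D]
  [FiniteDimensional ℝ D] {μ : Measure D} [μ.IsAddHaarMeasure]

theorem setIntegral_mul_fderiv_eq_neg {U : Set D} (hU : IsOpen U) {w η : D → ℝ}
    (hw : ContDiffOn ℝ 1 w U) (hη : ContDiff ℝ 1 η) (hc : HasCompactSupport η)
    (hs : tsupport η ⊆ U) (v : D) :
    ∫ x in U, w x * fderiv ℝ η x v ∂μ = -∫ x in U, η x * fderiv ℝ w x v ∂μ := by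
  have hcd : Continuous fun x => fderiv ℝ η x v :=
    (hη.continuous_fderiv one_ne_zero).clm_apply continuous_const
  have hz : ∀ x, x ∉ tsupport η → η x = 0 ∧ fderiv ℝ η x v = 0 := by
    intro x hx
    refine ⟨image_eq_zero_of_notMem_tsupport hx, ?_⟩
    rw [show fderiv ℝ η x = 0 from image_eq_zero_of_notMem_tsupport
      (fun h => hx (tsupport_fderiv_subset ℝ h))]; rfl
  rw [setIntegral_eq_integral_of_forall_compl_eq_zero
      (fun x hx => by rw [(hz x fun h => hx (hs h)).2, mul_zero]),
    setIntegral_eq_integral_of_forall_compl_eq_zero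
      (fun x hx => by rw [(hz x fun h => hx (hs h)).1, zero_mul])]
  -- The functions involved are only continuous on `U`, but vanishing off the support of `η` makes
  -- their extension by zero continuous with compact support.
  have key : ∀ f : D → ℝ, ContinuousOn f U → (∀ x, x ∉ tsupport η → f x = 0) →
      Integrable f μ := by
    intro f hf hf0
    have hsub : tsupport f ⊆ tsupport η :=
      closure_minimal (fun x hx => by by_contra h; exact hx (hf0 x h)) (isClosed_tsupport _)
    exact (hf.continuous_of_tsupport_subset hU (hsub.trans hs)).integrable_of_hasCompactSupport
      (hc.of_isClosed_subset (isClosed_tsupport _) hsub)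
  have hfw : ContinuousOn (fun x => fderiv ℝ w x v) U :=
    (hw.continuousOn_fderiv_of_isOpen hU le_rfl).clm_apply continuousOn_const
  rw [integral_mul_fderiv_eq_neg_fderiv_mul_of_integrable]
  · simp_rw [mul_comm]
  · exact key _ (hfw.mul hη.continuous.continuousOn) fun x hx => by simp [(hz x hx).1]
  · exact key _ (hw.continuousOn.mul hcd.continuousOn) fun x hx => by simp [(hz x hx).2]
  · exact key _ (hw.continuousOn.mul hη.continuous.continuousOn) fun x hx => by simp [(hz x hx).1]
  · exact fun x hx => (hw.contDiffAt (hU.mem_nhds (hs hx))).differentiableAt one_ne_zero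
  · exact fun x _ => (hη.differentiable one_ne_zero) x

theorem norm_normed_convolution_le (φ : ContDiffBump (0 : D)) {g : D → ℝ} {M : ℝ}
    (hg : ∀ x, |g x| ≤ M) (x : D) :
    ‖convolution (φ.normed μ) g (ContinuousLinearMap.lsmul ℝ ℝ) μ x‖ ≤ M := by
  have h1 : Integrable (fun t => φ.normed μ t * M) μ := φ.integrable_normed.mul_const M
  refine (norm_integral_le_of_norm_le h1 (Eventually.of_forall fun t => ?_)).trans ?_
  · simp only [ContinuousLinearMap.lsmul_apply, smul_eq_mul, norm_mul, Real.norm_eq_abs,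
      abs_of_nonneg (φ.nonneg_normed t)]
    exact mul_le_mul_of_nonneg_left (hg _) (φ.nonneg_normed t)
  · rw [integral_mul_const, φ.integral_normed, one_mul]

/-- The derivative falls first on the smooth mollifier; integrating by parts along the line moves it
onto `η`, for which a line derivative in the single direction `v` is enough. -/
theorem fderiv_normed_convolution_apply (φ : ContDiffBump (0 : D)) {η κ : D → ℝ} {v : D}
    (hη : Continuous η) (hκ : LocallyIntegrable κ μ) (hd : ∀ x, HasLineDerivAt ℝ η (κ x) x v)
    (x : D) :
    fderiv ℝ (convolution (φ.normed μ) η (ContinuousLinearMap.lsmul ℝ ℝ) μ) x v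
      = convolution (φ.normed μ) κ (ContinuousLinearMap.lsmul ℝ ℝ) μ x := by
  have hφc : ContDiff ℝ 1 (φ.normed μ) := φ.contDiff_normed
  have hφ' : Continuous (fderiv ℝ (φ.normed μ)) := hφc.continuous_fderiv one_ne_zero
  have hφs : HasCompactSupport (φ.normed μ) := φ.hasCompactSupport_normed
  rw [(hφs.hasFDerivAt_convolution_left (ContinuousLinearMap.lsmul ℝ ℝ) hφc
    hη.locallyIntegrable x).fderiv]
  have hex := (hφs.fderiv ℝ).convolutionExists_left
    (L := ContinuousLinearMap.precompL D (ContinuousLinearMap.lsmul ℝ ℝ)) hφ'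
    (hη.locallyIntegrable (μ := μ)) x
  unfold convolution
  rw [ContinuousLinearMap.integral_apply hex]
  have hex2 := hφs.convolutionExists_left (L := ContinuousLinearMap.lsmul ℝ ℝ) hφc.continuous hκ x
  have hex3 := hφs.convolutionExists_left (L := ContinuousLinearMap.lsmul ℝ ℝ) hφc.continuous
    (hη.locallyIntegrable (μ := μ)) x
  have hi := integral_bilinear_hasLineDerivAt_right_eq_neg_left_of_integrable (μ := μ)
    (B := ContinuousLinearMap.lsmul ℝ ℝ) (f := φ.normed μ) (f' := fun t => fderiv ℝ (φ.normed μ) t v)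
    (g := fun t => η (x - t)) (g' := fun t => - κ (x - t)) (v := v) ?_ ?_ ?_ ?_ ?_
  · simp only [map_neg, integral_neg, neg_inj] at hi
    exact hi.symm
  · exact hex.apply_continuousLinearMap v
  · simp only [map_neg]; exact Integrable.neg hex2
  · exact hex3
  · exact fun t _ => ((hφc.differentiable one_ne_zero) t).hasFDerivAt.hasLineDerivAt v
  · intro t _
    have := hd (x - t)
    unfold HasLineDerivAt at this ⊢
    have h2 := this.scomp_of_eq (0 : ℝ) (hasDerivAt_neg (0 : ℝ)) (by simp)
    have h3 : (fun s : ℝ => η (x - (t + s • v))) = (fun s : ℝ => η (x - t + s • v)) ∘ Neg.neg := by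
      ext s; simp only [Function.comp]; congr 1; module
    rw [h3]
    simpa using h2

/-- If `G` is the weak derivative of the continuous function `w` in the direction `v`, one can
test with continuous functions that merely have a bounded line derivative. -/
theorem setIntegral_smul_eq_neg_of_hasLineDerivAt {B : Type*} [NormedAddCommGroup B]
    [NormedSpace ℝ B] {U : Set D} (hU : IsOpen U) {w G : D → B} {v : D}
    (hw : ContinuousOn w U) (hG : LocallyIntegrableOn G U μ)
    (h : ∀ η : D → ℝ, ContDiff ℝ ∞ η → HasCompactSupport η → tsupport η ⊆ U →
      ∫ x in U, η x • G x ∂μ = -∫ x in U, fderiv ℝ η x v • w x ∂μ)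
    {η κ : D → ℝ} (hη : Continuous η) (hc : HasCompactSupport η) (hs : tsupport η ⊆ U)
    (hκm : AEStronglyMeasurable κ μ) {M : ℝ} (hκ : ∀ x, |κ x| ≤ M)
    (hd : ∀ x, HasLineDerivAt ℝ η (κ x) x v) :
    ∫ x in U, η x • G x ∂μ = -∫ x in U, κ x • w x ∂μ := by
  have hκl : LocallyIntegrable κ μ :=
    (locallyIntegrable_const M).mono hκm (Eventually.of_forall fun x => by
      rw [Real.norm_eq_abs, Real.norm_eq_abs]; exact (hκ x).trans (le_abs_self _))
  obtain ⟨N, hN⟩ := hη.bounded_above_of_compact_support hc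
  obtain ⟨δ, hδ, hδU⟩ := IsCompact.exists_cthickening_subset_open hc hU hs
  set K := Metric.cthickening δ (tsupport η) with hK
  have hKc : IsCompact K := IsCompact.cthickening hc
  -- Outer radii below `δ` keep the mollified functions supported in `K ⊆ U`. The fixed ratio of
  -- outer to inner radius is what almost everywhere convergence asks for, `κ` being only locally
  -- integrable.
  let φ : ℕ → ContDiffBump (0 : D) := fun k =>
    ⟨δ / (k + 2) / 2, δ / (k + 2), by positivity, half_lt_self (by positivity)⟩
  have hφδ : ∀ k, (φ k).rOut < δ := fun k => by
    change δ / (k + 2) < δ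
    exact div_lt_self hδ (by have : (0 : ℝ) ≤ k := k.cast_nonneg; linarith)
  have hφ0 : Tendsto (fun k => (φ k).rOut) atTop (𝓝 0) := by
    have : Tendsto (fun k : ℕ => δ / ((k : ℝ) + 2)) atTop (𝓝 0) :=
      tendsto_const_nhds.div_atTop (tendsto_natCast_atTop_atTop.atTop_add tendsto_const_nhds)
    exact this
  have hφr : ∀ᶠ k in atTop, (φ k).rOut ≤ 2 * (φ k).rIn := Eventually.of_forall fun k => by
    change δ / (k + 2) ≤ 2 * (δ / (k + 2) / 2); linarith
  let e : ℕ → D → ℝ := fun k => convolution ((φ k).normed μ) η (ContinuousLinearMap.lsmul ℝ ℝ) μ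
  let c : ℕ → D → ℝ := fun k => convolution ((φ k).normed μ) κ (ContinuousLinearMap.lsmul ℝ ℝ) μ
  have hκ0 : ∀ x, x ∉ tsupport η → κ x = 0 := by
    intro x hx
    have h0 : HasLineDerivAt ℝ η 0 x v := by
      have : η =ᶠ[𝓝 x] fun _ => 0 := by
        filter_upwards [(isClosed_tsupport η).isOpen_compl.mem_nhds hx] with z hz
        exact image_eq_zero_of_notMem_tsupport hz
      exact ((hasFDerivAt_const (0 : ℝ) x).congr_of_eventuallyEq this).hasLineDerivAt v
    exact (hd x).lineDeriv.symm.trans h0.lineDeriv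
  have hsupp : ∀ k (g : D → ℝ), (∀ x, x ∉ tsupport η → g x = 0) → ∀ x, x ∉ K →
      convolution ((φ k).normed μ) g (ContinuousLinearMap.lsmul ℝ ℝ) μ x = 0 := by
    intro k g hg x hx
    by_contra hne
    obtain ⟨s, hs1, t, ht, rfl⟩ := support_convolution_subset _ hne
    apply hx
    rw [(φ k).support_normed_eq, mem_ball_zero_iff] at hs1
    have ht' : t ∈ tsupport η := by by_contra h; exact ht (hg t h)
    apply Metric.mem_cthickening_of_dist_le (s + t) t δ _ ht'
    rw [dist_eq_norm, add_sub_cancel_right]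
    exact (hs1.trans (hφδ k)).le
  have he0 : ∀ k x, x ∉ K → e k x = 0 := fun k =>
    hsupp k η fun x hx => image_eq_zero_of_notMem_tsupport hx
  have hc0 : ∀ k x, x ∉ K → c k x = 0 := fun k => hsupp k κ hκ0
  have hets : ∀ k, tsupport (e k) ⊆ K := fun k =>
    closure_minimal (fun x hx => by by_contra h'; exact hx (he0 k x h')) hKc.isClosed
  have hec : ∀ k, ContDiff ℝ ∞ (e k) := fun k =>
    (φ k).hasCompactSupport_normed.contDiff_convolution_left _ (φ k).contDiff_normed
      hη.locallyIntegrable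
  have hid : ∀ k, ∫ x in U, e k x • G x ∂μ = -∫ x in U, c k x • w x ∂μ := by
    intro k
    rw [h (e k) (hec k) (hKc.of_isClosed_subset (isClosed_tsupport _) (hets k))
      ((hets k).trans hδU)]
    congr 2
    ext x
    rw [fderiv_normed_convolution_apply (φ k) hη hκl hd]
  have hcm : ∀ k, Continuous (c k) := fun k =>
    (φ k).hasCompactSupport_normed.continuous_convolution_left _ (φ k).continuous_normed hκl
  have hlim : ∀ (A : D → B) (q : ℕ → D → ℝ) (q' : D → ℝ) (L : ℝ), IntegrableOn A K μ →
      (∀ k, Continuous (q k)) → (∀ k x, ‖q k x‖ ≤ L) → (∀ k x, x ∉ K → q k x = 0) →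
      AEStronglyMeasurable A (μ.restrict U) →
      (∀ᵐ x ∂μ, Tendsto (fun k => q k x) atTop (𝓝 (q' x))) →
      Tendsto (fun k => ∫ x in U, q k x • A x ∂μ) atTop (𝓝 (∫ x in U, q' x • A x ∂μ)) := by
    intro A q q' L hA hq hL hq0 hAm hlim
    refine tendsto_integral_of_dominated_convergence (K.indicator fun x => L * ‖A x‖)
      (fun k => (hq k).aestronglyMeasurable.smul hAm) ?_ ?_ ?_
    · exact ((integrable_indicator_iff hKc.measurableSet).2 (hA.norm.const_mul L)).restrict
    · intro k
      refine Eventually.of_forall fun x => ?_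
      by_cases hx : x ∈ K
      · rw [indicator_of_mem hx, norm_smul]
        exact mul_le_mul_of_nonneg_right (hL k x) (norm_nonneg _)
      · rw [indicator_of_notMem hx, hq0 k x hx, zero_smul, norm_zero]
    · exact ae_restrict_of_ae (hlim.mono fun x hx => hx.smul_const _)
  have l1 := hlim G e η N (hG.integrableOn_compact_subset hδU hKc)
    (fun k => (hec k).continuous) (fun k x => norm_normed_convolution_le (φ k) hN x) he0
    hG.aestronglyMeasurable
    (ContDiffBump.ae_convolution_tendsto_right_of_locallyIntegrable hφ0 hφr hη.locallyIntegrable)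
  have l2 := hlim w c κ M ((hw.mono hδU).integrableOn_compact hKc)
    hcm (fun k x => norm_normed_convolution_le (φ k) hκ x) hc0
    (hw.aestronglyMeasurable hU.measurableSet)
    (ContDiffBump.ae_convolution_tendsto_right_of_locallyIntegrable hφ0 hφr hκl)
  simp_rw [hid] at l1
  exact tendsto_nhds_unique l1 l2.neg

end IntegrationByParts

/-! ### Calculus of weak gradients. -/

section WeakGradient

variable {n : ℕ} {U : Set (E n × ℝ)} {φ : E n × ℝ → ℝ}

theorem continuous_grad {η : E n × ℝ → ℝ} (hη : ContDiff ℝ 1 η) : Continuous (grad η) :=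
  (toV n).continuous.comp (hη.continuous_fderiv one_ne_zero)

theorem continuousOn_grad {η : E n × ℝ → ℝ} (hU : IsOpen U) (hη : ContDiffOn ℝ 1 η U) :
    ContinuousOn (grad η) U :=
  (toV n).continuous.comp_continuousOn (hη.continuousOn_fderiv_of_isOpen hU le_rfl)

theorem tsupport_grad_subset (η : E n × ℝ → ℝ) : tsupport (grad η) ⊆ tsupport η := by
  refine closure_minimal (fun x hx => ?_) (isClosed_tsupport _)
  by_contra h
  exact hx (by rw [grad_eq, show fderiv ℝ η x = 0 from image_eq_zero_of_notMem_tsupport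
    (fun h' => h (tsupport_fderiv_subset ℝ h')), map_zero])

/-- A locally integrable field times a continuous, compactly supported function. -/
theorem integrableOn_smul_of_tsupport_subset {B : Type*} [NormedAddCommGroup B] [NormedSpace ℝ B]
    {G : E n × ℝ → B} (hG : LocallyIntegrableOn G U) {η : E n × ℝ → ℝ} (hη : Continuous η)
    (hc : HasCompactSupport η) (hs : tsupport η ⊆ U) : IntegrableOn (fun X => η X • G X) U := by
  obtain ⟨N, hN⟩ := hη.bounded_above_of_compact_support hc
  have h1 : IntegrableOn G (tsupport η) := hG.integrableOn_compact_subset hs hc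
  have h2 : IntegrableOn (fun X => η X • G X) (tsupport η) :=
    h1.bdd_smul N hη.aestronglyMeasurable (Eventually.of_forall hN)
  refine (integrableOn_iff_integrable_of_support_subset (f := fun X => η X • G X) ?_).1 h2
    |>.integrableOn
  intro X hX
  by_contra h
  exact hX (by simp [image_eq_zero_of_notMem_tsupport h])

theorem integrableOn_smul_grad {φ : E n × ℝ → ℝ} (hφ : LocallyIntegrableOn φ U)
    {η : E n × ℝ → ℝ} (hη : ContDiff ℝ 1 η) (hc : HasCompactSupport η) (hs : tsupport η ⊆ U) :
    IntegrableOn (fun X => φ X • grad η X) U := by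
  have h1 : IntegrableOn (fun X => φ X • grad η X) (tsupport η) :=
    (hφ.integrableOn_compact_subset hs hc).smul_continuousOn (continuous_grad hη).continuousOn hc
  refine (integrableOn_iff_integrable_of_support_subset (f := fun X => φ X • grad η X) ?_).1 h1
    |>.integrableOn
  intro X hX
  by_contra h
  exact hX (by
    show φ X • grad η X = 0
    rw [image_eq_zero_of_notMem_tsupport (f := grad η) fun h' => h (tsupport_grad_subset η h'),
      smul_zero])

theorem hasWeakGradient_iff (hφ : LocallyIntegrableOn φ U) {G : E n × ℝ → V n}
    (hG : LocallyIntegrableOn G U) : HasWeakGradient U φ G ↔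
      ∀ η : E n × ℝ → ℝ, ContDiff ℝ ∞ η → HasCompactSupport η → tsupport η ⊆ U → ∀ ξ : V n,
        ∫ X in U, φ X * fderiv ℝ η X (WithLp.ofLp ξ) = -∫ X in U, η X * ⟪G X, ξ⟫ := by
  have key : ∀ η : E n × ℝ → ℝ, ContDiff ℝ ∞ η → HasCompactSupport η → tsupport η ⊆ U →
      ∀ ξ : V n, (∫ X in U, φ X * fderiv ℝ η X (WithLp.ofLp ξ) = ⟪ξ, ∫ X in U, φ X • grad η X⟫ ∧
        ∫ X in U, η X * ⟪G X, ξ⟫ = ⟪ξ, ∫ X in U, η X • G X⟫) := by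
    intro η hη hc hs ξ
    rw [← integral_inner (integrableOn_smul_grad hφ (hη.of_le (by exact_mod_cast le_top)) hc hs),
      ← integral_inner (integrableOn_smul_of_tsupport_subset hG hη.continuous hc hs)]
    constructor
    · congr 1; ext X; rw [real_inner_smul_right, real_inner_comm, inner_grad]
    · congr 1; ext X; rw [real_inner_smul_right, real_inner_comm]
  constructor
  · intro h η hη hc hs ξ
    rw [(key η hη hc hs ξ).1, (key η hη hc hs ξ).2, h.integral_eq η hη hc hs, inner_neg_right]
  · intro h
    refine ⟨hφ, hG, fun η hη hc hs => ext_inner_left ℝ fun ξ => ?_⟩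
    rw [← (key η hη hc hs ξ).1, h η hη hc hs ξ, (key η hη hc hs ξ).2, inner_neg_right]

theorem hasWeakGradient_grad (hU : IsOpen U) {φ : E n × ℝ → ℝ} (hφ : ContDiffOn ℝ 1 φ U) :
    HasWeakGradient U φ (grad φ) := by
  rw [hasWeakGradient_iff (hφ.continuousOn.locallyIntegrableOn hU.measurableSet)
    ((continuousOn_grad hU hφ).locallyIntegrableOn hU.measurableSet)]
  intro η hη hc hs ξ
  rw [setIntegral_mul_fderiv_eq_neg hU hφ (hη.of_le (by exact_mod_cast le_top)) hc hs]
  simp_rw [inner_grad]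

/-- Leibniz rule: test the weak gradient of `φ` with `θη` and separate the two terms of its
derivative. -/
theorem HasWeakGradient.mul_left (hU : IsOpen U) {φ : E n × ℝ → ℝ} {G : E n × ℝ → V n}
    (h : HasWeakGradient U φ G) {θ : E n × ℝ → ℝ} (hθ : ContDiff ℝ ∞ θ) :
    HasWeakGradient U (fun X => θ X * φ X) (fun X => θ X • G X + φ X • grad θ X) := by
  have h1 : ContDiff ℝ 1 θ := hθ.of_le (by exact_mod_cast le_top)
  have hl : IsLocallyClosed U := hU.isLocallyClosed
  have hc1 : LocallyIntegrableOn (fun X => θ X • G X) U :=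
    h.locallyIntegrable_grad.continuousOn_smul hl h1.continuous.continuousOn
  have hc2 : LocallyIntegrableOn (fun X => φ X • grad θ X) U :=
    h.locallyIntegrable.smul_continuousOn hl (continuous_grad h1).continuousOn
  refine (hasWeakGradient_iff (h.locallyIntegrable.continuousOn_mul h1.continuous.continuousOn hl)
    (hc1.add hc2)).2 ?_
  intro η hη hc hs ξ
  have hsub : tsupport (fun X => θ X * η X) ⊆ tsupport η := tsupport_mul_subset_right
  have hη1 : ContDiff ℝ 1 η := hη.of_le (by exact_mod_cast le_top)
  have := (hasWeakGradient_iff h.locallyIntegrable h.locallyIntegrable_grad).1 h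
    (fun X => θ X * η X) (hθ.mul hη) hc.mul_left (hsub.trans hs) ξ
  have hfd : ∀ X, fderiv ℝ (fun X => θ X * η X) X (WithLp.ofLp ξ)
      = θ X * fderiv ℝ η X (WithLp.ofLp ξ) + η X * fderiv ℝ θ X (WithLp.ofLp ξ) := by
    intro X
    rw [fderiv_fun_mul (h1.differentiable one_ne_zero X) (hη1.differentiable one_ne_zero X)]
    simp
  have i1 : IntegrableOn (fun X => θ X * φ X * fderiv ℝ η X (WithLp.ofLp ξ)) U := by
    have := (integrableOn_smul_grad (h.locallyIntegrable.continuousOn_mul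
      h1.continuous.continuousOn hl) hη1 hc hs).inner_const (𝕜 := ℝ) ξ
    refine this.congr (Eventually.of_forall fun X => ?_)
    simp only [real_inner_smul_left, inner_grad]
  have i2 : IntegrableOn (fun X => η X * (φ X * fderiv ℝ θ X (WithLp.ofLp ξ))) U := by
    have := (integrableOn_smul_of_tsupport_subset hc2 hη.continuous hc hs).inner_const (𝕜 := ℝ) ξ
    refine this.congr (Eventually.of_forall fun X => ?_)
    simp only [real_inner_smul_left, inner_grad]
  have i3 : IntegrableOn (fun X => η X * (θ X * ⟪G X, ξ⟫)) U := by
    have := (integrableOn_smul_of_tsupport_subset hc1 hη.continuous hc hs).inner_const (𝕜 := ℝ) ξ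
    refine this.congr (Eventually.of_forall fun X => ?_)
    simp only [real_inner_smul_left]
  have e1 : ∫ X in U, φ X * fderiv ℝ (fun X => θ X * η X) X (WithLp.ofLp ξ)
      = (∫ X in U, θ X * φ X * fderiv ℝ η X (WithLp.ofLp ξ))
        + ∫ X in U, η X * (φ X * fderiv ℝ θ X (WithLp.ofLp ξ)) := by
    rw [← integral_add i1 i2]
    congr 1; ext X; rw [hfd]; ring
  have e2 : ∫ X in U, η X * ⟪((fun X => θ X • G X) + fun X => φ X • grad θ X) X, ξ⟫
      = (∫ X in U, η X * (θ X * ⟪G X, ξ⟫))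
        + ∫ X in U, η X * (φ X * fderiv ℝ θ X (WithLp.ofLp ξ)) := by
    rw [← integral_add i3 i2]
    congr 1; ext X; rw [Pi.add_apply, inner_add_left, real_inner_smul_left, real_inner_smul_left, inner_grad]
    ring
  have e3 : ∫ X in U, θ X * η X * ⟪G X, ξ⟫ = ∫ X in U, η X * (θ X * ⟪G X, ξ⟫) := by
    congr 1; ext X; ring
  rw [e1, e3] at this
  rw [e2]
  linarith

/-- If `∂ᵥw` has the weak gradient `G`, then `G` is the weak derivative of `∇w` in the direction
`v`. -/
theorem HasWeakGradient.setIntegral_smul_eq_neg (hU : IsOpen U) {w : E n × ℝ → ℝ} {v : E n × ℝ}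
    {G : E n × ℝ → V n} (hw : ContDiffOn ℝ 1 w U)
    (h : HasWeakGradient U (fun X => fderiv ℝ w X v) G) {η κ : E n × ℝ → ℝ} (hη : Continuous η)
    (hc : HasCompactSupport η) (hs : tsupport η ⊆ U) (hκm : AEStronglyMeasurable κ)
    {M : ℝ} (hκ : ∀ X, |κ X| ≤ M) (hd : ∀ X, HasLineDerivAt ℝ η (κ X) X v) :
    ∫ X in U, η X • G X = -∫ X in U, κ X • grad w X := by
  refine setIntegral_smul_eq_neg_of_hasLineDerivAt hU (continuousOn_grad hU hw)
    h.locallyIntegrable_grad ?_ hη hc hs hκm hκ hd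
  intro η hη hc hs
  have hη2 : ContDiff ℝ 2 η := contDiff_infty.1 hη 2
  have hηv : ContDiff ℝ 1 fun X => fderiv ℝ η X v :=
    (hη2.fderiv_right (m := 1) (by norm_num)).clm_apply contDiff_const
  have hcv : HasCompactSupport fun X => fderiv ℝ η X v := hc.fderiv_apply (𝕜 := ℝ) v
  have hsv : tsupport (fun X => fderiv ℝ η X v) ⊆ tsupport η := tsupport_fderiv_apply_subset ℝ v
  have hg := (hasWeakGradient_iff h.locallyIntegrable h.locallyIntegrable_grad).1 h η hη hc hs
  have i1 := integrableOn_smul_of_tsupport_subset h.locallyIntegrable_grad hη.continuous hc hs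
  have i2 := integrableOn_smul_of_tsupport_subset
    ((continuousOn_grad hU hw).locallyIntegrableOn hU.measurableSet) hηv.continuous hcv
    (hsv.trans hs)
  refine ext_inner_left ℝ fun ξ => ?_
  rw [inner_neg_right, ← integral_inner i1, ← integral_inner i2]
  have hcξ : HasCompactSupport fun X => fderiv ℝ η X (WithLp.ofLp ξ) :=
    hc.fderiv_apply (𝕜 := ℝ) _
  have hsξ : tsupport (fun X => fderiv ℝ η X (WithLp.ofLp ξ)) ⊆ tsupport η :=
    tsupport_fderiv_apply_subset ℝ _
  have hηξ : ContDiff ℝ 1 fun X => fderiv ℝ η X (WithLp.ofLp ξ) :=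
    (hη2.fderiv_right (m := 1) (by norm_num)).clm_apply contDiff_const
  -- `w` has only one derivative, so the second one must sit on the test function: integrate by
  -- parts twice and exchange the order of differentiation of `η` in between.
  have a1 := setIntegral_mul_fderiv_eq_neg (μ := volume) hU hw hηv hcv (hsv.trans hs)
    (WithLp.ofLp ξ)
  have a2 := setIntegral_mul_fderiv_eq_neg (μ := volume) hU hw hηξ hcξ (hsξ.trans hs) v
  have hsymm : ∀ X, fderiv ℝ (fun X => fderiv ℝ η X v) X (WithLp.ofLp ξ)
      = fderiv ℝ (fun X => fderiv ℝ η X (WithLp.ofLp ξ)) X v := by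
    intro X
    have hdf : DifferentiableAt ℝ (fderiv ℝ η) X :=
      (hη2.fderiv_right (m := 1) (by norm_num)).differentiable one_ne_zero X
    have hsy := (hη2.contDiffAt (x := X)).isSymmSndFDerivAt (by simp)
    rw [fderiv_clm_apply hdf (by fun_prop), fderiv_clm_apply hdf (by fun_prop)]
    simpa using hsy (WithLp.ofLp ξ) v
  simp_rw [hsymm] at a1
  simp only [fun x => real_inner_comm x ξ, real_inner_smul_left, inner_grad]
  have b := hg ξ
  simp_rw [mul_comm (fderiv ℝ w _ v)] at b
  rw [a1] at a2
  linarith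

end WeakGradient

/-! ### Defining functions, tangent directions and curvature of `∂Ω`. -/

section Boundary

variable {n : ℕ} {Ω : Set (E n)}

theorem eventually_lt_of_fderiv_pos {ρ : E n → ℝ} {p w : E n} (hρ : DifferentiableAt ℝ ρ p)
    (h : 0 < fderiv ℝ ρ p w) : ∀ᶠ s : ℝ in 𝓝[>] 0, ρ p < ρ (p + s • w) := by
  have h1 : HasDerivAt (fun s : ℝ => ρ (p + s • w)) (fderiv ℝ ρ p w) 0 :=
    hρ.hasFDerivAt.hasLineDerivAt w
  have h2 := h1.tendsto_slope_zero_right.eventually (lt_mem_nhds h)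
  filter_upwards [h2, self_mem_nhdsWithin] with s hs hs0
  have hs0' : 0 < s := hs0
  simp only [zero_add, zero_smul, add_zero, smul_eq_mul] at hs
  have := (mul_pos_iff_of_pos_left (inv_pos.2 hs0')).1 hs
  linarith

theorem eventually_lt_of_fderiv_neg {ρ : E n → ℝ} {p w : E n} (hρ : DifferentiableAt ℝ ρ p)
    (h : fderiv ℝ ρ p w < 0) : ∀ᶠ s : ℝ in 𝓝[>] 0, ρ (p + s • w) < ρ p := by
  have := eventually_lt_of_fderiv_pos (ρ := fun x => -ρ x) (w := w) hρ.fun_neg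
    (by rw [fderiv_fun_neg]; simpa using h)
  simpa using this

/-- The value is not negative because `p ∉ Ω`, and not positive because `p` is a limit of points of
`Ω`. -/
theorem IsLocalDefiningFunction.eq_zero (hΩ : IsOpen Ω) {p : E n} (hp : p ∈ frontier Ω)
    {ρ : E n → ℝ} (hρ : IsLocalDefiningFunction Ω p ρ) (hc : ContinuousAt ρ p) : ρ p = 0 := by
  have hpΩ : p ∉ Ω := fun h => (hΩ.inter_frontier_eq.subset ⟨h, hp⟩).elim
  have h1 : ¬ ρ p < 0 := fun h => hpΩ (hρ.2.self_of_nhds.2 h)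
  have h2 : ρ p ≤ 0 := by
    have hf : ∃ᶠ x in 𝓝 p, ρ x < 0 := by
      have := mem_closure_iff_frequently.1 (frontier_subset_closure hp)
      exact (this.and_eventually hρ.2).mono fun x hx => hx.2.1 hx.1
    exact le_of_tendsto_of_frequently hc (hf.mono fun x hx => hx.le)
  exact le_antisymm h2 (not_lt.1 h1)

/-- The outer normal direction makes an acute angle with the directions that come from the inside
of a convex set. -/
theorem IsLocalDefiningFunction.fderiv_sub_pos (hΩ : IsOpen Ω) (hconv : Convex ℝ Ω) {p x₀ : E n}
    (hp : p ∈ frontier Ω) (hx₀ : x₀ ∈ Ω) {ρ : E n → ℝ} (hρ : IsLocalDefiningFunction Ω p ρ)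
    (hd : DifferentiableAt ℝ ρ p) : 0 < fderiv ℝ ρ p (p - x₀) := by
  have hp0 := hρ.eq_zero hΩ hp hd.continuousAt
  -- Otherwise `ρ` would be positive just after `p` on the segment towards `x`, whose points lie in
  -- `Ω` by convexity.
  have key : ∀ x ∈ Ω, fderiv ℝ ρ p (x - p) ≤ 0 := by
    intro x hx
    by_contra! hlt
    have h1 := eventually_lt_of_fderiv_pos hd hlt
    have h2 : Tendsto (fun s : ℝ => p + s • (x - p)) (𝓝[>] 0) (𝓝 p) := by
      have : Continuous fun s : ℝ => p + s • (x - p) := by fun_prop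
      simpa using (this.tendsto 0).mono_left nhdsWithin_le_nhds
    obtain ⟨s, hs1, hs2, hs3⟩ := (h1.and ((h2.eventually hρ.2).and
      (Ioc_mem_nhdsGT (zero_lt_one' ℝ)))).exists
    have hm := hconv.add_smul_sub_mem_interior' (frontier_subset_closure hp)
      (by rwa [hΩ.interior_eq]) hs3
    rw [hΩ.interior_eq] at hm
    linarith [hs2.1 hm]
  -- Strictness comes from openness: `x₀` may be pushed a little along `∇ρ(p)` inside `Ω`, which
  -- leaves the margin `s |∇ρ(p)|²` in the previous inequality.
  have h3 : Tendsto (fun s : ℝ => x₀ + s • gradient ρ p) (𝓝[>] 0) (𝓝 x₀) := by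
    have : Continuous fun s : ℝ => x₀ + s • gradient ρ p := by fun_prop
    simpa using (this.tendsto 0).mono_left nhdsWithin_le_nhds
  obtain ⟨s, hs, hs0⟩ := ((h3.eventually (hΩ.mem_nhds hx₀)).and self_mem_nhdsWithin).exists
  have h4 := key _ hs
  have h5 : x₀ + s • gradient ρ p - p = s • gradient ρ p - (p - x₀) := by abel
  rw [h5, map_sub, map_smul, ← inner_gradient_left, real_inner_self_eq_norm_sq, smul_eq_mul] at h4
  have h6 : 0 < s * ‖gradient ρ p‖ ^ 2 := mul_pos hs0 (by have := norm_pos_iff.2 hρ.1; positivity)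
  linarith

/-- `ρ` is a global defining function of `Ω`. -/
structure IsDefiningFunction (Ω : Set (E n)) (ρ : E n → ℝ) : Prop where
  contDiff : ContDiff ℝ 2 ρ
  mem_iff : ∀ x, x ∈ Ω ↔ ρ x < 0
  gradient_ne_zero : ∀ p ∈ frontier Ω, gradient ρ p ≠ 0

theorem IsDefiningFunction.isLocal {ρ : E n → ℝ} (h : IsDefiningFunction Ω ρ) {p : E n}
    (hp : p ∈ frontier Ω) : IsLocalDefiningFunction Ω p ρ :=
  ⟨h.gradient_ne_zero p hp, Eventually.of_forall h.mem_iff⟩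

theorem IsDefiningFunction.differentiable {ρ : E n → ℝ} (h : IsDefiningFunction Ω ρ) :
    Differentiable ℝ ρ := h.contDiff.differentiable two_ne_zero

theorem IsDefiningFunction.eq_zero {ρ : E n → ℝ} (h : IsDefiningFunction Ω ρ) (hΩ : IsOpen Ω)
    {p : E n} (hp : p ∈ frontier Ω) : ρ p = 0 :=
  (h.isLocal hp).eq_zero hΩ hp (h.differentiable p).continuousAt

theorem IsDefiningFunction.fderiv_sub_pos {ρ : E n → ℝ} (h : IsDefiningFunction Ω ρ)
    (hΩ : IsOpen Ω) (hconv : Convex ℝ Ω) {p x₀ : E n} (hp : p ∈ frontier Ω) (hx₀ : x₀ ∈ Ω) :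
    0 < fderiv ℝ ρ p (p - x₀) :=
  (h.isLocal hp).fderiv_sub_pos hΩ hconv hp hx₀ (h.differentiable p)

/-- Local defining functions are glued with nonnegative bumps, which preserves their signs;
subtracting a smooth `θ ≥ 0` that vanishes exactly off `Ω` makes the result negative throughout `Ω`.
The gradients cannot cancel at a boundary point `q`: by convexity every local function that is
active there has positive derivative in the common direction `q - x₀`, and `θ` is minimal at `q`. -/
theorem exists_isDefiningFunction (hΩ : IsOpen Ω) (hbdd : Bornology.IsBounded Ω)
    (hconv : Convex ℝ Ω) {x₀ : E n} (hx₀ : x₀ ∈ Ω)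
    (hreg : ∀ p ∈ frontier Ω, ∃ ρ : E n → ℝ, ContDiff ℝ 2 ρ ∧ IsLocalDefiningFunction Ω p ρ) :
    ∃ ρ, IsDefiningFunction Ω ρ := by
  have hloc : ∀ p : frontier Ω, ∃ (ρ : E n → ℝ) (r : ℝ), 0 < r ∧ ContDiff ℝ 2 ρ ∧
      ∀ x ∈ Metric.ball (p : E n) r, gradient ρ x ≠ 0 ∧ (x ∈ Ω ↔ ρ x < 0) := by
    rintro ⟨p, hp⟩
    obtain ⟨ρ, hρ, hg, hd⟩ := hreg p hp
    have hcont : Continuous (gradient ρ) :=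
      (InnerProductSpace.toDual ℝ (E n)).symm.continuous.comp
        (hρ.continuous_fderiv two_ne_zero)
    obtain ⟨r, hr, hball⟩ := Metric.eventually_nhds_iff_ball.1
      ((hcont.continuousAt.eventually_ne hg).and hd)
    exact ⟨ρ, r, hr, hρ, hball⟩
  choose ρ r hr hρ hball using hloc
  let b : ∀ p : frontier Ω, ContDiffBump (p : E n) := fun p =>
    ⟨r p / 3, r p / 2, by have := hr p; positivity, by have := hr p; linarith⟩
  have hcpt : IsCompact (frontier Ω) :=
    Metric.isCompact_of_isClosed_isBounded isClosed_frontier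
      (hbdd.closure.subset frontier_subset_closure)
  obtain ⟨t, ht⟩ := hcpt.elim_nhds_subcover'
    (fun x hx => Metric.ball x (r ⟨x, hx⟩ / 3)) fun x hx =>
      Metric.ball_mem_nhds x (by have := hr ⟨x, hx⟩; positivity)
  obtain ⟨θ, hθc, hθr, hθ0, -⟩ := exists_contMDiff_zero_iff_one_iff_of_isClosed (n := ⊤)
    (modelWithCornersSelf ℝ (E n)) hΩ.isClosed_compl isClosed_empty (disjoint_empty _)
  have hθc' : ContDiff ℝ 2 θ := contDiff_infty.1 hθc.contDiff 2
  have hθn : ∀ x, 0 ≤ θ x := fun x => (hθr ⟨x, rfl⟩).1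
  have hbc : ∀ p, ContDiff ℝ 2 (b p) := fun p => (b p).contDiff
  have hmem : ∀ p x, b p x ≠ 0 → x ∈ Metric.ball (p : E n) (r p) := by
    intro p x hx
    have : x ∈ Function.support (b p) := hx
    rw [(b p).support_eq] at this
    exact Metric.ball_subset_ball (by change r p / 2 ≤ r p; linarith [hr p]) this
  let R : E n → ℝ := fun x => (∑ p ∈ t, b p x * ρ p x) - θ x
  have hRc : ContDiff ℝ 2 R :=
    (ContDiff.sum fun p _ => (hbc p).mul (hρ p)).sub hθc'
  refine ⟨R, hRc, fun x => ⟨fun hx => ?_, fun hx => ?_⟩, fun q hq => ?_⟩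
  · have h1 : ∑ p ∈ t, b p x * ρ p x ≤ 0 := Finset.sum_nonpos fun p _ => by
      by_cases hb : b p x = 0
      · simp [hb]
      · exact mul_nonpos_of_nonneg_of_nonpos (b p).nonneg
          (((hball p x (hmem p x hb)).2.1 hx).le)
    have h2 : 0 < θ x := lt_of_le_of_ne (hθn x) fun h => ((hθ0 x).2 h.symm) hx
    show (∑ p ∈ t, b p x * ρ p x) - θ x < 0
    linarith
  · by_contra hxΩ
    have h1 : 0 ≤ ∑ p ∈ t, b p x * ρ p x := Finset.sum_nonneg fun p _ => by
      by_cases hb : b p x = 0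
      · simp [hb]
      · exact mul_nonneg (b p).nonneg
          (not_lt.1 fun h => hxΩ ((hball p x (hmem p x hb)).2.2 h))
    have h2 : θ x = 0 := (hθ0 x).1 hxΩ
    have h3 : (∑ p ∈ t, b p x * ρ p x) - θ x < 0 := hx
    linarith
  · have hqΩ : q ∉ Ω := fun h => (hΩ.inter_frontier_eq.subset ⟨h, hq⟩).elim
    have hθd : fderiv ℝ θ q = 0 := by
      apply IsLocalMin.fderiv_eq_zero
      have h2 : θ q = 0 := (hθ0 q).1 hqΩ
      exact Eventually.of_forall fun x => h2 ▸ hθn x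
    have hderiv : fderiv ℝ R q (q - x₀) = ∑ p ∈ t, (b p q * fderiv ℝ (ρ p) q (q - x₀)
        + ρ p q * fderiv ℝ (b p) q (q - x₀)) := by
      have hd1 : ∀ p ∈ t, DifferentiableAt ℝ (fun x => b p x * ρ p x) q := fun p _ =>
        (((hbc p).mul (hρ p)).differentiable two_ne_zero) q
      have e1 : fderiv ℝ R q = fderiv ℝ (fun x => ∑ p ∈ t, b p x * ρ p x) q - fderiv ℝ θ q :=
        fderiv_fun_sub (DifferentiableAt.fun_sum hd1) (hθc'.differentiable two_ne_zero q)
      rw [e1, hθd, sub_zero, fderiv_fun_sum hd1, sum_apply]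
      refine Finset.sum_congr rfl fun p _ => ?_
      rw [fderiv_fun_mul ((hbc p).differentiable two_ne_zero q)
        ((hρ p).differentiable two_ne_zero q)]
      simp
    have hterm : ∀ p, (0 ≤ b p q * fderiv ℝ (ρ p) q (q - x₀)
        + ρ p q * fderiv ℝ (b p) q (q - x₀)) ∧ (b p q ≠ 0 → 0 < b p q * fderiv ℝ (ρ p) q (q - x₀)
        + ρ p q * fderiv ℝ (b p) q (q - x₀)) := by
      intro p
      -- An inactive bump is at its minimum, so its derivative vanishes too. For an active one, `ρ p
      -- q = 0` removes the derivative of the bump.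
      by_cases hb : b p q = 0
      · have : fderiv ℝ (b p) q = 0 := IsLocalMin.fderiv_eq_zero
          (Eventually.of_forall fun x => hb ▸ (b p).nonneg)
        simp [hb, this]
      · have hqb := hmem p q hb
        have hl : IsLocalDefiningFunction Ω q (ρ p) :=
          ⟨(hball p q hqb).1, by
            filter_upwards [Metric.isOpen_ball.mem_nhds hqb] with x hx using (hball p x hx).2⟩
        have hdq : DifferentiableAt ℝ (ρ p) q := (hρ p).differentiable two_ne_zero q
        have h0 := hl.eq_zero hΩ hq hdq.continuousAt
        have h1 := hl.fderiv_sub_pos hΩ hconv hq hx₀ hdq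
        have h2 : 0 < b p q * fderiv ℝ (ρ p) q (q - x₀)
            + ρ p q * fderiv ℝ (b p) q (q - x₀) := by
          rw [h0, zero_mul, add_zero]
          exact mul_pos (lt_of_le_of_ne (b p).nonneg (Ne.symm hb)) h1
        exact ⟨h2.le, fun _ => h2⟩
    obtain ⟨p, hpt, hpq⟩ : ∃ p ∈ t, q ∈ Metric.ball (p : E n) (r p / 3) := by
      have := ht hq
      simp only [mem_iUnion] at this
      obtain ⟨p, hp, h⟩ := this
      exact ⟨p, hp, h⟩
    have hb1 : b p q = 1 := (b p).one_of_mem_closedBall (Metric.ball_subset_closedBall hpq)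
    have hpos : 0 < fderiv ℝ R q (q - x₀) := by
      rw [hderiv]
      exact Finset.sum_pos' (fun p _ => (hterm p).1)
        ⟨p, hpt, (hterm p).2 (by rw [hb1]; exact one_ne_zero)⟩
    intro hgrad
    rw [← inner_gradient_left, hgrad, inner_zero_left] at hpos
    exact lt_irrefl _ hpos

/-- The tangent hyperplane is contained in the tangent cone of the boundary. -/
theorem IsDefiningFunction.mem_tangentConeAt {ρ : E n → ℝ} (h : IsDefiningFunction Ω ρ)
    (hΩ : IsOpen Ω) {p v : E n} (hp : p ∈ frontier Ω) (hv : fderiv ℝ ρ p v = 0) :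
    v ∈ tangentConeAt ℝ (frontier Ω) p := by
  have hd := h.differentiable p
  have hp0 := h.eq_zero hΩ hp
  set e := gradient ρ p with he
  have hee : 0 < fderiv ℝ ρ p e := by
    rw [← inner_gradient_left, real_inner_self_eq_norm_sq]
    have := norm_pos_iff.2 (h.gradient_ne_zero p hp)
    positivity
  -- For small `s` the points `p + s (v ± d e)` lie on opposite sides of the boundary, so the
  -- connected segment between them meets the frontier. The crossing parameter is the correction
  -- `c`.
  have key : ∀ k : ℕ, ∃ s c : ℝ, 0 < s ∧ s < 1 / ((k : ℝ) + 1) ∧ |c| ≤ 1 / ((k : ℝ) + 1) ∧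
      p + s • (v + c • e) ∈ frontier Ω := by
    intro k
    set d : ℝ := 1 / ((k : ℝ) + 1) with hd'
    have hd0 : 0 < d := by positivity
    have h1 : fderiv ℝ ρ p (v + d • e) > 0 := by
      rw [map_add, hv, map_smul, zero_add]; exact mul_pos hd0 hee
    have h2 : fderiv ℝ ρ p (v + (-d) • e) < 0 := by
      rw [map_add, hv, map_smul, zero_add, smul_eq_mul]; nlinarith
    obtain ⟨s, hs1, hs2, hs3⟩ := ((eventually_lt_of_fderiv_pos hd h1).and
      ((eventually_lt_of_fderiv_neg hd h2).and (Ioo_mem_nhdsGT hd0))).exists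
    rw [hp0] at hs1 hs2
    let γ : ℝ → E n := fun c => p + s • (v + c • e)
    have hγ : Continuous γ := by fun_prop
    by_contra! hcon
    have hsub : Icc (-d) d ⊆ γ ⁻¹' Ω ∪ γ ⁻¹' (interior Ωᶜ) := by
      intro c hc
      have := hcon s c hs3.1 hs3.2 (abs_le.2 hc)
      by_cases hcΩ : γ c ∈ Ω
      · exact Or.inl hcΩ
      · right
        show γ c ∈ interior Ωᶜ
        rw [interior_compl]
        intro hcl
        exact this (by rw [hΩ.frontier_eq]; exact ⟨hcl, hcΩ⟩)
    have hdd : -d ≤ d := by linarith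
    have := isPreconnected_iff_subset_of_disjoint.1 isPreconnected_Icc _ _ (hΩ.preimage hγ)
      (isOpen_interior.preimage hγ) hsub (by
        ext c
        simp only [mem_inter_iff, mem_preimage, mem_empty_iff_false, iff_false, not_and]
        intro _ hc1 hc2
        exact interior_subset hc2 hc1)
    rcases this with h3 | h3
    · have : γ d ∈ Ω := h3 (right_mem_Icc.2 hdd)
      linarith [(h.mem_iff _).1 this]
    · exact interior_subset (h3 (left_mem_Icc.2 hdd)) ((h.mem_iff _).2 hs2)
  choose s c hs0 hs1 hc hmem using key
  have hk : Tendsto (fun k : ℕ => 1 / ((k : ℝ) + 1)) atTop (𝓝 0) :=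
    tendsto_one_div_add_atTop_nhds_zero_nat
  have hst : Tendsto s atTop (𝓝 0) :=
    squeeze_zero (fun k => (hs0 k).le) (fun k => (hs1 k).le) hk
  have hct : Tendsto c atTop (𝓝 0) := squeeze_zero_norm hc hk
  have hvc : Tendsto (fun k => v + c k • e) atTop (𝓝 v) := by
    simpa using (hct.smul_const e).const_add v
  refine mem_tangentConeAt_of_seq atTop (fun k => (s k)⁻¹) (fun k => s k • (v + c k • e)) ?_
    (Eventually.of_forall hmem) ?_
  · simpa using hst.smul hvc
  · refine hvc.congr fun k => ?_
    rw [smul_smul, inv_mul_cancel₀ (hs0 k).ne', one_smul]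

/-- If all principal curvatures are positive, the Hessian of a defining function is positive on
tangent vectors. -/
theorem IsDefiningFunction.inner_fderiv_gradient_pos {ρ : E n → ℝ} (h : IsDefiningFunction Ω ρ)
    {p : E n} (hp : p ∈ frontier Ω) (hcurv : ∀ κ : ℝ, IsPrincipalCurvature Ω p κ → 0 < κ)
    {v : E n} (hv : v ≠ 0) (hvt : fderiv ℝ ρ p v = 0) :
    0 < ⟪fderiv ℝ (gradient ρ) p v, v⟫ := by
  have hgc : ContDiff ℝ 1 (gradient ρ) :=
    (InnerProductSpace.toDual ℝ (E n)).symm.toContinuousLinearEquiv.contDiff.comp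
      (h.contDiff.fderiv_right (m := 1) (by norm_num))
  have hgd : DifferentiableAt ℝ (gradient ρ) p := hgc.differentiable one_ne_zero p
  set ν := gradient ρ p with hν
  have hν0 : ν ≠ 0 := h.gradient_ne_zero p hp
  have hνn : 0 < ‖ν‖ := norm_pos_iff.2 hν0
  set A := fderiv ℝ (gradient ρ) p with hA
  have hAin : ∀ v w, ⟪A v, w⟫ = fderiv ℝ (fderiv ℝ ρ) p v w := by
    intro v w
    have e1 : (fun x => ⟪gradient ρ x, w⟫) = fun x => fderiv ℝ ρ x w := by
      ext x; exact inner_gradient_left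
    have hfd : DifferentiableAt ℝ (fderiv ℝ ρ) p :=
      (h.contDiff.fderiv_right (m := 1) (by norm_num)).differentiable one_ne_zero p
    have e2 : fderiv ℝ (fun x => ⟪gradient ρ x, w⟫) p v = fderiv ℝ (fun x => fderiv ℝ ρ x w) p v := by
      rw [e1]
    rw [fderiv_inner_apply ℝ hgd (by fun_prop), fderiv_clm_apply hfd (by fun_prop)] at e2
    simpa using e2
  have hAs : ∀ v w, ⟪A v, w⟫ = ⟪v, A w⟫ := by
    intro v w
    rw [hAin, real_inner_comm, hAin]
    exact (h.contDiff.contDiffAt.isSymmSndFDerivAt (by simp)) v w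
  let T : Submodule ℝ (E n) := (ℝ ∙ ν)ᗮ
  have hT : ∀ w, w ∈ T ↔ ⟪ν, w⟫ = 0 := fun w => Submodule.mem_orthogonal_singleton_iff_inner_right
  -- The Hessian compressed to the tangent hyperplane. It is symmetric and its eigenvalues are `‖ν‖`
  -- times principal curvatures, so the spectral theorem reduces positivity on all tangent vectors
  -- to the hypothesis.
  let S : T →ₗ[ℝ] T := T.orthogonalProjectionOnto.toLinearMap ∘ₗ A.toLinearMap ∘ₗ T.subtype
  have hSin : ∀ x y : T, ⟪S x, y⟫ = ⟪A x, (y : E n)⟫ := fun x y => by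
    simp [S]
  have hSs : S.IsSymmetric := fun x y => calc
    ⟪S x, y⟫ = ⟪A x, (y : E n)⟫ := hSin x y
    _ = ⟪(x : E n), A y⟫ := hAs _ _
    _ = ⟪A y, (x : E n)⟫ := real_inner_comm _ _
    _ = ⟪S y, x⟫ := (hSin y x).symm
    _ = ⟪x, S y⟫ := real_inner_comm _ _
  have heig : ∀ (w : T) (μ : ℝ), w ≠ 0 → S w = μ • w → 0 < μ := by
    intro w μ hw hSw
    have hwt : ⟪ν, (w : E n)⟫ = 0 := (hT w).1 w.2
    have hw0 : (w : E n) ≠ 0 := fun h' => hw (Subtype.ext h')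
    have hκ : IsPrincipalCurvature Ω p (‖ν‖⁻¹ * μ) := by
      refine ⟨ρ, h.contDiff, h.isLocal hp, w, hw0, by rw [real_inner_comm]; exact hwt, ?_⟩
      have hd1 : HasFDerivAt (fun x => ‖gradient ρ x‖)
          ((‖ν‖⁻¹ • innerSL ℝ ν).comp A) p := by
        exact (hasFDerivAt_norm_of_ne_zero hν0).comp p hgd.hasFDerivAt
      have hd2 := (((hasDerivAt_inv hνn.ne').comp_hasFDerivAt p hd1).smul hgd.hasFDerivAt)
      have hd3 : fderiv ℝ (unitNormal ρ) p = _ := HasFDerivAt.fderiv hd2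
      -- `A w` equals `μ w` up to a multiple of `ν`. Differentiating the factor `‖∇ρ‖⁻¹` of the unit
      -- normal contributes exactly the opposite multiple.
      have hproj : A w = μ • (w : E n) + (⟪ν, A w⟫ / ‖ν‖ ^ 2) • ν := by
        have h1 : ((S w : T) : E n) = A w - (⟪ν, A w⟫ / ‖ν‖ ^ 2) • ν := by
          have := Submodule.starProjection_orthogonal_val (K := ℝ ∙ ν) (A w)
          have h3 := Submodule.starProjection_singleton ℝ (v := ν) (A w)
          rw [h3] at this
          exact this
        rw [hSw] at h1
        exact sub_eq_iff_eq_add.1 h1.symm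
      rw [hd3]
      simp only [Function.comp, add_apply, smul_apply,
        ContinuousLinearMap.smulRight_apply, ContinuousLinearMap.comp_apply, innerSL_apply_apply]
      rw [← hν, ← hA]
      generalize hq : ⟪ν, A w⟫ = q at *
      rw [hproj, smul_add, smul_smul, smul_smul, add_assoc, ← add_smul]
      simp only [smul_eq_mul]
      have : ‖ν‖⁻¹ * (q / ‖ν‖ ^ 2) + -(‖ν‖ ^ 2)⁻¹ * (‖ν‖⁻¹ * q) = 0 := by field_simp; ring
      rw [this, zero_smul, add_zero]
    exact (mul_pos_iff_of_pos_left (inv_pos.2 hνn)).1 (hcurv _ hκ)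
  have hvT : v ∈ T := (hT v).2 (by rw [inner_gradient_left]; exact hvt)
  let v' : T := ⟨v, hvT⟩
  let bb := hSs.eigenvectorBasis rfl
  have hv' : v' ≠ 0 := fun h' => hv (congrArg Subtype.val h')
  rw [show ⟪A v, v⟫ = ⟪S v', v'⟫ from (hSin v' v').symm, ← bb.sum_inner_mul_inner]
  have hterm : ∀ i, ⟪S v', bb i⟫ * ⟪bb i, v'⟫ = hSs.eigenvalues rfl i * ⟪bb i, v'⟫ ^ 2 := by
    intro i
    rw [hSs, hSs.apply_eigenvectorBasis, real_inner_smul_right, real_inner_comm (bb i)]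
    simp; ring
  have hpos : ∀ i, 0 < hSs.eigenvalues rfl i := fun i =>
    heig (bb i) _ (bb.orthonormal.ne_zero i) (hSs.apply_eigenvectorBasis rfl i)
  simp_rw [hterm]
  refine Finset.sum_pos' (fun i _ => mul_nonneg (hpos i).le (sq_nonneg _)) ?_
  by_contra! hcon
  apply hv'
  apply bb.repr.injective
  ext i
  rw [bb.repr_apply_apply, map_zero]
  have := hcon i (Finset.mem_univ _)
  have h0 : ⟪bb i, v'⟫ ^ 2 ≤ 0 := by
    by_contra! hlt
    linarith [mul_pos (hpos i) hlt]
  simpa using pow_eq_zero_iff two_ne_zero |>.1 (le_antisymm h0 (sq_nonneg _))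

end Boundary

/-! ### Thin boundary layers in place of surface integrals. -/

section Layer

variable {n : ℕ} {Ω : Set (E n)} {ρ : E n → ℝ}

/-- A smooth monotone function, `0` on `(-∞, 1]` and `1` on `[2, ∞)`. -/
def cutoff (t : ℝ) : ℝ := Real.smoothTransition (t - 1)

theorem contDiff_cutoff {m : ℕ∞} : ContDiff ℝ m cutoff :=
  Real.smoothTransition.contDiff.comp (contDiff_id.sub contDiff_const)

theorem monotone_cutoff : Monotone cutoff := fun _ _ h =>
  Real.smoothTransition.monotone (sub_le_sub_right h 1)

theorem cutoff_nonneg (t : ℝ) : 0 ≤ cutoff t := Real.smoothTransition.nonneg _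

theorem cutoff_le_one (t : ℝ) : cutoff t ≤ 1 := Real.smoothTransition.le_one _

theorem cutoff_of_le {t : ℝ} (h : t ≤ 1) : cutoff t = 0 :=
  Real.smoothTransition.zero_of_nonpos (by linarith)

theorem cutoff_of_ge {t : ℝ} (h : 2 ≤ t) : cutoff t = 1 :=
  Real.smoothTransition.one_of_one_le (by linarith)

theorem deriv_cutoff_nonneg (t : ℝ) : 0 ≤ deriv cutoff t := monotone_cutoff.deriv_nonneg

theorem deriv_cutoff_of_lt {t : ℝ} (h : t < 1) : deriv cutoff t = 0 := by
  have : cutoff =ᶠ[𝓝 t] fun _ => 0 := by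
    filter_upwards [gt_mem_nhds h] with s hs using cutoff_of_le hs.le
  rw [this.deriv_eq, deriv_const]

theorem deriv_cutoff_of_gt {t : ℝ} (h : 2 < t) : deriv cutoff t = 0 := by
  have : cutoff =ᶠ[𝓝 t] fun _ => 1 := by
    filter_upwards [lt_mem_nhds h] with s hs using cutoff_of_ge hs.le
  rw [this.deriv_eq, deriv_const]

theorem continuous_deriv_cutoff : Continuous (deriv cutoff) :=
  (contDiff_cutoff (m := 1)).continuous_deriv le_rfl

/-- Cutoff functions with compact support in `Ω = {ρ < 0}` that increase to `1`. -/
def innerCutoff (ρ : E n → ℝ) (k : ℕ) (x : E n) : ℝ := cutoff (-(((k : ℝ) + 1) * ρ x))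

/-- The derivative of `innerCutoff ρ k` in the direction `v` is `- layerKernel ρ k · ∂ᵥρ`. -/
def layerKernel (ρ : E n → ℝ) (k : ℕ) (x : E n) : ℝ :=
  ((k : ℝ) + 1) * deriv cutoff (-(((k : ℝ) + 1) * ρ x))

theorem innerCutoff_nonneg (k : ℕ) (x : E n) : 0 ≤ innerCutoff ρ k x := cutoff_nonneg _

theorem innerCutoff_le_one (k : ℕ) (x : E n) : innerCutoff ρ k x ≤ 1 := cutoff_le_one _

theorem layerKernel_nonneg (k : ℕ) (x : E n) : 0 ≤ layerKernel ρ k x :=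
  mul_nonneg (by positivity) (deriv_cutoff_nonneg _)

theorem neg_of_layerKernel_ne_zero {k : ℕ} {x : E n} (h : layerKernel ρ k x ≠ 0) :
    ρ x < 0 ∧ -(2 / ((k : ℝ) + 1)) ≤ ρ x := by
  have hk : (0 : ℝ) < k + 1 := by positivity
  have h1 : 1 ≤ -(((k : ℝ) + 1) * ρ x) := by
    by_contra! hlt
    exact h (by rw [layerKernel, deriv_cutoff_of_lt hlt, mul_zero])
  have h2 : -(((k : ℝ) + 1) * ρ x) ≤ 2 := by
    by_contra! hlt
    exact h (by rw [layerKernel, deriv_cutoff_of_gt hlt, mul_zero])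
  constructor
  · by_contra! h0
    nlinarith [mul_nonneg hk.le h0]
  · rw [neg_le, le_div_iff₀ hk]; linarith

theorem tendsto_innerCutoff {x : E n} (hx : ρ x < 0) :
    Tendsto (fun k => innerCutoff ρ k x) atTop (𝓝 1) := by
  have h1 : Tendsto (fun k : ℕ => ((k : ℝ) + 1) * -ρ x) atTop atTop :=
    (tendsto_atTop_add_const_right _ _ tendsto_natCast_atTop_atTop).atTop_mul_const (by linarith)
  refine tendsto_const_nhds.congr' ?_
  filter_upwards [h1.eventually_ge_atTop 2] with k hk
  exact (cutoff_of_ge (by rw [← mul_neg]; exact hk)).symm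

namespace IsDefiningFunction

theorem contDiff_innerCutoff (h : IsDefiningFunction Ω ρ) (k : ℕ) : ContDiff ℝ 2
    (innerCutoff ρ k) :=
  (contDiff_cutoff (m := 2)).comp (contDiff_const.mul h.contDiff).neg

theorem continuous_layerKernel (h : IsDefiningFunction Ω ρ) (k : ℕ) : Continuous
    (layerKernel ρ k) :=
  continuous_const.mul (continuous_deriv_cutoff.comp
    (continuous_const.mul h.contDiff.continuous).neg)

theorem fderiv_innerCutoff (h : IsDefiningFunction Ω ρ) (k : ℕ) (x v : E n) :
    fderiv ℝ (innerCutoff ρ k) x v = -(layerKernel ρ k x * fderiv ℝ ρ x v) := by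
  have h1 : HasFDerivAt (fun x => -(((k : ℝ) + 1) * ρ x)) (-(((k : ℝ) + 1) • fderiv ℝ ρ x)) x :=
    ((h.differentiable x).hasFDerivAt.const_mul _).neg
  have h2 : HasDerivAt cutoff (deriv cutoff (-(((k : ℝ) + 1) * ρ x))) (-(((k : ℝ) + 1) * ρ x)) :=
    ((contDiff_cutoff (m := 1)).differentiable one_ne_zero _).hasDerivAt
  have h3 : fderiv ℝ (innerCutoff ρ k) x = _ := (h2.comp_hasFDerivAt x h1).fderiv
  rw [h3, layerKernel]
  simp
  ring

theorem tsupport_innerCutoff_subset (h : IsDefiningFunction Ω ρ) (k : ℕ) :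
    tsupport (innerCutoff ρ k) ⊆ {x | 1 ≤ -(((k : ℝ) + 1) * ρ x)} := by
  refine closure_minimal (fun x hx => ?_) (isClosed_le continuous_const
    (continuous_const.mul h.contDiff.continuous).neg)
  by_contra hlt
  exact hx (cutoff_of_le (not_le.1 hlt).le)

theorem tsupport_innerCutoff_subset_self (h : IsDefiningFunction Ω ρ) (k : ℕ) : tsupport
    (innerCutoff ρ k) ⊆ Ω := by
  intro x hx
  have h1 : 1 ≤ -(((k : ℝ) + 1) * ρ x) := h.tsupport_innerCutoff_subset k hx
  rw [h.mem_iff]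
  by_contra! h0
  have : 0 ≤ ((k : ℝ) + 1) * ρ x := mul_nonneg (by positivity) h0
  linarith

theorem hasCompactSupport_innerCutoff (h : IsDefiningFunction Ω ρ) (hb : Bornology.IsBounded Ω)
    (k : ℕ) :
    HasCompactSupport (innerCutoff ρ k) :=
  Metric.isCompact_of_isClosed_isBounded (isClosed_tsupport _)
    (hb.subset (h.tsupport_innerCutoff_subset_self k))

theorem layerKernel_eq_zero_of_notMem (h : IsDefiningFunction Ω ρ) (k : ℕ) {x : E n} (hx : x ∉ Ω) :
    layerKernel ρ k x = 0 := by
  by_contra hne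
  exact hx ((h.mem_iff x).2 (neg_of_layerKernel_ne_zero hne).1)

theorem _root_.BoundaryReaction.isCompact_closure_of_isBounded (hb : Bornology.IsBounded Ω) :
    IsCompact (closure Ω) :=
  Metric.isCompact_of_isClosed_isBounded isClosed_closure hb.closure

theorem integrableOn_layerKernel_mul (h : IsDefiningFunction Ω ρ) (hb : Bornology.IsBounded Ω)
    (k : ℕ) {Φ : E n → ℝ}
    (hΦ : ContinuousOn Φ (closure Ω)) :
    IntegrableOn (fun x => layerKernel ρ k x * Φ x) Ω :=
  (((h.continuous_layerKernel k).continuousOn.mul hΦ).integrableOn_compact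
    (isCompact_closure_of_isBounded hb)).mono_set subset_closure

/-- A strict inequality on the boundary holds on the support of `layerKernel ρ k`, for large
`k`. -/
theorem eventually_lt_of_layerKernel_ne_zero (h : IsDefiningFunction Ω ρ) (hΩ : IsOpen Ω)
    (hb : Bornology.IsBounded Ω)
    {Φ : E n → ℝ} (hΦ : ContinuousOn Φ (closure Ω)) {c : ℝ} (hc : ∀ p ∈ frontier Ω, Φ p < c) :
    ∀ᶠ k in atTop, ∀ x, layerKernel ρ k x ≠ 0 → Φ x < c := by
  -- The set where the inequality fails is compact and contained in `Ω`, so `-ρ` has a positive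
  -- minimum on it and layers of width `2 / (k + 1)` eventually miss it.
  set A : Set (E n) := closure Ω ∩ Φ ⁻¹' Ici c with hA
  have hAc : IsCompact A := (isCompact_closure_of_isBounded hb).of_isClosed_subset
    (hΦ.preimage_isClosed_of_isClosed isClosed_closure isClosed_Ici) inter_subset_left
  have hAΩ : ∀ x ∈ A, 0 < -ρ x := by
    rintro x ⟨hx1, hx2⟩
    have : x ∈ Ω := by
      by_contra hx
      exact absurd (hc x (by rw [hΩ.frontier_eq]; exact ⟨hx1, hx⟩)) (not_lt.2 hx2)
    linarith [(h.mem_iff x).1 this]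
  obtain ⟨d, hd, hdA⟩ := hAc.exists_forall_le' h.contDiff.continuous.neg.continuousOn hAΩ
  have hk : Tendsto (fun k : ℕ => 2 / ((k : ℝ) + 1)) atTop (𝓝 0) := by
    simpa [div_eq_mul_inv] using tendsto_one_div_add_atTop_nhds_zero_nat.const_mul (2 : ℝ)
  filter_upwards [hk.eventually (gt_mem_nhds hd)] with k hk x hx
  obtain ⟨h1, h2⟩ := neg_of_layerKernel_ne_zero hx
  by_contra! hcx
  have : d ≤ -ρ x := hdA x ⟨subset_closure ((h.mem_iff x).2 h1), hcx⟩
  linarith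

/-- The divergence theorem for the vector fields `θ(x) (x - x₀)`. -/
theorem integral_layerKernel_mul (h : IsDefiningFunction Ω ρ) (hb : Bornology.IsBounded Ω) (k : ℕ)
    {θ : E n → ℝ}
    (hθ : ContDiff ℝ 1 θ) (x₀ : E n) :
    ∫ x in Ω, layerKernel ρ k x * (fderiv ℝ ρ x (x - x₀) * θ x)
      = ∫ x in Ω, innerCutoff ρ k x * (n * θ x + fderiv ℝ θ x (x - x₀)) := by
  set ζ := innerCutoff ρ k
  have hζ : ContDiff ℝ 1 ζ := (h.contDiff_innerCutoff k).of_le (by norm_num)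
  have hζc : HasCompactSupport ζ := h.hasCompactSupport_innerCutoff hb k
  have hζs := h.tsupport_innerCutoff_subset_self k
  rw [setIntegral_eq_integral_of_forall_compl_eq_zero (fun x hx => by
      rw [h.layerKernel_eq_zero_of_notMem k hx, zero_mul]),
    setIntegral_eq_integral_of_forall_compl_eq_zero (fun x hx => by
      rw [show ζ x = 0 from image_eq_zero_of_notMem_tsupport fun h' => hx (hζs h'),
        zero_mul])]
  let z : Fin n → E n → ℝ := fun i x => (x - x₀) i
  let e : Fin n → E n := fun i => EuclideanSpace.single i 1
  have hz : ∀ i, ContDiff ℝ 1 (z i) := fun i => by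
    have : z i = fun x => EuclideanSpace.proj (𝕜 := ℝ) i (x - x₀) := rfl
    rw [this]; exact (EuclideanSpace.proj (𝕜 := ℝ) i).contDiff.comp (contDiff_id.sub contDiff_const)
  have hze : ∀ i x, fderiv ℝ (z i) x (e i) = 1 := by
    intro i x
    have : HasFDerivAt (z i) (EuclideanSpace.proj (𝕜 := ℝ) i) x := by
      have h1 := (EuclideanSpace.proj (𝕜 := ℝ) i : E n →L[ℝ] ℝ).hasFDerivAt (x := x - x₀)
      exact h1.comp x ((hasFDerivAt_id x).sub_const x₀)
    rw [this.fderiv]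
    simp [e]
  have hsum : ∀ (L : E n →L[ℝ] ℝ) x, ∑ i, z i x * L (e i) = L (x - x₀) := by
    intro L x
    conv_rhs => rw [← sum_single_smul (x - x₀), map_sum]
    simp [z, e]
  have hibp : ∀ i, ∫ x, θ x * z i x * fderiv ℝ ζ x (e i)
      = -∫ x, ζ x * fderiv ℝ (fun x => θ x * z i x) x (e i) := by
    intro i
    simpa using setIntegral_mul_fderiv_eq_neg (μ := volume) isOpen_univ
      (hθ.mul (hz i)).contDiffOn hζ hζc (subset_univ _) (e i)
  have hi1 : ∀ i, Integrable fun x => θ x * z i x * fderiv ℝ ζ x (e i) := fun i => by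
    have hc : Continuous fun x => fderiv ℝ ζ x (e i) :=
      (hζ.continuous_fderiv one_ne_zero).clm_apply continuous_const
    exact ((hθ.mul (hz i)).continuous.mul hc).integrable_of_hasCompactSupport
      (hζc.fderiv_apply (𝕜 := ℝ) (e i)).mul_left
  have hi2 : ∀ i, Integrable fun x => ζ x * fderiv ℝ (fun x => θ x * z i x) x (e i) := fun i => by
    have hc : Continuous fun x => fderiv ℝ (fun x => θ x * z i x) x (e i) :=
      ((hθ.mul (hz i)).continuous_fderiv one_ne_zero).clm_apply continuous_const
    exact (hζ.continuous.mul hc).integrable_of_hasCompactSupport hζc.mul_right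
  have hs := Finset.sum_congr rfl fun i (_ : i ∈ Finset.univ) => hibp i
  rw [Finset.sum_neg_distrib, ← integral_finsetSum _ fun i _ => hi1 i,
    ← integral_finsetSum _ fun i _ => hi2 i] at hs
  have hs' := congrArg Neg.neg hs
  rw [← integral_neg, neg_neg] at hs'
  refine Eq.trans (integral_congr_ae (Eventually.of_forall fun x => ?_))
    (hs'.trans (integral_congr_ae (Eventually.of_forall fun x => ?_)))
  · have : ∑ i, θ x * z i x * fderiv ℝ ζ x (e i) = θ x * fderiv ℝ ζ x (x - x₀) := by
      rw [← hsum, Finset.mul_sum]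
      exact Finset.sum_congr rfl fun i _ => by ring
    simp only [this]
    rw [h.fderiv_innerCutoff]; ring
  · have : ∀ i, fderiv ℝ (fun x => θ x * z i x) x (e i) = θ x + z i x * fderiv ℝ θ x (e i) := by
      intro i
      rw [fderiv_fun_mul (hθ.differentiable one_ne_zero x) ((hz i).differentiable one_ne_zero x)]
      simp [hze]
    simp only [this]
    rw [← Finset.mul_sum, Finset.sum_add_distrib, hsum]
    simp

/-- Convexity gives `∂ρ(x - x₀) ≥ m > 0` on the frontier, hence at least `m / 2` in thin layers. The
divergence theorem for the field `x - x₀`, whose divergence is `n`, then bounds the total mass of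
the layers uniformly. -/
theorem exists_integral_layerKernel_le (h : IsDefiningFunction Ω ρ) (hΩ : IsOpen Ω)
    (hb : Bornology.IsBounded Ω)
    (hconv : Convex ℝ Ω) {x₀ : E n} (hx₀ : x₀ ∈ Ω) :
    ∃ C > 0, ∀ᶠ k in atTop, ∫ x in Ω, layerKernel ρ k x ≤ C := by
  have hfin : volume Ω ≠ ⊤ := hb.measure_lt_top.ne
  have hmc : Continuous fun x => fderiv ℝ ρ x (x - x₀) :=
    (h.contDiff.continuous_fderiv two_ne_zero).clm_apply (continuous_id.sub continuous_const)
  have hcpt : IsCompact (frontier Ω) :=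
    (isCompact_closure_of_isBounded hb).of_isClosed_subset isClosed_frontier frontier_subset_closure
  obtain ⟨m, hm, hmle⟩ := hcpt.exists_forall_le' hmc.continuousOn
    fun p hp => h.fderiv_sub_pos hΩ hconv hp hx₀
  have hev := h.eventually_lt_of_layerKernel_ne_zero hΩ hb (Φ := fun x => -fderiv ℝ ρ x (x - x₀))
    hmc.neg.continuousOn (c := -(m / 2)) fun p hp => by linarith [hmle p hp]
  refine ⟨(2 / m) * (n * volume.real Ω) + 1, by positivity, ?_⟩
  filter_upwards [hev] with k hk
  have hd := h.integral_layerKernel_mul hb k (θ := fun _ => 1) contDiff_const x₀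
  have h1 : ∫ x in Ω, layerKernel ρ k x
      ≤ ∫ x in Ω, (2 / m) * (layerKernel ρ k x * (fderiv ℝ ρ x (x - x₀) * 1)) := by
    refine integral_mono ?_ ?_ fun x => ?_
    · have := h.integrableOn_layerKernel_mul hb k (Φ := fun _ => 1) continuousOn_const
      simp only [mul_one] at this
      exact this
    · exact (h.integrableOn_layerKernel_mul hb k
        (hmc.mul continuous_const).continuousOn).const_mul _
    · by_cases h0 : layerKernel ρ k x = 0
      · simp [h0]
      · have h2 := hk x h0
        have h3 : 1 ≤ (2 / m) * fderiv ℝ ρ x (x - x₀) := by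
          rw [div_mul_eq_mul_div, le_div_iff₀ hm]; linarith
        have h4 := mul_le_mul_of_nonneg_left h3 (layerKernel_nonneg (ρ := ρ) k x)
        linarith
  rw [integral_const_mul, hd] at h1
  have h2 : ∫ x in Ω, innerCutoff ρ k x * ((n : ℝ) * 1 + fderiv ℝ (fun _ : E n => (1 : ℝ)) x (x - x₀))
      ≤ n * volume.real Ω := by
    have : ∫ x in Ω, innerCutoff ρ k x * ((n : ℝ) * 1 + fderiv ℝ (fun _ : E n => (1 : ℝ)) x (x - x₀))
        ≤ ∫ x in Ω, (n : ℝ) := by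
      refine integral_mono_of_nonneg (Eventually.of_forall fun x => ?_)
        (integrableOn_const hfin) (Eventually.of_forall fun x => ?_)
      · simpa using mul_nonneg (innerCutoff_nonneg k x) n.cast_nonneg
      · simpa using mul_le_of_le_one_left n.cast_nonneg (innerCutoff_le_one k x)
    refine this.trans (le_of_eq ?_)
    simp [mul_comm]
  have h3 := mul_le_mul_of_nonneg_left h2 (by positivity : 0 ≤ 2 / m)
  linarith

/-- In thin layers `Φ` is at most `ε / C` by continuity, where `C` bounds the mass of the kernels.
-/
theorem eventually_integral_layerKernel_mul_le (h : IsDefiningFunction Ω ρ) (hΩ : IsOpen Ω)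
    (hb : Bornology.IsBounded Ω)
    (hconv : Convex ℝ Ω) (hne : Ω.Nonempty) {Φ : E n → ℝ} (hΦ : ContinuousOn Φ (closure Ω))
    (hΦ0 : ∀ p ∈ frontier Ω, Φ p ≤ 0) {ε : ℝ} (hε : 0 < ε) :
    ∀ᶠ k in atTop, ∫ x in Ω, layerKernel ρ k x * Φ x ≤ ε := by
  obtain ⟨x₀, hx₀⟩ := hne
  obtain ⟨C, hC, hCk⟩ := h.exists_integral_layerKernel_le hΩ hb hconv hx₀
  have hev := h.eventually_lt_of_layerKernel_ne_zero hΩ hb hΦ (c := ε / C) fun p hp =>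
    (hΦ0 p hp).trans_lt (by positivity)
  filter_upwards [hCk, hev] with k h1 h2
  calc ∫ x in Ω, layerKernel ρ k x * Φ x ≤ ∫ x in Ω, layerKernel ρ k x * (ε / C) := by
        refine integral_mono (h.integrableOn_layerKernel_mul hb k hΦ)
          (h.integrableOn_layerKernel_mul hb k continuousOn_const) fun x => ?_
        by_cases h0 : layerKernel ρ k x = 0
        · simp [h0]
        · exact mul_le_mul_of_nonneg_left (h2 x h0).le (layerKernel_nonneg k x)
    _ ≤ C * (ε / C) := by
        rw [integral_mul_const]; exact mul_le_mul_of_nonneg_right h1 (by positivity)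
    _ = ε := by field_simp

theorem tendsto_integral_layerKernel_mul (h : IsDefiningFunction Ω ρ) (hΩ : IsOpen Ω)
    (hb : Bornology.IsBounded Ω)
    (hconv : Convex ℝ Ω) (hne : Ω.Nonempty) {Φ : E n → ℝ} (hΦ : ContinuousOn Φ (closure Ω))
    (hΦ0 : ∀ p ∈ frontier Ω, Φ p = 0) :
    Tendsto (fun k => ∫ x in Ω, layerKernel ρ k x * Φ x) atTop (𝓝 0) := by
  rw [Metric.tendsto_nhds]
  intro ε hε
  filter_upwards [h.eventually_integral_layerKernel_mul_le hΩ hb hconv hne hΦ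
      (fun p hp => (hΦ0 p hp).le) (half_pos hε),
    h.eventually_integral_layerKernel_mul_le hΩ hb hconv hne hΦ.neg
      (fun p hp => by simp [hΦ0 p hp]) (half_pos hε)] with k h1 h2
  simp only [Pi.neg_apply, mul_neg, integral_neg] at h2
  rw [Real.dist_eq, sub_zero, abs_lt]
  constructor <;> linarith

/-- A ray from a point of an open convex set meets the frontier only once: every earlier point of it
is interior. -/
theorem _root_.BoundaryReaction.eq_of_norm_smul_eq (hΩ : IsOpen Ω) (hconv : Convex ℝ Ω)
    {x₀ p q : E n} (hx₀ : x₀ ∈ Ω)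
    (hp : p ∈ frontier Ω) (hq : q ∈ frontier Ω) (hpq : ‖p - x₀‖ • (q - x₀) = ‖q - x₀‖ • (p - x₀)) :
    ‖q - x₀‖ ≤ ‖p - x₀‖ → q = p := by
  intro hle
  have hne : p ≠ x₀ := fun h' => (hΩ.inter_frontier_eq.subset ⟨hx₀, h' ▸ hp⟩).elim
  have hp0 : 0 < ‖p - x₀‖ := norm_pos_iff.2 (sub_ne_zero.2 hne)
  have hqe : q = p + (1 - ‖q - x₀‖ / ‖p - x₀‖) • (x₀ - p) := by
    have h1 : q - x₀ = (‖q - x₀‖ / ‖p - x₀‖) • (p - x₀) := by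
      rw [div_eq_inv_mul, mul_smul, ← hpq, smul_smul, inv_mul_cancel₀ hp0.ne', one_smul]
    rw [sub_smul, one_smul, ← neg_sub p x₀, smul_neg, ← h1]
    abel
  rcases hle.lt_or_eq with hlt | heq
  · exfalso
    have hm := hconv.add_smul_sub_mem_interior' (frontier_subset_closure hp)
      (by rwa [hΩ.interior_eq]) (t := 1 - ‖q - x₀‖ / ‖p - x₀‖)
      ⟨by rw [sub_pos, div_lt_one hp0]; exact hlt, by
        rw [sub_le_self_iff]; positivity⟩
    rw [← hqe, hΩ.interior_eq] at hm
    exact (hΩ.inter_frontier_eq.subset ⟨hm, hq⟩).elim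
  · rw [heq, div_self hp0.ne', sub_self, zero_smul, add_zero] at hqe
    exact hqe

/-- The layers must be shown to charge every neighbourhood of `p`. This is done with a radial field
`θ(x)(x - x₀)`, where `θ ≥ 0` is supported in a narrow cone around `p - x₀` and does not decrease
along rays. Its divergence is at least `θ`, so its flux through the layers stays bounded below by a
positive number, while a small multiple of the flux density can be added to `Φ` without making it
positive on the frontier. -/
theorem lt_zero_of_tendsto_integral_layerKernel (h : IsDefiningFunction Ω ρ) (hn : 0 < n)
    (hΩ : IsOpen Ω)
    (hb : Bornology.IsBounded Ω) (hconv : Convex ℝ Ω) (hne : Ω.Nonempty) {Φ : E n → ℝ}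
    (hΦ : ContinuousOn Φ (closure Ω)) (hΦ0 : ∀ p ∈ frontier Ω, Φ p ≤ 0) {p : E n}
    (hp : p ∈ frontier Ω) (hΦp : Φ p < 0) {l : ℝ}
    (hl : Tendsto (fun k => ∫ x in Ω, layerKernel ρ k x * Φ x) atTop (𝓝 l)) : l < 0 := by
  obtain ⟨x₀, hx₀⟩ := hne
  have hfr : ∀ q ∈ frontier Ω, q ∉ Ω := fun q hq h' => (hΩ.inter_frontier_eq.subset ⟨h', hq⟩).elim
  set w := p - x₀ with hw
  have hw0 : 0 < ‖w‖ := norm_pos_iff.2 (sub_ne_zero.2 fun h' => hfr p hp (h' ▸ hx₀))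
  have hcpt : IsCompact (frontier Ω) :=
    (isCompact_closure_of_isBounded hb).of_isClosed_subset isClosed_frontier frontier_subset_closure
  have hΦf : ContinuousOn Φ (frontier Ω) := hΦ.mono frontier_subset_closure
  set A : Set (E n) := frontier Ω ∩ Φ ⁻¹' Ici (Φ p / 2) with hA
  have hAc : IsCompact A := hcpt.of_isClosed_subset
    (hΦf.preimage_isClosed_of_isClosed isClosed_frontier isClosed_Ici) inter_subset_left
  have hAn : ∀ q ∈ A, 0 < ‖q - x₀‖ := fun q hq =>
    norm_pos_iff.2 (sub_ne_zero.2 fun h' => hfr q hq.1 (h' ▸ hx₀))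
  -- Only `p` lies on the ray in the direction `w`, and `p ∉ A`; hence the cosine of the angle is
  -- below `1` on the compact set `A`, and so below some `c < 1` uniformly.
  have hAlt : ∀ q ∈ A, -1 < -(⟪q - x₀, w⟫ / (‖q - x₀‖ * ‖w‖)) := by
    intro q hq
    have hq0 := hAn q hq
    rw [neg_lt_neg_iff, div_lt_one (by positivity)]
    refine lt_of_le_of_ne (real_inner_le_norm _ _) fun heq => ?_
    have hray := inner_eq_norm_mul_iff_real.1 heq
    have hqp : q = p := by
      rcases le_total ‖q - x₀‖ ‖p - x₀‖ with hle | hle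
      · exact eq_of_norm_smul_eq hΩ hconv hx₀ hp hq.1 hray hle
      · exact (eq_of_norm_smul_eq hΩ hconv hx₀ hq.1 hp hray.symm hle).symm
    have h2 : Φ p / 2 ≤ Φ q := hq.2
    rw [hqp] at h2
    linarith
  obtain ⟨c', hc', hc'A⟩ := hAc.exists_forall_le' (f := fun q => -(⟪q - x₀, w⟫ / (‖q - x₀‖ * ‖w‖)))
    (ContinuousOn.neg (ContinuousOn.div (by fun_prop) (by fun_prop)
      fun q hq => (mul_pos (hAn q hq) hw0).ne')) hAlt
  set c : ℝ := max (-c') 0 with hc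
  have hc0 : 0 ≤ c := le_max_right _ _
  have hc1 : c < 1 := max_lt (by linarith) one_pos
  let s : E n → ℝ := fun x => ⟪x - x₀, w⟫
  let κ : E n → ℝ := fun x => s x ^ 2 - c ^ 2 * (‖x - x₀‖ ^ 2 * ‖w‖ ^ 2)
  -- Positive exactly in the open cone where the cosine of the angle with `w` exceeds `c`.
  let θ : E n → ℝ := fun x => expNegInvGlue (s x) * expNegInvGlue (κ x)
  have hs : ContDiff ℝ 1 s := (contDiff_id.sub contDiff_const).inner ℝ contDiff_const
  have hκ : ContDiff ℝ 1 κ := (hs.pow 2).sub (contDiff_const.mul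
    (((contDiff_id.sub contDiff_const).norm_sq ℝ).mul contDiff_const))
  have hθ : ContDiff ℝ 1 θ :=
    ((expNegInvGlue.contDiff (n := 1)).comp hs).mul ((expNegInvGlue.contDiff (n := 1)).comp hκ)
  have hθ0 : ∀ x, 0 ≤ θ x := fun x => mul_nonneg (expNegInvGlue.nonneg _) (expNegInvGlue.nonneg _)
  have hθA : ∀ q ∈ A, θ q = 0 := by
    intro q hq
    show expNegInvGlue (s q) * expNegInvGlue (κ q) = 0
    rcases le_or_gt (s q) 0 with h0 | h0
    · rw [expNegInvGlue.zero_of_nonpos h0, zero_mul]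
    · have hq0 := hAn q hq
      have h1 : s q ≤ c * (‖q - x₀‖ * ‖w‖) := by
        rw [← div_le_iff₀ (by positivity)]
        exact le_trans (by linarith [hc'A q hq]) (le_max_left _ _)
      have h2 : κ q ≤ 0 := by
        have := pow_le_pow_left₀ h0.le h1 2
        show s q ^ 2 - c ^ 2 * (‖q - x₀‖ ^ 2 * ‖w‖ ^ 2) ≤ 0
        nlinarith
      rw [expNegInvGlue.zero_of_nonpos h2, mul_zero]
  -- About `x₀`, `s` is homogeneous of degree `1` and `κ` of degree `2`, and `expNegInvGlue` is
  -- monotone and zero on negative numbers, so `θ` cannot decrease along rays.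
  have hrad : ∀ x, 0 ≤ fderiv ℝ θ x (x - x₀) := by
    intro x
    by_contra! hlt
    obtain ⟨t, ht, ht0⟩ := ((eventually_lt_of_fderiv_neg (hθ.differentiable one_ne_zero x) hlt).and
      self_mem_nhdsWithin).exists
    have ht0 : 0 < t := ht0
    have hx : x + t • (x - x₀) - x₀ = (1 + t) • (x - x₀) := by module
    have hs1 : s (x + t • (x - x₀)) = (1 + t) * s x := by
      simp only [s]; rw [hx, real_inner_smul_left]
    have hκ1 : κ (x + t • (x - x₀)) = (1 + t) ^ 2 * κ x := by
      simp only [κ]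
      rw [hs1, hx, norm_smul, Real.norm_of_nonneg (by linarith)]; ring
    have hmono : ∀ r d : ℝ, 1 ≤ r → expNegInvGlue d ≤ expNegInvGlue (r * d) := by
      intro r d hr
      rcases le_or_gt d 0 with h0 | h0
      · rw [expNegInvGlue.zero_of_nonpos h0]; exact expNegInvGlue.nonneg _
      · exact expNegInvGlue.monotone (by nlinarith)
    have : θ x ≤ θ (x + t • (x - x₀)) := by
      simp only [θ]
      rw [hs1, hκ1]
      exact mul_le_mul (hmono _ _ (by linarith)) (hmono _ _ (by nlinarith))
        (expNegInvGlue.nonneg _) (expNegInvGlue.nonneg _)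
    linarith
  have hmc : Continuous fun x => fderiv ℝ ρ x (x - x₀) * θ x :=
    ((h.contDiff.continuous_fderiv two_ne_zero).clm_apply
      (continuous_id.sub continuous_const)).mul hθ.continuous
  obtain ⟨M, hM⟩ := hcpt.bddAbove_image hmc.continuousOn
  -- Off `A` the margin of `Φ` below zero is `-Φ p / 2`, and the added density is at most `|M| + 1`;
  -- on `A` it vanishes.
  set b : ℝ := -Φ p / 2 / (|M| + 1) with hbdef
  have hb0 : 0 < b := by
    apply div_pos (by linarith); positivity
  have hΨ0 : ∀ q ∈ frontier Ω, Φ q + b * (fderiv ℝ ρ q (q - x₀) * θ q) ≤ 0 := by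
    intro q hq
    by_cases hqA : q ∈ A
    · rw [hθA q hqA, mul_zero, mul_zero, add_zero]; exact hΦ0 q hq
    · have h1 : Φ q < Φ p / 2 := by
        by_contra! h'; exact hqA ⟨hq, h'⟩
      have h2 : fderiv ℝ ρ q (q - x₀) * θ q ≤ |M| + 1 := by
        linarith [hM (mem_image_of_mem _ hq), le_abs_self M]
      have h3 : b * (fderiv ℝ ρ q (q - x₀) * θ q) ≤ -Φ p / 2 := by
        calc _ ≤ b * (|M| + 1) := mul_le_mul_of_nonneg_left h2 hb0.le
          _ = -Φ p / 2 := by rw [hbdef]; field_simp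
      linarith
  have hfin : volume Ω ≠ ⊤ := hb.measure_lt_top.ne
  have hθi : IntegrableOn θ Ω :=
    (hθ.continuous.continuousOn.integrableOn_compact (isCompact_closure_of_isBounded hb)).mono_set
      subset_closure
  have hI : 0 < ∫ x in Ω, θ x := by
    rw [setIntegral_pos_iff_support_of_nonneg_ae (Eventually.of_forall hθ0) hθi]
    have hto : Tendsto (fun t : ℝ => x₀ + t • w) (𝓝[>] 0) (𝓝 x₀) := by
      have : Continuous fun t : ℝ => x₀ + t • w := by fun_prop
      simpa using (this.tendsto 0).mono_left nhdsWithin_le_nhds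
    obtain ⟨t, ht, ht0⟩ := ((hto.eventually (hΩ.mem_nhds hx₀)).and self_mem_nhdsWithin).exists
    have ht0 : 0 < t := ht0
    refine IsOpen.measure_pos _ (hθ.continuous.isOpen_support.inter hΩ) ⟨x₀ + t • w, ?_, ht⟩
    have h1 : s (x₀ + t • w) = t * ‖w‖ ^ 2 := by
      simp only [s]; rw [add_sub_cancel_left, real_inner_smul_left, real_inner_self_eq_norm_sq]
    have h2 : κ (x₀ + t • w) = t ^ 2 * ‖w‖ ^ 4 * (1 - c ^ 2) := by
      simp only [κ]
      rw [h1, add_sub_cancel_left, norm_smul, Real.norm_of_nonneg ht0.le]; ring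
    have h3 : 0 < 1 - c ^ 2 := by nlinarith
    refine (mul_pos (expNegInvGlue.pos_of_pos ?_) (expNegInvGlue.pos_of_pos ?_)).ne'
    · rw [h1]; positivity
    · rw [h2]; positivity
  have hζθ : Tendsto (fun k => ∫ x in Ω, innerCutoff ρ k x * θ x) atTop (𝓝 (∫ x in Ω, θ x)) := by
    refine tendsto_integral_of_dominated_convergence θ
      (fun k => ((h.contDiff_innerCutoff k).continuous.mul hθ.continuous).aestronglyMeasurable)
      hθi (fun k => Eventually.of_forall fun x => ?_) ?_
    · rw [norm_mul, Real.norm_of_nonneg (innerCutoff_nonneg k x), Real.norm_of_nonneg (hθ0 x)]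
      exact mul_le_of_le_one_left (hθ0 x) (innerCutoff_le_one k x)
    · refine (ae_restrict_iff' hΩ.measurableSet).2 (Eventually.of_forall fun x hx => ?_)
      simpa using (tendsto_innerCutoff ((h.mem_iff x).1 hx)).mul_const (θ x)
  set I := ∫ x in Ω, θ x
  have hnpos : (1 : ℝ) ≤ n := by exact_mod_cast hn
  have hevΨ := h.eventually_integral_layerKernel_mul_le hΩ hb hconv ⟨x₀, hx₀⟩
    (hΦ.add (continuous_const.mul hmc).continuousOn (f := Φ)
      (g := fun q => b * (fderiv ℝ ρ q (q - x₀) * θ q))) hΨ0 (ε := b * I / 4) (by positivity)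
  have hle : ∀ᶠ k in atTop, ∫ x in Ω, layerKernel ρ k x * Φ x ≤ -(b * I / 4) := by
    filter_upwards [hevΨ, hζθ.eventually (lt_mem_nhds (half_lt_self hI))] with k h1 h2
    have e1 : ∫ x in Ω, layerKernel ρ k x * (Φ x + b * (fderiv ℝ ρ x (x - x₀) * θ x))
        = (∫ x in Ω, layerKernel ρ k x * Φ x)
          + b * ∫ x in Ω, layerKernel ρ k x * (fderiv ℝ ρ x (x - x₀) * θ x) := by
      rw [← integral_const_mul, ← integral_add (h.integrableOn_layerKernel_mul hb k hΦ)
        ((h.integrableOn_layerKernel_mul hb k hmc.continuousOn).const_mul b)]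
      congr 1; ext x; ring
    have e2 := h.integral_layerKernel_mul hb k hθ x₀
    have e3 : ∫ x in Ω, innerCutoff ρ k x * θ x
        ≤ ∫ x in Ω, innerCutoff ρ k x * (n * θ x + fderiv ℝ θ x (x - x₀)) := by
      have hi : ∀ q : E n → ℝ, Continuous q → IntegrableOn (fun x => innerCutoff ρ k x * q x) Ω :=
        fun q hq => (((h.contDiff_innerCutoff k).continuous.mul hq).continuousOn.integrableOn_compact
          (isCompact_closure_of_isBounded hb)).mono_set subset_closure
      refine integral_mono (hi _ hθ.continuous) (hi _ ?_) fun x => ?_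
      · exact (continuous_const.mul hθ.continuous).add
          ((hθ.continuous_fderiv one_ne_zero).clm_apply (continuous_id.sub continuous_const))
      · refine mul_le_mul_of_nonneg_left ?_ (innerCutoff_nonneg k x)
        nlinarith [hθ0 x, hrad x]
    have h1' : ∫ x in Ω, layerKernel ρ k x * (Φ x + b * (fderiv ℝ ρ x (x - x₀) * θ x))
        ≤ b * I / 4 := h1
    rw [e1, e2] at h1'
    nlinarith
  have := le_of_tendsto hl hle
  have : 0 < b * I / 4 := by positivity
  linarith

theorem nonpos_of_tendsto_integral_layerKernel (h : IsDefiningFunction Ω ρ) (hΩ : IsOpen Ω)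
    (hb : Bornology.IsBounded Ω) (hconv : Convex ℝ Ω) (hne : Ω.Nonempty) {Φ : E n → ℝ}
    (hΦ : ContinuousOn Φ (closure Ω)) (hΦ0 : ∀ p ∈ frontier Ω, Φ p ≤ 0) {l : ℝ}
    (hl : Tendsto (fun k => ∫ x in Ω, layerKernel ρ k x * Φ x) atTop (𝓝 l)) : l ≤ 0 :=
  le_of_forall_pos_le_add fun ε hε => by
    rw [zero_add]
    exact le_of_tendsto hl (h.eventually_integral_layerKernel_mul_le hΩ hb hconv hne hΦ hΦ0 hε)

end IsDefiningFunction

end Layer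

/-! ### First and second derivatives up to the lateral boundary, and the normal flux. -/

section Slices

variable {n : ℕ} {Ω : Set (E n)} {ρ : E n → ℝ} {a : ℝ → ℝ → ℝ} {u : E n × ℝ → ℝ}

/-- A bounded convex domain with a global defining function, a diffusion coefficient, and a
function with the regularity required of solutions. -/
structure Setting (Ω : Set (E n)) (ρ : E n → ℝ) (a : ℝ → ℝ → ℝ) (u : E n × ℝ → ℝ) : Prop where
  isOpen : IsOpen Ω
  isBounded : Bornology.IsBounded Ω
  convex : Convex ℝ Ω
  nonempty : Ω.Nonempty
  dim_pos : 0 < n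
  defining : IsDefiningFunction Ω ρ
  coeff : IsDiffusionCoefficient a
  regular : IsRegular Ω a u

/-- The differential of `u`, extended to the lateral boundary of the cylinder. -/
def extDeriv (Ω : Set (E n)) (u : E n × ℝ → ℝ) (X : E n × ℝ) : (E n × ℝ) →L[ℝ] ℝ :=
  fderivWithin ℝ u (closure Ω ×ˢ Ioi 0) X

/-- The second differential of `u`, extended to the lateral boundary of the cylinder. -/
def extDeriv₂ (Ω : Set (E n)) (u : E n × ℝ → ℝ) (X : E n × ℝ) :
    (E n × ℝ) →L[ℝ] (E n × ℝ) →L[ℝ] ℝ :=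
  fderivWithin ℝ (extDeriv Ω u) (closure Ω ×ˢ Ioi 0) X

theorem apply_inl_eq_inner (L : (E n × ℝ) →L[ℝ] ℝ) (v : E n) :
    L (v, 0) = ⟪(WithLp.ofLp (toV n L)).1, v⟫ := by
  have h1 := inner_toV L (WithLp.toLp 2 (v, 0))
  rw [WithLp.prod_inner_apply] at h1
  have h2 : ⟪(WithLp.ofLp (toV n L)).1, v⟫ + ⟪(WithLp.ofLp (toV n L)).2, (0 : ℝ)⟫ = L (v, 0) := h1
  rw [inner_zero_right, add_zero] at h2
  exact h2.symm

namespace Setting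

theorem isOpen_cyl (S : Setting Ω ρ a u) : IsOpen (cyl Ω) := S.isOpen.prod isOpen_Ioi

theorem cyl_subset : cyl Ω ⊆ closure Ω ×ˢ Ioi 0 := prod_mono subset_closure subset_rfl

theorem mem_nhds (S : Setting Ω ρ a u) {X : E n × ℝ} (hX : X ∈ cyl Ω) :
    closure Ω ×ˢ Ioi (0 : ℝ) ∈ 𝓝 X :=
  mem_of_superset (S.isOpen_cyl.mem_nhds hX) cyl_subset

theorem isCompact_closure (S : Setting Ω ρ a u) : IsCompact (closure Ω) :=
  isCompact_closure_of_isBounded S.isBounded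

/-- The closure of a nonempty open convex set is convex with nonempty interior. Uniqueness of
derivatives is what makes `extDeriv` and `extDeriv₂` continuous up to the lateral boundary. -/
theorem uniqueDiffOn (S : Setting Ω ρ a u) : UniqueDiffOn ℝ (closure Ω ×ˢ Ioi (0 : ℝ)) := by
  refine UniqueDiffOn.prod (uniqueDiffOn_convex S.convex.closure ?_) isOpen_Ioi.uniqueDiffOn
  exact S.nonempty.mono (S.isOpen.subset_interior_iff.2 subset_closure)

theorem contDiffOn_cyl (S : Setting Ω ρ a u) : ContDiffOn ℝ 2 u (cyl Ω) :=
  S.regular.contDiffOn.mono cyl_subset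

theorem contDiffOn_extDeriv (S : Setting Ω ρ a u) :
    ContDiffOn ℝ 1 (extDeriv Ω u) (closure Ω ×ˢ Ioi 0) :=
  S.regular.contDiffOn.fderivWithin S.uniqueDiffOn (by norm_num)

theorem continuousOn_extDeriv (S : Setting Ω ρ a u) :
    ContinuousOn (extDeriv Ω u) (closure Ω ×ˢ Ioi 0) := S.contDiffOn_extDeriv.continuousOn

theorem continuousOn_extDeriv₂ (S : Setting Ω ρ a u) :
    ContinuousOn (extDeriv₂ Ω u) (closure Ω ×ˢ Ioi 0) :=
  (S.contDiffOn_extDeriv.fderivWithin S.uniqueDiffOn (m := 0) (by norm_num)).continuousOn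

theorem hasFDerivWithinAt (S : Setting Ω ρ a u) {X : E n × ℝ}
    (hX : X ∈ closure Ω ×ˢ Ioi (0 : ℝ)) :
    HasFDerivWithinAt u (extDeriv Ω u X) (closure Ω ×ˢ Ioi 0) X :=
  (S.regular.contDiffOn.differentiableOn two_ne_zero X hX).hasFDerivWithinAt

theorem hasFDerivWithinAt_extDeriv (S : Setting Ω ρ a u) {X : E n × ℝ}
    (hX : X ∈ closure Ω ×ˢ Ioi (0 : ℝ)) :
    HasFDerivWithinAt (extDeriv Ω u) (extDeriv₂ Ω u X) (closure Ω ×ˢ Ioi 0) X :=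
  (S.contDiffOn_extDeriv.differentiableOn one_ne_zero X hX).hasFDerivWithinAt

theorem extDeriv_eq (S : Setting Ω ρ a u) {X : E n × ℝ} (hX : X ∈ cyl Ω) :
    extDeriv Ω u X = fderiv ℝ u X := fderivWithin_of_mem_nhds (S.mem_nhds hX)

theorem extDeriv_eventuallyEq (S : Setting Ω ρ a u) {X : E n × ℝ} (hX : X ∈ cyl Ω) :
    extDeriv Ω u =ᶠ[𝓝 X] fderiv ℝ u := by
  filter_upwards [S.isOpen_cyl.mem_nhds hX] with Y hY using S.extDeriv_eq hY

theorem hasFDerivAt (S : Setting Ω ρ a u) {X : E n × ℝ} (hX : X ∈ cyl Ω) :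
    HasFDerivAt u (extDeriv Ω u X) X :=
  (S.hasFDerivWithinAt (cyl_subset hX)).hasFDerivAt (S.mem_nhds hX)

theorem hasFDerivAt_fderiv (S : Setting Ω ρ a u) {X : E n × ℝ} (hX : X ∈ cyl Ω) :
    HasFDerivAt (fderiv ℝ u) (extDeriv₂ Ω u X) X :=
  ((S.hasFDerivWithinAt_extDeriv (cyl_subset hX)).hasFDerivAt (S.mem_nhds hX)).congr_of_eventuallyEq
    (S.extDeriv_eventuallyEq hX).symm

theorem contDiffOn_fderiv (S : Setting Ω ρ a u) : ContDiffOn ℝ 1 (fderiv ℝ u) (cyl Ω) :=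
  S.contDiffOn_cyl.fderiv_of_isOpen S.isOpen_cyl (by norm_num)

theorem contDiffOn_dx (S : Setting Ω ρ a u) (i : Fin n) : ContDiffOn ℝ 1 (dx i u) (cyl Ω) :=
  S.contDiffOn_fderiv.clm_apply contDiffOn_const

theorem fderiv_dx (S : Setting Ω ρ a u) (i : Fin n) {X : E n × ℝ} (hX : X ∈ cyl Ω)
    (w : E n × ℝ) : fderiv ℝ (dx i u) X w = extDeriv₂ Ω u X w (eX i) := by
  have h1 : HasFDerivAt (dx i u) ((extDeriv₂ Ω u X).flip (eX i)) X := by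
    have := (S.hasFDerivAt_fderiv hX).clm_apply (hasFDerivAt_const (eX i) X)
    exact this.congr_fderiv (by simp)
  rw [h1.fderiv]; rfl

theorem dx_dx (S : Setting Ω ρ a u) (i j : Fin n) {X : E n × ℝ} (hX : X ∈ cyl Ω) :
    dx i (dx j u) X = extDeriv₂ Ω u X (eX i) (eX j) := S.fderiv_dx j hX _

theorem extDeriv₂_comm (S : Setting Ω ρ a u) {X : E n × ℝ} (hX : X ∈ cyl Ω) (v w : E n × ℝ) :
    extDeriv₂ Ω u X v w = extDeriv₂ Ω u X w v := by
  have h1 : IsSymmSndFDerivAt ℝ u X :=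
    (S.contDiffOn_cyl.contDiffAt (S.isOpen_cyl.mem_nhds hX)).isSymmSndFDerivAt (by simp)
  have h2 := h1 v w
  rwa [(S.hasFDerivAt_fderiv hX).fderiv] at h2

theorem dy_dx (S : Setting Ω ρ a u) (i : Fin n) {X : E n × ℝ} (hX : X ∈ cyl Ω) :
    dy (dx i u) X = dx i (dy u) X := by
  have h1 : HasFDerivAt (dy u) ((extDeriv₂ Ω u X).flip (0, 1)) X := by
    have := (S.hasFDerivAt_fderiv hX).clm_apply (hasFDerivAt_const ((0 : E n), (1 : ℝ)) X)
    exact this.congr_fderiv (by simp)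
  have h2 : dx i (dy u) X = extDeriv₂ Ω u X (eX i) (0, 1) := by
    rw [dx, h1.fderiv]; rfl
  rw [h2, dy, S.fderiv_dx i hX, S.extDeriv₂_comm hX]

theorem continuousOn_slice {B : Type*} [TopologicalSpace B] {F : E n × ℝ → B}
    (hF : ContinuousOn F (closure Ω ×ˢ Ioi (0 : ℝ))) {y : ℝ} (hy : 0 < y) :
    ContinuousOn (fun x => F (x, y)) (closure Ω) :=
  hF.comp (by fun_prop) fun x hx => ⟨hx, hy⟩

/-- The Neumann condition is a one-sided derivative along the inward normal. Small points of this
ray lie in `Ω`, so that derivative coincides with the one computed from the derivative within the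
closed cylinder. -/
theorem extDeriv_normal (S : Setting Ω ρ a u) {p : E n} (hp : p ∈ frontier Ω) {y : ℝ}
    (hy : 0 < y) : extDeriv Ω u (p, y) (gradient ρ p, 0) = 0 := by
  have hpc : p ∈ closure Ω := frontier_subset_closure hp
  set g := gradient ρ p with hg
  have hg0 : 0 < ‖g‖ := norm_pos_iff.2 (S.defining.gradient_ne_zero p hp)
  set ν := unitNormal ρ p with hν
  have hN := S.regular.neumann p hp ν
    ⟨ρ, S.defining.contDiff.of_le (by norm_num), S.defining.isLocal hp, rfl⟩ y hy.le
  let c : ℝ → E n × ℝ := fun t => (p - t • ν, y)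
  have hneg : fderiv ℝ ρ p (-ν) < 0 := by
    rw [map_neg, ← inner_gradient_left, hν, unitNormal, real_inner_smul_right,
      real_inner_self_eq_norm_sq]
    have : 0 < ‖g‖⁻¹ * ‖g‖ ^ 2 := by positivity
    rw [hg] at this
    linarith
  have hs : c ⁻¹' (closure Ω ×ˢ Ioi 0) ∈ 𝓝[Ici 0] (0 : ℝ) := by
    rw [← Ioi_insert, nhdsWithin_insert]
    refine mem_sup.2 ⟨?_, ?_⟩
    · simp only [mem_pure, mem_preimage, c, zero_smul, sub_zero]
      exact ⟨hpc, hy⟩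
    · filter_upwards [eventually_lt_of_fderiv_neg (S.defining.differentiable p) hneg] with t ht
      rw [S.defining.eq_zero S.isOpen hp] at ht
      refine ⟨subset_closure ((S.defining.mem_iff _).2 ?_), hy⟩
      simpa [c, sub_eq_add_neg] using ht
  have hc : HasDerivAt c (-ν, 0) 0 := by
    have h1 : HasDerivAt (fun t : ℝ => p - t • ν) (-ν) 0 := by
      simpa using ((hasDerivAt_id (0 : ℝ)).smul_const ν).const_sub p
    exact h1.prodMk (hasDerivAt_const 0 y)
  have h0 : c 0 = (p, y) := by simp [c]
  have h1 : HasDerivWithinAt (u ∘ c) (extDeriv Ω u (p, y) (-ν, 0))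
      (c ⁻¹' (closure Ω ×ˢ Ioi 0)) 0 := by
    have h2 : HasFDerivWithinAt u (extDeriv Ω u (p, y)) (closure Ω ×ˢ Ioi 0) (c 0) := by
      rw [h0]; exact S.hasFDerivWithinAt ⟨hpc, hy⟩
    exact h2.comp_hasDerivWithinAt 0 hc.hasDerivWithinAt (mapsTo_preimage _ _)
  have h2 := h1.mono_of_mem_nhdsWithin hs
  have h3 := (uniqueDiffWithinAt_Ici (0 : ℝ)).eq_deriv _ h2 hN
  have h4 : ((g, 0) : E n × ℝ) = (-‖g‖) • (-ν, (0 : ℝ)) := by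
    ext1
    · change g = (-‖g‖) • (-ν)
      rw [smul_neg, neg_smul, neg_neg, hν, unitNormal, smul_smul, mul_inv_cancel₀ hg0.ne', one_smul]
    · simp
  rw [h4, map_smul, h3, smul_zero]

/-- The product `a Σᵢ ∂ᵢρ ⟨∇u, ∇uᵢ⟩`, extended to the lateral boundary. -/
def normalFlux (Ω : Set (E n)) (ρ : E n → ℝ) (a : ℝ → ℝ → ℝ) (u : E n × ℝ → ℝ) (y : ℝ) (x : E n) :
    ℝ :=
  a y ‖toV n (extDeriv Ω u (x, y))‖ *
    extDeriv₂ Ω u (x, y) (WithLp.ofLp (toV n (extDeriv Ω u (x, y)))) (gradient ρ x, 0)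

theorem continuous_gradient (S : Setting Ω ρ a u) : Continuous (gradient ρ) :=
  (InnerProductSpace.toDual ℝ (E n)).symm.continuous.comp
    (S.defining.contDiff.continuous_fderiv two_ne_zero)

theorem continuousOn_coeff (S : Setting Ω ρ a u) {y : ℝ} (hy : 0 < y) :
    ContinuousOn (a y) (Ici 0) := by
  have := S.coeff.continuousOn
  exact this.comp (f := fun t : ℝ => (y, t)) (by fun_prop) fun t ht => ⟨hy, ht⟩

theorem continuousOn_ofLp_toV_extDeriv (S : Setting Ω ρ a u) :
    ContinuousOn (fun X => WithLp.ofLp (toV n (extDeriv Ω u X))) (closure Ω ×ˢ Ioi 0) :=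
  (WithLp.prod_continuous_ofLp 2 (E n) ℝ).comp_continuousOn
    ((toV n).continuous.comp_continuousOn S.continuousOn_extDeriv)

theorem continuousOn_normalFlux (S : Setting Ω ρ a u) {y : ℝ} (hy : 0 < y) :
    ContinuousOn (normalFlux Ω ρ a u y) (closure Ω) := by
  have h1 : ContinuousOn (fun x => toV n (extDeriv Ω u (x, y))) (closure Ω) :=
    (toV n).continuous.comp_continuousOn (continuousOn_slice S.continuousOn_extDeriv hy)
  refine ((S.continuousOn_coeff hy).comp h1.norm fun x _ => norm_nonneg _).mul ?_
  refine ((continuousOn_slice S.continuousOn_extDeriv₂ hy).clm_apply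
    (continuousOn_slice S.continuousOn_ofLp_toV_extDeriv hy)).clm_apply ?_
  exact (S.continuous_gradient.prodMk continuous_const).continuousOn

theorem normalFlux_eq (S : Setting Ω ρ a u) {y : ℝ} (hy : 0 < y) {x : E n} (hx : x ∈ Ω) :
    normalFlux Ω ρ a u y x = ∑ i, fderiv ℝ ρ x (EuclideanSpace.single i 1)
      * (a y ‖grad u (x, y)‖ * ⟪grad u (x, y), grad (dx i u) (x, y)⟫) := by
  have hX : (x, y) ∈ cyl Ω := ⟨hx, hy⟩
  have h1 : ∀ i, ⟪grad u (x, y), grad (dx i u) (x, y)⟫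
      = extDeriv₂ Ω u (x, y) (WithLp.ofLp (grad u (x, y))) (eX i) := fun i => by
    rw [real_inner_comm, inner_grad, S.fderiv_dx i hX]
  have h2 : ∀ i, (gradient ρ x) i = fderiv ℝ ρ x (EuclideanSpace.single i 1) := fun i => by
    rw [← inner_gradient_left, EuclideanSpace.inner_single_right]; simp
  rw [normalFlux, S.extDeriv_eq hX, ← grad_eq, ← sum_eX, map_sum, Finset.mul_sum]
  refine Finset.sum_congr rfl fun i _ => ?_
  rw [map_smul, h1, h2, smul_eq_mul]; ring

/-- The function `N = ⟨∇ₓu, ∇ρ⟩` vanishes on the lateral boundary, and `∇u` is tangent to it, since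
`∇ₓu` is orthogonal to `∇ρ` and the vertical direction is always tangent. Differentiating `N` along
`∇u` gives `D²u(∇u, ∇ρ) + ⟨D²ρ ∇ₓu, ∇ₓu⟩ = 0`. -/
theorem normalFlux_eq_of_mem_frontier (S : Setting Ω ρ a u) {y : ℝ} (hy : 0 < y) {p : E n}
    (hp : p ∈ frontier Ω) :
    normalFlux Ω ρ a u y p = -(a y ‖toV n (extDeriv Ω u (p, y))‖ *
      ⟪fderiv ℝ (gradient ρ) p (WithLp.ofLp (toV n (extDeriv Ω u (p, y)))).1,
        (WithLp.ofLp (toV n (extDeriv Ω u (p, y)))).1⟫) := by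
  have hpc : p ∈ closure Ω := frontier_subset_closure hp
  have hX : (p, y) ∈ closure Ω ×ˢ Ioi (0 : ℝ) := ⟨hpc, hy⟩
  set g := WithLp.ofLp (toV n (extDeriv Ω u (p, y))) with hg
  have hgin : ∀ v : E n, extDeriv Ω u (p, y) (v, 0) = ⟪g.1, v⟫ := apply_inl_eq_inner _
  have hgd : DifferentiableAt ℝ (gradient ρ) p := by
    have : ContDiff ℝ 1 (gradient ρ) :=
      (InnerProductSpace.toDual ℝ (E n)).symm.toContinuousLinearEquiv.contDiff.comp
        (S.defining.contDiff.fderiv_right (m := 1) (by norm_num))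
    exact this.differentiable one_ne_zero p
  set A := fderiv ℝ (gradient ρ) p with hA
  let N : E n × ℝ → ℝ := fun X => extDeriv Ω u X (gradient ρ X.1, 0)
  have hN : HasFDerivWithinAt N ((extDeriv Ω u (p, y)).comp
      (((A.comp (ContinuousLinearMap.fst ℝ (E n) ℝ)).prod 0)) +
        (extDeriv₂ Ω u (p, y)).flip (gradient ρ p, 0)) (closure Ω ×ˢ Ioi 0) (p, y) := by
    have h1 : HasFDerivAt (fun X : E n × ℝ => ((gradient ρ X.1, 0) : E n × ℝ))
        ((A.comp (ContinuousLinearMap.fst ℝ (E n) ℝ)).prod 0) (p, y) :=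
      (HasFDerivAt.comp (g := gradient ρ) (f := Prod.fst) (p, y) hgd.hasFDerivAt
        hasFDerivAt_fst).prodMk (hasFDerivAt_const 0 _)
    exact (S.hasFDerivWithinAt_extDeriv hX).clm_apply h1.hasFDerivWithinAt
  set N' := (extDeriv Ω u (p, y)).comp
      (((A.comp (ContinuousLinearMap.fst ℝ (E n) ℝ)).prod 0)) +
        (extDeriv₂ Ω u (p, y)).flip (gradient ρ p, 0) with hN'
  have hN'a : ∀ w, N' w = extDeriv Ω u (p, y) (A w.1, 0)
      + extDeriv₂ Ω u (p, y) w (gradient ρ p, 0) := fun w => by simp [hN']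
  have hy0 : N' (0, 1) = 0 := by
    have h1 : HasDerivWithinAt (fun t : ℝ => N (p, t)) (N' (0, 1)) (Ioi 0) y :=
      hN.comp_hasDerivWithinAt (f := fun t : ℝ => (p, t)) y
        ((hasDerivAt_const y p).prodMk (hasDerivAt_id y)).hasDerivWithinAt
        (fun t ht => ⟨hpc, ht⟩)
    have h2 : HasDerivWithinAt (fun t : ℝ => N (p, t)) 0 (Ioi 0) y :=
      (hasDerivWithinAt_const y (Ioi (0 : ℝ)) (0 : ℝ)).congr
        (fun t ht => S.extDeriv_normal hp ht) (S.extDeriv_normal hp hy)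
    exact (isOpen_Ioi.uniqueDiffWithinAt hy).eq_deriv _ h1 h2
  -- `N` is constant only along the frontier, so its derivative is compared with `0` on the tangent
  -- cone of the frontier.
  have htan : ∀ v : E n, fderiv ℝ ρ p v = 0 → N' (v, 0) = 0 := by
    intro v hv
    have h1 : HasFDerivWithinAt (fun x : E n => N (x, y))
        (N'.comp (ContinuousLinearMap.inl ℝ (E n) ℝ)) (frontier Ω) p :=
      hN.comp (f := fun x : E n => (x, y)) p
        ((hasFDerivAt_id p).prodMk (hasFDerivAt_const y p)).hasFDerivWithinAt
        (fun x hx => ⟨frontier_subset_closure hx, hy⟩)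
    have h2 : HasFDerivWithinAt (fun x : E n => N (x, y)) (0 : E n →L[ℝ] ℝ) (frontier Ω) p :=
      (hasFDerivWithinAt_const (0 : ℝ) p (frontier Ω)).congr
        (fun x hx => S.extDeriv_normal hx hy) (S.extDeriv_normal hp hy)
    have := h1.unique_on h2 (S.defining.mem_tangentConeAt S.isOpen hp hv)
    simpa using this
  have hgt : fderiv ℝ ρ p g.1 = 0 := by
    rw [← inner_gradient_left, real_inner_comm, ← hgin]; exact S.extDeriv_normal hp hy
  have hg0 : N' g = 0 := by
    have : g = (g.1, 0) + g.2 • ((0 : E n), (1 : ℝ)) := by ext1 <;> simp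
    rw [this, map_add, map_smul, htan _ hgt, hy0, smul_zero, add_zero]
  rw [hN'a, hgin, real_inner_comm] at hg0
  rw [normalFlux, ← hg, eq_neg_of_add_eq_zero_right hg0, mul_neg]

/-- `∇ₓu` is tangent to `∂Ω`, and there positive principal curvatures make the Hessian of `ρ`
positive. -/
theorem normalFlux_nonpos (S : Setting Ω ρ a u)
    (hcurv : ∀ p ∈ frontier Ω, ∀ κ : ℝ, IsPrincipalCurvature Ω p κ → 0 < κ) {y : ℝ} (hy : 0 < y)
    {p : E n} (hp : p ∈ frontier Ω) : normalFlux Ω ρ a u y p ≤ 0 ∧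
      (extDeriv Ω u (p, y) ∘L ContinuousLinearMap.inl ℝ (E n) ℝ ≠ 0 →
        normalFlux Ω ρ a u y p < 0) := by
  rw [S.normalFlux_eq_of_mem_frontier hy hp]
  set g := (WithLp.ofLp (toV n (extDeriv Ω u (p, y)))).1 with hg
  have hgin : ∀ v : E n, extDeriv Ω u (p, y) (v, 0) = ⟪g, v⟫ := apply_inl_eq_inner _
  have ha := S.coeff.pos y hy ‖toV n (extDeriv Ω u (p, y))‖ (norm_nonneg _)
  have hgt : fderiv ℝ ρ p g = 0 := by
    rw [← inner_gradient_left, real_inner_comm, ← hgin]; exact S.extDeriv_normal hp hy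
  have hpos : g ≠ 0 → -(a y ‖toV n (extDeriv Ω u (p, y))‖ * ⟪fderiv ℝ (gradient ρ) p g, g⟫) < 0 :=
    fun h0 => by
      have := mul_pos ha (S.defining.inner_fderiv_gradient_pos hp (hcurv p hp) h0 hgt)
      linarith
  constructor
  · rcases eq_or_ne g 0 with h0 | h0
    · simp [h0]
    · exact (hpos h0).le
  · intro hne
    refine hpos fun h0 => hne ?_
    ext v
    simpa [h0] using hgin v

end Setting

end Slices

/-! ### Green's formula on horizontal slices. -/

section Green

variable {n : ℕ} {Ω : Set (E n)} {ρ : E n → ℝ} {a : ℝ → ℝ → ℝ} {u : E n × ℝ → ℝ}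

namespace IsDefiningFunction

theorem tendsto_integral_innerCutoff_mul (h : IsDefiningFunction Ω ρ) (hΩ : IsOpen Ω) {F : E n → ℝ}
    (hF : IntegrableOn F Ω) :
    Tendsto (fun k => ∫ x in Ω, innerCutoff ρ k x * F x) atTop (𝓝 (∫ x in Ω, F x)) := by
  refine tendsto_integral_of_dominated_convergence (fun x => ‖F x‖)
    (fun k => ((h.contDiff_innerCutoff k).continuous.aestronglyMeasurable.mul
      hF.aestronglyMeasurable)) hF.norm (fun k => Eventually.of_forall fun x => ?_) ?_
  · rw [norm_mul, Real.norm_of_nonneg (innerCutoff_nonneg k x)]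
    exact mul_le_of_le_one_left (norm_nonneg _) (innerCutoff_le_one k x)
  · filter_upwards [ae_restrict_mem hΩ.measurableSet] with x hx
    simpa using (tendsto_innerCutoff ((h.mem_iff x).1 hx)).mul_const (F x)

theorem contDiff_innerCutoff_mul (h : IsDefiningFunction Ω ρ) (hΩ : IsOpen Ω) (k : ℕ)
    {P : E n → ℝ} (hP : ContDiffOn ℝ 1 P Ω) : ContDiff ℝ 1 fun x => innerCutoff ρ k x * P x := by
  refine contDiff_iff_contDiffAt.2 fun x => ?_
  by_cases hx : x ∈ tsupport fun x => innerCutoff ρ k x * P x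
  swap
  · exact contDiffAt_const.congr_of_eventuallyEq (notMem_tsupport_iff_eventuallyEq.1 hx)
  have hxΩ : x ∈ Ω := h.tsupport_innerCutoff_subset_self k (tsupport_mul_subset_left hx)
  exact ((h.contDiff_innerCutoff k).of_le (by norm_num)).contDiffAt.mul
    (hP.contDiffAt (hΩ.mem_nhds hxΩ))

/-- With `ψ` merely Lipschitz, one integrates by parts against the compactly supported `C¹` function
`ζP`, `ζ` the inner cutoff. The derivative of `ζ` produces the layer term, the approximation of the
boundary integral. -/
theorem integral_lineDeriv_mul_innerCutoff (h : IsDefiningFunction Ω ρ) (hΩ : IsOpen Ω)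
    (hb : Bornology.IsBounded Ω) (k : ℕ) {C : ℝ≥0} {ψ : E n → ℝ} (hψ : LipschitzWith C ψ)
    {P : E n → ℝ} (hP : ContDiffOn ℝ 1 P Ω) (v : E n) :
    IntegrableOn (fun x => innerCutoff ρ k x * (lineDeriv ℝ ψ x v * P x)) Ω ∧
    IntegrableOn (fun x => innerCutoff ρ k x * (ψ x * fderiv ℝ P x v)
      - layerKernel ρ k x * (ψ x * (fderiv ℝ ρ x v * P x))) Ω ∧
    ∫ x in Ω, innerCutoff ρ k x * (lineDeriv ℝ ψ x v * P x)
      = -∫ x in Ω, (innerCutoff ρ k x * (ψ x * fderiv ℝ P x v)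
          - layerKernel ρ k x * (ψ x * (fderiv ℝ ρ x v * P x))) := by
  set g : E n → ℝ := fun x => innerCutoff ρ k x * P x with hg
  have hg1 : ContDiff ℝ 1 g := h.contDiff_innerCutoff_mul hΩ k hP
  have hgs : tsupport g ⊆ Ω :=
    tsupport_mul_subset_left.trans (h.tsupport_innerCutoff_subset_self k)
  have hgc : HasCompactSupport g := (h.hasCompactSupport_innerCutoff hb k).mul_right
  obtain ⟨D, hD⟩ := hg1.lipschitzWith_of_hasCompactSupport hgc one_ne_zero
  have h1 := LipschitzWith.integral_lineDeriv_mul_eq (μ := volume) hψ hD hgc v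
  have hfg : ∀ x, lineDeriv ℝ g x (-v) = -fderiv ℝ g x v := fun x => by
    rw [(hg1.differentiable one_ne_zero x).lineDeriv_eq_fderiv, map_neg]
  have hout : ∀ x, x ∉ Ω → g x = 0 := fun x hx => image_eq_zero_of_notMem_tsupport fun h' => hx (hgs h')
  have hout' : ∀ x, x ∉ Ω → fderiv ℝ g x = 0 := fun x hx =>
    image_eq_zero_of_notMem_tsupport fun h' => hx (hgs (tsupport_fderiv_subset ℝ h'))
  have hin : ∀ x ∈ Ω, fderiv ℝ g x v * ψ x = innerCutoff ρ k x * (ψ x * fderiv ℝ P x v)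
      - layerKernel ρ k x * (ψ x * (fderiv ℝ ρ x v * P x)) := fun x hx => by
    have h2 : HasFDerivAt g _ x :=
      ((h.contDiff_innerCutoff k).differentiable two_ne_zero x).hasFDerivAt.mul
      ((hP.differentiableOn one_ne_zero x hx).differentiableAt (hΩ.mem_nhds hx)).hasFDerivAt
    rw [h2.fderiv]
    simp only [add_apply, smul_apply, smul_eq_mul, h.fderiv_innerCutoff]
    ring
  have hI1 : Integrable (fun x => lineDeriv ℝ ψ x v * g x) :=
    (hg1.continuous.integrable_of_hasCompactSupport hgc).bdd_mul (c := C * ‖v‖)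
      (aestronglyMeasurable_lineDeriv hψ.continuous _)
      (Eventually.of_forall fun x => norm_lineDeriv_le_of_lipschitz ℝ hψ)
  have hI2 : Integrable (fun x => fderiv ℝ g x v * ψ x) :=
    (((hg1.continuous_fderiv one_ne_zero).clm_apply continuous_const).mul
      hψ.continuous).integrable_of_hasCompactSupport
      ((hgc.fderiv_apply ℝ v).mul_right)
  refine ⟨?_, ?_, ?_⟩
  · refine hI1.integrableOn.congr (Eventually.of_forall fun x => ?_)
    simp only [hg]; ring
  · exact hI2.integrableOn.congr_fun (fun x hx => hin x hx) hΩ.measurableSet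
  · rw [← integral_neg, ← setIntegral_congr_fun hΩ.measurableSet
      (fun x hx => congrArg Neg.neg (hin x hx)),
      setIntegral_eq_integral_of_forall_compl_eq_zero fun x hx => by
        have h2 : innerCutoff ρ k x * P x = 0 := hout x hx
        linear_combination lineDeriv ℝ ψ x v * h2,
      setIntegral_eq_integral_of_forall_compl_eq_zero fun x hx => by simp [hout' x hx]]
    calc _ = ∫ x, lineDeriv ℝ ψ x v * g x :=
          integral_congr_ae (Eventually.of_forall fun x => by simp only [hg]; ring)
      _ = _ := h1
      _ = _ := integral_congr_ae (Eventually.of_forall fun x => by simp only [hfg]; ring)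

/-- **Green's formula** on a bounded convex domain, for a vector field that is tangent to the
boundary and a Lipschitz function. -/
theorem integral_mul_divergence (h : IsDefiningFunction Ω ρ) (hΩ : IsOpen Ω)
    (hb : Bornology.IsBounded Ω) (hconv : Convex ℝ Ω) (hne : Ω.Nonempty) {C : ℝ≥0} {φ : E n → ℝ}
    (hφ : LipschitzOnWith C φ Ω) {P κ : Fin n → E n → ℝ} {D : E n → ℝ}
    (hPc : ∀ i, ContinuousOn (P i) (closure Ω)) (hP : ∀ i, ContDiffOn ℝ 1 (P i) Ω)
    (hDc : ContinuousOn D (closure Ω))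
    (hD : ∀ x ∈ Ω, D x = ∑ i, fderiv ℝ (P i) x (EuclideanSpace.single i 1))
    (hn : ∀ p ∈ frontier Ω, ∑ i, fderiv ℝ ρ p (EuclideanSpace.single i 1) * P i p = 0)
    (hκ : ∀ i, ∀ᵐ x ∂volume.restrict Ω,
      lineDeriv ℝ φ x (EuclideanSpace.single i 1) * P i x = κ i x) :
    ∫ x in Ω, φ x * D x = -∫ x in Ω, ∑ i, κ i x := by
  -- The formula for Lipschitz functions lives on the whole space; inside the open set `Ω` the
  -- extension has the same line derivatives as `φ`.
  obtain ⟨ψ, hψ, heq⟩ := hφ.extend_real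
  have hcpt : IsCompact (closure Ω) := isCompact_closure_of_isBounded hb
  have hld : ∀ x ∈ Ω, ∀ v, lineDeriv ℝ ψ x v = lineDeriv ℝ φ x v := fun x hx v =>
    Filter.EventuallyEq.lineDeriv_eq (by
      filter_upwards [hΩ.mem_nhds hx] with z hz using (heq hz).symm)
  have hPi : ∀ i, IntegrableOn (fun x => lineDeriv ℝ ψ x (EuclideanSpace.single i 1) * P i x) Ω :=
    fun i => (((hPc i).integrableOn_compact hcpt).mono_set subset_closure).bdd_mul
      (c := C * ‖EuclideanSpace.single i (1 : ℝ)‖)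
      (aestronglyMeasurable_lineDeriv hψ.continuous _)
      (Eventually.of_forall fun x => norm_lineDeriv_le_of_lipschitz ℝ hψ)
  have hκi : IntegrableOn (fun x => ∑ i, lineDeriv ℝ ψ x (EuclideanSpace.single i 1) * P i x) Ω :=
    integrable_finsetSum _ fun i _ => hPi i
  have hDi : IntegrableOn (fun x => ψ x * D x) Ω :=
    ((hψ.continuous.continuousOn.mul hDc).integrableOn_compact hcpt).mono_set subset_closure
  have hΦ : ContinuousOn (fun x => ψ x * ∑ i, fderiv ℝ ρ x (EuclideanSpace.single i 1) * P i x)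
      (closure Ω) := by
    refine hψ.continuous.continuousOn.mul (continuousOn_finsetSum _ fun i _ => ContinuousOn.mul ?_ (hPc i))
    exact ((h.contDiff.continuous_fderiv two_ne_zero).clm_apply continuous_const).continuousOn
  have hk : ∀ k, ∫ x in Ω, innerCutoff ρ k x *
        ∑ i, lineDeriv ℝ ψ x (EuclideanSpace.single i 1) * P i x
      = -(∫ x in Ω, innerCutoff ρ k x * (ψ x * D x)) + ∫ x in Ω, layerKernel ρ k x *
          (ψ x * ∑ i, fderiv ℝ ρ x (EuclideanSpace.single i 1) * P i x) := by
    intro k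
    have hi := fun i => h.integral_lineDeriv_mul_innerCutoff hΩ hb k hψ (hP i)
      (EuclideanSpace.single i 1)
    have hc1 : IntegrableOn (fun x => innerCutoff ρ k x * (ψ x * D x)) Ω :=
      (((h.contDiff_innerCutoff k).continuous.continuousOn.mul
        (hψ.continuous.continuousOn.mul hDc)).integrableOn_compact hcpt).mono_set subset_closure
    have hc2 := h.integrableOn_layerKernel_mul hb k hΦ
    rw [neg_add_eq_sub, ← neg_sub, ← integral_sub hc1 hc2]
    calc _ = ∫ x in Ω, ∑ i, innerCutoff ρ k x *
          (lineDeriv ℝ ψ x (EuclideanSpace.single i 1) * P i x) :=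
          integral_congr_ae (Eventually.of_forall fun x => Finset.mul_sum ..)
      _ = ∑ i, ∫ x in Ω, innerCutoff ρ k x *
          (lineDeriv ℝ ψ x (EuclideanSpace.single i 1) * P i x) :=
          integral_finsetSum _ fun i _ => (hi i).1
      _ = ∑ i, -∫ x in Ω, (innerCutoff ρ k x * (ψ x * fderiv ℝ (P i) x (EuclideanSpace.single i 1))
          - layerKernel ρ k x * (ψ x * (fderiv ℝ ρ x (EuclideanSpace.single i 1) * P i x))) :=
          Finset.sum_congr rfl fun i _ => (hi i).2.2
      _ = _ := by
          rw [Finset.sum_neg_distrib, ← integral_finsetSum _ fun i _ => (hi i).2.1]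
          congr 1
          refine setIntegral_congr_fun hΩ.measurableSet fun x hx => ?_
          simp only [Finset.sum_sub_distrib, hD x hx, Finset.mul_sum]
  -- The layer term tends to zero because its integrand vanishes on the frontier, where the field is
  -- tangent.
  have hlim := ((h.tendsto_integral_innerCutoff_mul hΩ hDi).neg.add
    (h.tendsto_integral_layerKernel_mul hΩ hb hconv hne hΦ fun p hp => by rw [hn p hp, mul_zero]))
  have := tendsto_nhds_unique (h.tendsto_integral_innerCutoff_mul hΩ hκi)
    (hlim.congr fun k => (hk k).symm)
  have h1 : ∫ x in Ω, φ x * D x = ∫ x in Ω, ψ x * D x :=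
    setIntegral_congr_fun hΩ.measurableSet fun x hx => by simp only [heq hx]
  have h2 : ∫ x in Ω, ∑ i, κ i x
      = ∫ x in Ω, ∑ i, lineDeriv ℝ ψ x (EuclideanSpace.single i 1) * P i x := by
    refine integral_congr_ae ?_
    filter_upwards [ae_all_iff.2 hκ, ae_restrict_mem hΩ.measurableSet] with x hx hxΩ
    exact Finset.sum_congr rfl fun i _ => by rw [← hx i, hld x hxΩ]
  rw [h1, h2, this]; ring

end IsDefiningFunction

/-- If `G ∘ w` has a derivative at a point where `w` has a nonzero strict derivative, then `G`
has a derivative. -/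
theorem differentiableAt_of_comp_hasStrictDerivAt {w G : ℝ → ℝ} {t w' : ℝ}
    (hw : HasStrictDerivAt w w' t) (hw' : w' ≠ 0) (h : DifferentiableAt ℝ (fun s => G (w s)) t) :
    DifferentiableAt ℝ G (w t) := by
  have h1 := hw.to_localInverse hw'
  have h2 : w (hw.localInverse w w' t hw' (w t)) = w t :=
    HasStrictFDerivAt.eventually_right_inverse _ |>.self_of_nhds
  have h3 := (hw.hasStrictFDerivAt_equiv hw').localInverse_apply_image
  have h4 : DifferentiableAt ℝ (fun s => G (w s)) (hw.localInverse w w' t hw' (w t)) := by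
    have : hw.localInverse w w' t hw' (w t) = t := h3
    rwa [this]
  refine (h4.comp (w t) h1.hasDerivAt.differentiableAt).congr_of_eventuallyEq ?_
  filter_upwards [(hw.hasStrictFDerivAt_equiv hw').eventually_right_inverse] with s hs
  exact (congrArg G hs).symm

namespace Setting

theorem hasFDerivAt_extDeriv_apply_slice (S : Setting Ω ρ a u) (w : E n × ℝ) {x : E n} (hx : x ∈ Ω)
    {y : ℝ} (hy : 0 < y) : HasFDerivAt (fun x => extDeriv Ω u (x, y) w)
      (((extDeriv₂ Ω u (x, y)).flip w).comp (ContinuousLinearMap.inl ℝ (E n) ℝ)) x := by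
  have hX : (x, y) ∈ cyl Ω := ⟨hx, hy⟩
  have h1 := ((S.hasFDerivWithinAt_extDeriv (cyl_subset hX)).hasFDerivAt (S.mem_nhds hX)).clm_apply
    (hasFDerivAt_const w (x, y))
  have h2 := h1.comp (f := fun x : E n => (x, y)) x
    ((hasFDerivAt_id x).prodMk (hasFDerivAt_const y x))
  refine h2.congr_fderiv ?_
  ext v
  simp

theorem hasFDerivAt_slice (S : Setting Ω ρ a u) {x : E n} (hx : x ∈ Ω) {y : ℝ} (hy : 0 < y) :
    HasFDerivAt (fun x => u (x, y))
      ((extDeriv Ω u (x, y)).comp (ContinuousLinearMap.inl ℝ (E n) ℝ)) x :=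
  (S.hasFDerivAt (show (x, y) ∈ cyl Ω from ⟨hx, hy⟩)).comp (f := fun x : E n => (x, y)) x
    ((hasFDerivAt_id x).prodMk (hasFDerivAt_const y x))

theorem dx_eq (S : Setting Ω ρ a u) {x : E n} (hx : x ∈ Ω) {y : ℝ} (hy : 0 < y) (i : Fin n) :
    dx i u (x, y) = extDeriv Ω u (x, y) (eX i) := by
  rw [S.extDeriv_eq (show (x, y) ∈ cyl Ω from ⟨hx, hy⟩)]; rfl

/-- Green's formula on the slice at height `y`. -/
theorem integral_mul_laplacian (S : Setting Ω ρ a u) {y : ℝ} (hy : 0 < y) {C : ℝ≥0} {φ : E n → ℝ}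
    (hφ : LipschitzOnWith C φ Ω) {κ : Fin n → E n → ℝ}
    (hκ : ∀ i, ∀ᵐ x ∂volume.restrict Ω,
      lineDeriv ℝ φ x (EuclideanSpace.single i 1) * dx i u (x, y) = κ i x) :
    ∫ x in Ω, φ x * ∑ i, dx i (dx i u) (x, y) = -∫ x in Ω, ∑ i, κ i x := by
  have hc2 : ContinuousOn (fun x => extDeriv₂ Ω u (x, y)) (closure Ω) :=
    continuousOn_slice S.continuousOn_extDeriv₂ hy
  rw [← S.defining.integral_mul_divergence S.isOpen S.isBounded S.convex S.nonempty hφ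
    (P := fun i x => extDeriv Ω u (x, y) (eX i))
    (D := fun x => ∑ i, extDeriv₂ Ω u (x, y) (eX i) (eX i))
    (fun i => (continuousOn_slice S.continuousOn_extDeriv hy).clm_apply continuousOn_const)
    (fun i => ?_)
    (continuousOn_finsetSum _ fun i _ => (hc2.clm_apply continuousOn_const).clm_apply
      continuousOn_const) (fun x hx => ?_) (fun p hp => ?_) (κ := κ) fun i => ?_]
  · refine setIntegral_congr_fun S.isOpen.measurableSet fun x hx => ?_
    simp only [S.dx_dx _ _ (show (x, y) ∈ cyl Ω from ⟨hx, hy⟩)]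
  · have h1 : ContDiffOn ℝ 1 (fun x => extDeriv Ω u (x, y)) Ω :=
      S.contDiffOn_extDeriv.comp (contDiff_id.prodMk contDiff_const).contDiffOn
        fun x hx => ⟨subset_closure hx, hy⟩
    exact h1.clm_apply contDiffOn_const
  · refine Finset.sum_congr rfl fun i _ => ?_
    rw [(S.hasFDerivAt_extDeriv_apply_slice (eX i) hx hy).fderiv]
    rfl
  · have h1 := S.extDeriv_normal hp hy
    rw [← sum_eX, map_sum] at h1
    rw [← h1]
    refine Finset.sum_congr rfl fun i _ => ?_
    rw [map_smul, ← inner_gradient_left, EuclideanSpace.inner_single_right]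
    simp
  · filter_upwards [hκ i, ae_restrict_mem S.isOpen.measurableSet] with x hx hxΩ
    rw [← hx, S.dx_eq hxΩ hy]

theorem lipschitzOnWith_of_hasFDerivAt (S : Setting Ω ρ a u) {φ : E n → ℝ}
    {φ' : E n → E n →L[ℝ] ℝ} (hφ : ∀ x ∈ Ω, HasFDerivAt φ (φ' x) x) {C : ℝ}
    (hC : ∀ x ∈ Ω, ‖φ' x‖ ≤ C) : LipschitzOnWith C.toNNReal φ Ω :=
  S.convex.lipschitzOnWith_of_nnnorm_hasFDerivWithin_le
    (fun x hx => (hφ x hx).hasFDerivWithinAt) fun x hx => by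
      rw [← NNReal.coe_le_coe, coe_nnnorm]
      exact (hC x hx).trans (Real.le_coe_toNNReal C)

theorem integral_mul_laplacian_of_hasFDerivAt (S : Setting Ω ρ a u) {y : ℝ} (hy : 0 < y)
    {φ : E n → ℝ} {φ' : E n → E n →L[ℝ] ℝ} (hφ : ∀ x ∈ Ω, HasFDerivAt φ (φ' x) x) {C : ℝ}
    (hC : ∀ x ∈ Ω, ‖φ' x‖ ≤ C) :
    ∫ x in Ω, φ x * ∑ i, dx i (dx i u) (x, y)
      = -∫ x in Ω, ∑ i, φ' x (EuclideanSpace.single i 1) * dx i u (x, y) := by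
  refine S.integral_mul_laplacian hy (S.lipschitzOnWith_of_hasFDerivAt hφ hC) fun i => ?_
  filter_upwards [ae_restrict_mem S.isOpen.measurableSet] with x hx
  rw [((hφ x hx).hasLineDerivAt _).lineDeriv]

theorem exists_norm_le_of_continuousOn (S : Setting Ω ρ a u) {B : Type*} [SeminormedAddCommGroup B]
    {F : E n → B} (hF : ContinuousOn F (closure Ω)) : ∃ C, ∀ x ∈ Ω, ‖F x‖ ≤ C :=
  (S.isCompact_closure.exists_bound_of_continuousOn hF).imp fun _ h x hx => h x (subset_closure hx)

theorem continuousOn_slice_deriv (S : Setting Ω ρ a u) {y : ℝ} (hy : 0 < y) :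
    ContinuousOn (fun x => (extDeriv Ω u (x, y)).comp (ContinuousLinearMap.inl ℝ (E n) ℝ))
      (closure Ω) :=
  (continuousOn_slice S.continuousOn_extDeriv hy).clm_comp continuousOn_const

/-- Green's formula with the vertical component of the flux. -/
theorem integral_flux_mul_laplacian (S : Setting Ω ρ a u) {y : ℝ} (hy : 0 < y) :
    ∫ x in Ω, a y ‖grad u (x, y)‖ * dy u (x, y) * ∑ i, dx i (dx i u) (x, y)
      = -∫ x in Ω, ∑ i, dx i u (x, y) *
          ⟪matB a y (grad u (x, y)) (grad (dx i u) (x, y)), WithLp.toLp 2 ((0 : E n), (1 : ℝ))⟫ := by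
  set e : V n := WithLp.toLp 2 ((0 : E n), (1 : ℝ)) with he
  set φ' : E n → E n →L[ℝ] ℝ := fun x => (innerSL ℝ e).comp ((matBL a y (grad u (x, y))).comp
    ((toV n).comp ((extDeriv₂ Ω u (x, y)).comp (ContinuousLinearMap.inl ℝ (E n) ℝ)))) with hφ'
  have hT : ∀ x ∈ Ω, ∀ v : E n, φ' x v
      = ⟪matB a y (grad u (x, y)) (toV n (extDeriv₂ Ω u (x, y) (v, 0))), e⟫ := fun x hx v => by
    rw [real_inner_comm, ← matBL_apply]; rfl
  have hgrad : ∀ i, ∀ x ∈ Ω, toV n (extDeriv₂ Ω u (x, y) (eX i)) = grad (dx i u) (x, y) := by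
    intro i x hx
    rw [grad_eq]
    congr 1
    ext w
    all_goals simp [S.fderiv_dx i (show (x, y) ∈ cyl Ω from ⟨hx, hy⟩), S.extDeriv₂_comm (show (x, y) ∈ cyl Ω from ⟨hx, hy⟩) (eX i)]
  obtain ⟨Ca, hCa, hCb⟩ := S.coeff.bound
  have h1 : ContinuousOn (fun x => toV n (extDeriv Ω u (x, y))) (closure Ω) :=
    (toV n).continuous.comp_continuousOn (continuousOn_slice S.continuousOn_extDeriv hy)
  have h2 : ContinuousOn (fun x => ‖extDeriv₂ Ω u (x, y)‖) (closure Ω) :=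
    ContinuousOn.norm (E := (E n × ℝ) →L[ℝ] (E n × ℝ) →L[ℝ] ℝ)
      (continuousOn_slice S.continuousOn_extDeriv₂ hy)
  -- No continuity of `φ'` is used, only a bound by an expression continuous on the closed slice. It
  -- makes the vertical flux Lipschitz, as Green's formula requires.
  have hd : ContinuousOn (fun x => (1 + Ca) * a y ‖toV n (extDeriv Ω u (x, y))‖ * ‖e‖ *
      (‖toV n‖ * ‖extDeriv₂ Ω u (x, y)‖)) (closure Ω) :=
    ((continuousOn_const.mul ((S.continuousOn_coeff hy).comp h1.norm
      fun x _ => norm_nonneg _)).mul continuousOn_const).mul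
      (continuousOn_const.mul h2)
  obtain ⟨C, hC⟩ := S.exists_norm_le_of_continuousOn hd
  have hdy : ∀ x, dy u (x, y) = ⟪grad u (x, y), e⟫ := fun x => by
    rw [real_inner_comm, real_inner_comm, inner_grad]; rfl
  have key := S.integral_mul_laplacian_of_hasFDerivAt hy
    (φ := fun x => a y ‖grad u (x, y)‖ * dy u (x, y)) (φ' := φ') (C := C) (fun x hx => ?_) fun x hx => ?_
  · rw [key]
    congr 1
    refine setIntegral_congr_fun S.isOpen.measurableSet fun x hx => Finset.sum_congr rfl fun i _ => ?_
    rw [hT x hx, mul_comm, ← hgrad i x hx]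
    rfl
  · have hX : (x, y) ∈ cyl Ω := ⟨hx, hy⟩
    have h2 : HasFDerivAt (fun x => grad u (x, y))
        ((toV n).comp ((extDeriv₂ Ω u (x, y)).comp (ContinuousLinearMap.inl ℝ (E n) ℝ))) x :=
      (toV n).hasFDerivAt.comp x ((S.hasFDerivAt_fderiv hX).comp (f := fun x : E n => (x, y)) x
        ((hasFDerivAt_id x).prodMk (hasFDerivAt_const y x)))
    have h3 := (innerSL ℝ e).hasFDerivAt.comp x
      ((hasFDerivAt_flux_matBL (n := n) S.coeff hy (grad u (x, y))).comp x h2)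
    refine h3.congr_of_eventuallyEq (Eventually.of_forall fun z => ?_)
    simp only [hdy, Function.comp, innerSL_apply_apply, real_inner_smul_right, real_inner_comm e]
  · refine le_trans (ContinuousLinearMap.opNorm_le_bound _ ?_ fun v => ?_) ((le_abs_self _).trans (hC x hx))
    · have := S.coeff.pos y hy _ (norm_nonneg (toV n (extDeriv Ω u (x, y))))
      positivity
    · have hX : (x, y) ∈ cyl Ω := ⟨hx, hy⟩
      have hpos := S.coeff.pos y hy _ (norm_nonneg (grad u (x, y)))
      rw [hT x hx, S.extDeriv_eq hX, ← grad_eq]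
      calc _ ≤ ‖matB a y (grad u (x, y)) (toV n (extDeriv₂ Ω u (x, y) (v, 0)))‖ * ‖e‖ :=
            norm_inner_le_norm _ _
        _ ≤ (1 + Ca) * a y ‖grad u (x, y)‖ * ‖toV n (extDeriv₂ Ω u (x, y) (v, 0))‖ * ‖e‖ := by
            gcongr; exact norm_matB_le S.coeff hCb hy _ _
        _ ≤ (1 + Ca) * a y ‖grad u (x, y)‖ * (‖toV n‖ * (‖extDeriv₂ Ω u (x, y)‖ * ‖v‖)) * ‖e‖ := by
            gcongr
            refine (ContinuousLinearMap.le_opNorm _ _).trans ?_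
            gcongr
            refine (ContinuousLinearMap.le_opNorm _ _).trans_eq ?_
            simp [Prod.norm_def]
        _ = _ := by ring

theorem exists_lipschitzOnWith_slice (S : Setting Ω ρ a u) {y : ℝ} (hy : 0 < y) :
    ∃ C, LipschitzOnWith C (fun x => u (x, y)) Ω := by
  obtain ⟨C, hC⟩ := S.exists_norm_le_of_continuousOn (S.continuousOn_slice_deriv hy)
  exact ⟨_, S.lipschitzOnWith_of_hasFDerivAt (fun x hx => S.hasFDerivAt_slice hx hy) hC⟩

/-- Green's formula with a locally Lipschitz function of `u`. -/
theorem integral_locallyLipschitz_comp_mul_laplacian (S : Setting Ω ρ a u) {y : ℝ} (hy : 0 < y)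
    {F : ℝ → ℝ} (hF : LocallyLipschitz F) :
    ∫ x in Ω, F (u (x, y)) * ∑ i, dx i (dx i u) (x, y)
      = -∫ x in Ω, ∑ i, deriv F (u (x, y)) * dx i u (x, y) ^ 2 := by
  obtain ⟨C₁, h₁⟩ := S.exists_lipschitzOnWith_slice hy
  have hK : IsCompact ((fun x => u (x, y)) '' closure Ω) :=
    S.isCompact_closure.image_of_continuousOn
      (continuousOn_slice S.regular.contDiffOn.continuousOn hy)
  obtain ⟨C₂, h₂⟩ := (hF.locallyLipschitzOn (s := (fun x => u (x, y)) '' closure Ω)).exists_lipschitzOnWith_of_compact hK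
  have hφ : LipschitzOnWith (C₂ * C₁) (fun x => F (u (x, y))) Ω :=
    h₂.comp h₁ fun x hx => mem_image_of_mem _ (subset_closure hx)
  refine S.integral_mul_laplacian hy hφ fun i => ?_
  obtain ⟨ψ, hψ, heq⟩ := hφ.extend_real
  filter_upwards [ae_restrict_of_ae (hψ.ae_lineDifferentiableAt (μ := volume)
    (EuclideanSpace.single i (1 : ℝ))), ae_restrict_mem S.isOpen.measurableSet] with x hx hxΩ
  -- Where `uᵢ = 0` both sides vanish. Elsewhere `u` is locally invertible along the line, so
  -- differentiability of `F ∘ u`, true almost everywhere by Rademacher, passes to `F` at the value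
  -- `u(x, y)`. Hence the set where `F` is not differentiable does no harm.
  rcases eq_or_ne (dx i u (x, y)) 0 with h0 | h0
  · simp [h0]
  set v := EuclideanSpace.single i (1 : ℝ) with hv
  have hcont : Continuous fun t : ℝ => x + t • v := by fun_prop
  have hmem : ∀ᶠ t : ℝ in 𝓝 0, x + t • v ∈ Ω :=
    hcont.continuousAt.eventually_mem (by simpa using S.isOpen.mem_nhds hxΩ)
  have hw : HasStrictDerivAt (fun t : ℝ => u (x + t • v, y)) (dx i u (x, y)) 0 := by
    have h1 : HasStrictFDerivAt u (fderiv ℝ u (x + (0 : ℝ) • v, y)) (x + (0 : ℝ) • v, y) := by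
      rw [zero_smul, add_zero]
      exact (S.contDiffOn_cyl.contDiffAt (S.isOpen_cyl.mem_nhds (show (x, y) ∈ cyl Ω from ⟨hxΩ, hy⟩))).hasStrictFDerivAt
        two_ne_zero
    have h2 : HasStrictDerivAt (fun t : ℝ => (x + t • v, y)) (v, (0 : ℝ)) 0 := by
      have h3 : HasStrictDerivAt (fun t : ℝ => x + t • v) v 0 := by
        simpa using ((hasStrictDerivAt_id (0 : ℝ)).smul_const v).const_add x
      exact h3.prodMk (hasStrictDerivAt_const _ _)
    have h3 := h1.comp_hasStrictDerivAt 0 h2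
    rw [zero_smul, add_zero] at h3
    exact h3
  have hd : DifferentiableAt ℝ (fun t : ℝ => F (u (x + t • v, y))) 0 := by
    refine DifferentiableAt.congr_of_eventuallyEq hx ?_
    filter_upwards [hmem] with t ht using heq ht
  have hFd : DifferentiableAt ℝ F (u (x, y)) := by
    have := differentiableAt_of_comp_hasStrictDerivAt hw h0 hd
    rwa [zero_smul, add_zero] at this
  have : lineDeriv ℝ (fun x => F (u (x, y))) x v = deriv F (u (x, y)) * dx i u (x, y) := by
    have h1 : HasDerivAt F (deriv F (u (x, y))) (u (x + (0 : ℝ) • v, y)) := by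
      rw [zero_smul, add_zero]; exact hFd.hasDerivAt
    exact (h1.comp 0 hw.hasDerivAt).deriv
  rw [this]; ring

end Setting

end Green

/-! ### Integrability, measurability and Fubini on the cylinder. -/

section Cylinder

variable {n : ℕ} {Ω : Set (E n)} {ρ : E n → ℝ} {a : ℝ → ℝ → ℝ} {u : E n × ℝ → ℝ}

theorem restrict_prod_eq (Ω : Set (E n)) (s : Set ℝ) :
    (volume : Measure (E n × ℝ)).restrict (Ω ×ˢ s)
      = (volume.restrict Ω).prod (volume.restrict s) := by
  rw [Measure.prod_restrict, ← Measure.volume_eq_prod]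

theorem setIntegral_prod_symm {s : Set ℝ} {f : E n × ℝ → ℝ} (hf : IntegrableOn f (Ω ×ˢ s)) :
    ∫ X in Ω ×ˢ s, f X = ∫ y in s, ∫ x in Ω, f (x, y) := by
  rw [restrict_prod_eq]
  rw [IntegrableOn, restrict_prod_eq] at hf
  exact integral_prod_symm f hf

/-- `f` is integrable on every bounded part `Ω × (0, R)` of the cylinder. -/
def IntegrableBelow (Ω : Set (E n)) {B : Type*} [NormedAddCommGroup B] (f : E n × ℝ → B) : Prop :=
  ∀ R > 0, IntegrableOn f (Ω ×ˢ Ioo 0 R)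

namespace IntegrableBelow

theorem prod_Ioo_subset_cyl (R : ℝ) : Ω ×ˢ Ioo 0 R ⊆ cyl Ω :=
  prod_mono subset_rfl Ioo_subset_Ioi_self

variable {B : Type*} [NormedAddCommGroup B] {f g : E n × ℝ → B}

theorem mono' (hΩ : IsOpen Ω) {F : E n × ℝ → ℝ} (hF : IntegrableBelow Ω F)
    (hf : AEStronglyMeasurable f (volume.restrict (cyl Ω))) (hle : ∀ X ∈ cyl Ω, ‖f X‖ ≤ F X) :
    IntegrableBelow Ω f := fun R hR => by
  refine Integrable.mono' (hF R hR) (hf.mono_set (prod_Ioo_subset_cyl R)) ?_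
  filter_upwards [ae_restrict_mem (hΩ.prod isOpen_Ioo).measurableSet] with X hX
  exact hle X (prod_Ioo_subset_cyl R hX)

theorem add (hf : IntegrableBelow Ω f) (hg : IntegrableBelow Ω g) :
    IntegrableBelow Ω fun X => f X + g X := fun R hR => (hf R hR).add (hg R hR)

theorem sub (hf : IntegrableBelow Ω f) (hg : IntegrableBelow Ω g) :
    IntegrableBelow Ω fun X => f X - g X := fun R hR => (hf R hR).sub (hg R hR)

theorem sum {ι : Type*} (s : Finset ι) {f : ι → E n × ℝ → B}
    (hf : ∀ i ∈ s, IntegrableBelow Ω (f i)) : IntegrableBelow Ω fun X => ∑ i ∈ s, f i X :=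
  fun R hR => integrable_finsetSum _ fun i hi => hf i hi R hR

theorem const_mul {f : E n × ℝ → ℝ} (hf : IntegrableBelow Ω f) (c : ℝ) :
    IntegrableBelow Ω fun X => c * f X := fun R hR => (hf R hR).const_mul c

theorem bdd_mul {f θ : E n × ℝ → ℝ} (hf : IntegrableBelow Ω f)
    (hθ : Continuous θ) {M : ℝ} (hM : ∀ X, |θ X| ≤ M) : IntegrableBelow Ω fun X => θ X * f X :=
  fun R hR => Integrable.bdd_mul (c := M) (hf R hR) hθ.aestronglyMeasurable
    (Eventually.of_forall hM)

theorem integrableOn_cyl (hΩ : IsOpen Ω) (hf : IntegrableBelow Ω f) {R : ℝ} (hR : 0 < R)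
    (h0 : ∀ X ∈ cyl Ω, R ≤ X.2 → f X = 0) : IntegrableOn f (cyl Ω) := by
  refine (hf R hR).of_forall_sdiff_eq_zero (hΩ.prod isOpen_Ioi).measurableSet fun X hX => ?_
  refine h0 X hX.1 ?_
  by_contra! h
  exact hX.2 ⟨hX.1.1, hX.1.2, h⟩

theorem ae_integrableOn_slice (hf : IntegrableBelow Ω f) :
    ∀ᵐ y ∂(volume : Measure ℝ).restrict (Ioi 0), IntegrableOn (fun x => f (x, y)) Ω := by
  have h1 : ∀ k : ℕ, ∀ᵐ y ∂(volume : Measure ℝ), y ∈ Ioo (0 : ℝ) (k + 1) →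
      IntegrableOn (fun x => f (x, y)) Ω := fun k => by
    rw [← ae_restrict_iff' measurableSet_Ioo]
    have := hf (k + 1) (by positivity)
    rw [IntegrableOn, restrict_prod_eq] at this
    exact this.prod_left_ae
  rw [ae_restrict_iff' measurableSet_Ioi]
  filter_upwards [ae_all_iff.2 h1] with y hy hy0
  obtain ⟨k, hk⟩ := exists_nat_gt y
  exact hy k ⟨hy0, hk.trans (lt_add_one _)⟩

theorem integrableOn_integral_slice {f : E n × ℝ → ℝ} (hf : IntegrableBelow Ω f) {R : ℝ}
    (hR : 0 < R) : IntegrableOn (fun y => ∫ x in Ω, f (x, y)) (Ioo 0 R) := by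
  have := hf R hR
  rw [IntegrableOn, restrict_prod_eq] at this
  exact this.integral_prod_right

theorem locallyIntegrableOn_integral_slice {f : E n × ℝ → ℝ} (hf : IntegrableBelow Ω f) :
    LocallyIntegrableOn (fun y => ∫ x in Ω, f (x, y)) (Ioi 0) := by
  intro y hy
  have hy : 0 < y := hy
  refine ⟨Ioo 0 (y + 1), ?_, hf.integrableOn_integral_slice (by linarith)⟩
  exact mem_nhdsWithin_of_mem_nhds (Ioo_mem_nhds hy (lt_add_one y))

theorem exists_forall_eq_zero_of_hasCompactSupport {θ : ℝ → ℝ} (hc : HasCompactSupport θ) :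
    ∃ R > 0, ∀ y ≥ R, θ y = 0 := by
  obtain ⟨r, hr⟩ := hc.isCompact.isBounded.subset_closedBall 0
  refine ⟨max r 0 + 1, by positivity, fun y hy => image_eq_zero_of_notMem_tsupport fun h => ?_⟩
  have h1 := hr h
  rw [mem_closedBall_zero_iff, Real.norm_eq_abs] at h1
  have := le_abs_self y
  have := le_max_left r (0 : ℝ)
  linarith

theorem integrableOn_cyl_mul (hΩ : IsOpen Ω) {f : E n × ℝ → ℝ} (hf : IntegrableBelow Ω f)
    {θ : ℝ → ℝ} (hθ : Continuous θ) {R : ℝ} (hR : 0 < R) (h0 : ∀ y ≥ R, θ y = 0)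
    {M : ℝ} (hM : ∀ y, |θ y| ≤ M) :
    IntegrableOn (fun X => θ X.2 * f X) (cyl Ω) :=
  (hf.bdd_mul (θ := fun X => θ X.2) (hθ.comp continuous_snd) fun X => hM X.2).integrableOn_cyl hΩ hR
    fun X _ h => by rw [h0 _ h, zero_mul]

/-- By Fubini the hypothesis says that the slice integral is orthogonal to all smooth compactly
supported functions of `y`. -/
theorem ae_integral_slice_eq_zero (hΩ : IsOpen Ω) {f : E n × ℝ → ℝ} (hf : IntegrableBelow Ω f)
    (h : ∀ θ : ℝ → ℝ, ContDiff ℝ ∞ θ → HasCompactSupport θ → tsupport θ ⊆ Ioi 0 →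
      ∫ X in cyl Ω, θ X.2 * f X = 0) :
    ∀ᵐ y ∂(volume : Measure ℝ).restrict (Ioi 0), ∫ x in Ω, f (x, y) = 0 := by
  rw [ae_restrict_iff' measurableSet_Ioi]
  refine (isOpen_Ioi (a := (0 : ℝ))).ae_eq_zero_of_integral_contDiff_smul_eq_zero
    hf.locallyIntegrableOn_integral_slice fun θ hθ hc hs => ?_
  obtain ⟨R, hR, h0⟩ := exists_forall_eq_zero_of_hasCompactSupport hc
  obtain ⟨M, hM⟩ := hθ.continuous.bounded_above_of_compact_support hc
  have h1 := h θ hθ hc hs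
  rw [cyl, setIntegral_prod_symm (hf.integrableOn_cyl_mul hΩ hθ.continuous hR h0 hM)] at h1
  rw [← setIntegral_eq_integral_of_forall_compl_eq_zero (s := Ioi (0 : ℝ)) fun y hy => by
    rw [image_eq_zero_of_notMem_tsupport fun h' => hy (hs h'), zero_smul]]
  refine Eq.trans (setIntegral_congr_fun measurableSet_Ioi fun y _ => ?_) h1
  simp only [smul_eq_mul, integral_const_mul]

end IntegrableBelow

/-- `G i j` are weak gradients of the second derivatives of `u`, with the integrability required
of solutions. -/
structure HasThirdDerivatives (Ω : Set (E n)) (a : ℝ → ℝ → ℝ) (u : E n × ℝ → ℝ)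
    (G : Fin n → Fin n → E n × ℝ → V n) : Prop where
  weakGradient : ∀ i j, HasWeakGradient (cyl Ω) (dx i (dx j u)) (G i j)
  integrableBelow : IntegrableBelow Ω (fun X => a X.2 ‖grad u X‖ *
    (‖grad u X‖ ^ 2 + ∑ i, ∑ j, dx i (dx j u) X ^ 2 + ∑ i, dx i (dy u) X ^ 2
      + ∑ i, ∑ j, ‖G i j X‖ ^ 2))

namespace Setting

theorem continuousOn_grad (S : Setting Ω ρ a u) : ContinuousOn (grad u) (cyl Ω) :=
  BoundaryReaction.continuousOn_grad S.isOpen_cyl (S.contDiffOn_cyl.of_le (by norm_num))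

theorem continuousOn_grad_dx (S : Setting Ω ρ a u) (i : Fin n) :
    ContinuousOn (grad (dx i u)) (cyl Ω) :=
  BoundaryReaction.continuousOn_grad S.isOpen_cyl (S.contDiffOn_dx i)

theorem continuousOn_gradx (S : Setting Ω ρ a u) : ContinuousOn (gradx u) (cyl Ω) :=
  (PiLp.continuous_toLp 2 _).comp_continuousOn
    (continuousOn_pi.2 fun i => (S.contDiffOn_dx i).continuousOn)

theorem continuousOn_coeff_grad (S : Setting Ω ρ a u) :
    ContinuousOn (fun X : E n × ℝ => a X.2 ‖grad u X‖) (cyl Ω) :=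
  S.coeff.continuousOn.comp (f := fun X : E n × ℝ => (X.2, ‖grad u X‖))
    (continuousOn_snd.prodMk S.continuousOn_grad.norm) fun _ hX => ⟨hX.2, norm_nonneg _⟩

theorem coeff_pos (S : Setting Ω ρ a u) {X : E n × ℝ} (hX : X ∈ cyl Ω) :
    0 < a X.2 ‖grad u X‖ := S.coeff.pos _ hX.2 _ (norm_nonneg _)

theorem aestronglyMeasurable_of_continuousOn (S : Setting Ω ρ a u) {B : Type*} [TopologicalSpace B]
    [TopologicalSpace.PseudoMetrizableSpace B] [SecondCountableTopology B]
    {f : E n × ℝ → B} (hf : ContinuousOn f (cyl Ω)) :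
    AEStronglyMeasurable f (volume.restrict (cyl Ω)) :=
  hf.aestronglyMeasurable S.isOpen_cyl.measurableSet

theorem continuousOn_deriv_coeff (S : Setting Ω ρ a u) :
    ContinuousOn (fun p : ℝ × ℝ => deriv (a p.1) p.2) (Ioi 0 ×ˢ Ioi 0) := by
  have ho : IsOpen (Ioi (0 : ℝ) ×ˢ Ioi (0 : ℝ)) := isOpen_Ioi.prod isOpen_Ioi
  have h1 := (S.coeff.contDiffOn.continuousOn_fderiv_of_isOpen ho le_rfl).clm_apply
    (continuousOn_const (c := ((0 : ℝ), (1 : ℝ))))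
  refine h1.congr fun p hp => ?_
  have h2 := ((S.coeff.contDiffOn.differentiableOn one_ne_zero p hp).differentiableAt
    (ho.mem_nhds hp)).hasFDerivAt
  exact ((h2.comp_hasDerivAt (f := fun t : ℝ => (p.1, t)) p.2
    ((hasDerivAt_const p.2 p.1).prodMk (hasDerivAt_id p.2)))).deriv

/-- The coefficient `a_t / |∇u|` is continuous on the open set where `∇u ≠ 0` and, dividing by zero,
equal to `0` on the rest of the cylinder; no continuity across the two sets is needed. -/
theorem aestronglyMeasurable_matB (S : Setting Ω ρ a u) {ξ : E n × ℝ → V n}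
    (hξ : AEStronglyMeasurable ξ (volume.restrict (cyl Ω))) :
    AEStronglyMeasurable (fun X => matB a X.2 (grad u X) (ξ X)) (volume.restrict (cyl Ω)) := by
  have hg := S.aestronglyMeasurable_of_continuousOn S.continuousOn_grad
  have hc : AEStronglyMeasurable (fun X : E n × ℝ => deriv (a X.2) ‖grad u X‖ / ‖grad u X‖)
      (volume.restrict (cyl Ω)) := by
    set A : Set (E n × ℝ) := cyl Ω ∩ grad u ⁻¹' {0}ᶜ
    have hA : IsOpen A :=
      S.continuousOn_grad.isOpen_inter_preimage S.isOpen_cyl isOpen_compl_singleton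
    have hpos : ∀ X ∈ A, 0 < ‖grad u X‖ := fun X hX => norm_pos_iff.2 hX.2
    have h1 : ContinuousOn (fun X : E n × ℝ => deriv (a X.2) ‖grad u X‖ / ‖grad u X‖) A := by
      have hn := (S.continuousOn_grad.mono (inter_subset_left (t := grad u ⁻¹' {0}ᶜ))).norm
      refine ContinuousOn.div ?_ hn fun X hX => (hpos X hX).ne'
      exact S.continuousOn_deriv_coeff.comp (f := fun X : E n × ℝ => (X.2, ‖grad u X‖))
        (continuousOn_snd.prodMk hn) fun X hX => ⟨hX.1.2, hpos X hX⟩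
    have h2 := (aestronglyMeasurable_indicator_iff hA.measurableSet).2
      (h1.aestronglyMeasurable (μ := volume.restrict (cyl Ω)) hA.measurableSet)
    refine h2.congr ?_
    filter_upwards [ae_restrict_mem S.isOpen_cyl.measurableSet] with X hX
    by_cases h : X ∈ A
    · rw [indicator_of_mem h]
    · rw [indicator_of_notMem h]
      have : grad u X = 0 := by
        by_contra h0
        exact h ⟨hX, h0⟩
      simp [this]
  exact ((S.aestronglyMeasurable_of_continuousOn S.continuousOn_coeff_grad).smul hξ).add
    ((hc.mul (hg.inner hξ)).smul hg)

/-- The test functions `⟪a∇u, b⟫` times a cutoff have a line derivative. -/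
theorem hasFDerivAt_flux (S : Setting Ω ρ a u) {x : E n} {y : ℝ} (hX : (x, y) ∈ cyl Ω) :
    HasFDerivAt (fun x => a y ‖grad u (x, y)‖ • grad u (x, y))
      ((matBL a y (grad u (x, y))).comp ((toV n).comp
        ((extDeriv₂ Ω u (x, y)).comp (ContinuousLinearMap.inl ℝ (E n) ℝ)))) x := by
  have h2 : HasFDerivAt (fun x => grad u (x, y))
      ((toV n).comp ((extDeriv₂ Ω u (x, y)).comp (ContinuousLinearMap.inl ℝ (E n) ℝ))) x :=
    (toV n).hasFDerivAt.comp x ((S.hasFDerivAt_fderiv hX).comp (f := fun x : E n => (x, y)) x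
      ((hasFDerivAt_id x).prodMk (hasFDerivAt_const y x)))
  exact (hasFDerivAt_flux_matBL S.coeff hX.2 (grad u (x, y))).comp x h2

theorem toV_extDeriv₂ (S : Setting Ω ρ a u) {X : E n × ℝ} (hX : X ∈ cyl Ω) (i : Fin n) :
    toV n (extDeriv₂ Ω u X (eX i)) = grad (dx i u) X := by
  rw [grad_eq]
  congr 1
  refine ContinuousLinearMap.ext fun w => ?_
  rw [S.fderiv_dx i hX, S.extDeriv₂_comm hX]

theorem norm_sq_grad_dx_le (S : Setting Ω ρ a u) {X : E n × ℝ} (hX : X ∈ cyl Ω) (i : Fin n) :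
    ‖grad (dx i u) X‖ ^ 2 ≤ ∑ i, ∑ j, dx i (dx j u) X ^ 2 + ∑ i, dx i (dy u) X ^ 2 := by
  rw [norm_sq_grad, norm_sq_gradx, S.dy_dx i hX]
  refine add_le_add ?_ (Finset.single_le_sum (f := fun i => dx i (dy u) X ^ 2)
    (fun _ _ => sq_nonneg _) (Finset.mem_univ i))
  rw [Finset.sum_comm]
  exact Finset.single_le_sum (f := fun i => ∑ j, dx j (dx i u) X ^ 2)
    (fun _ _ => Finset.sum_nonneg fun _ _ => sq_nonneg _) (Finset.mem_univ i)

/-- A common gateway for the integrability claims: an integrand is admissible once it is bounded by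
`a e` for every common bound `e` of the squared first, second and third derivatives. The value of
`e` used is the bracket in the regularity hypothesis. -/
theorem integrableBelow_quadratic (S : Setting Ω ρ a u) {G : Fin n → Fin n → E n × ℝ → V n}
    (hG : HasThirdDerivatives Ω a u G) {f : E n × ℝ → ℝ}
    (hf : AEStronglyMeasurable f (volume.restrict (cyl Ω))) {c : ℝ}
    (hle : ∀ X ∈ cyl Ω, ∀ e : ℝ, ‖grad u X‖ ^ 2 ≤ e → (∀ i, ‖grad (dx i u) X‖ ^ 2 ≤ e) →
      (∀ i j, ‖G i j X‖ ^ 2 ≤ e) → |f X| ≤ c * (a X.2 ‖grad u X‖ * e)) :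
    IntegrableBelow Ω f := by
  refine (hG.integrableBelow.const_mul c).mono' S.isOpen hf fun X hX => ?_
  have h1 : 0 ≤ ∑ i, ∑ j, dx i (dx j u) X ^ 2 :=
    Finset.sum_nonneg fun _ _ => Finset.sum_nonneg fun _ _ => sq_nonneg _
  have h2 : 0 ≤ ∑ i, dx i (dy u) X ^ 2 := Finset.sum_nonneg fun _ _ => sq_nonneg _
  have h3 : 0 ≤ ∑ i, ∑ j, ‖G i j X‖ ^ 2 :=
    Finset.sum_nonneg fun _ _ => Finset.sum_nonneg fun _ _ => sq_nonneg _
  have h4 := sq_nonneg ‖grad u X‖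
  refine hle X hX _ (by linarith) (fun i => ?_) fun i j => ?_
  · linarith [S.norm_sq_grad_dx_le hX i]
  · have h5 : ‖G i j X‖ ^ 2 ≤ ∑ j, ‖G i j X‖ ^ 2 := Finset.single_le_sum
      (f := fun j => ‖G i j X‖ ^ 2) (fun _ _ => sq_nonneg _) (Finset.mem_univ j)
    have h6 : ∑ j, ‖G i j X‖ ^ 2 ≤ ∑ i, ∑ j, ‖G i j X‖ ^ 2 := Finset.single_le_sum
      (f := fun i => ∑ j, ‖G i j X‖ ^ 2)
      (fun _ _ => Finset.sum_nonneg fun _ _ => sq_nonneg _) (Finset.mem_univ i)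
    linarith

end Setting

end Cylinder

/-! ### The weak divergence identity for the field `a⟨∇u, ∇uᵢ⟩`. -/

section FluxIdentity

variable {n : ℕ} {Ω : Set (E n)} {ρ : E n → ℝ} {a : ℝ → ℝ → ℝ} {u : E n × ℝ → ℝ}

/-- The quadratic form `Σᵢ ⟨ℬ∇uᵢ, ∇uᵢ⟩`. -/
def hessianForm (a : ℝ → ℝ → ℝ) (u : E n × ℝ → ℝ) (X : E n × ℝ) : ℝ :=
  ∑ i, ⟪matB a X.2 (grad u X) (grad (dx i u) X), grad (dx i u) X⟫

/-- The pairing of the flux `a∇u` with the third derivatives `Σᵢ ∇uᵢᵢ`. -/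
def fluxForm (a : ℝ → ℝ → ℝ) (u : E n × ℝ → ℝ) (G : Fin n → Fin n → E n × ℝ → V n)
    (X : E n × ℝ) : ℝ :=
  ∑ i, a X.2 ‖grad u X‖ * ⟪grad u X, G i i X⟫

namespace Setting

theorem isCompact_tsupport_prod (S : Setting Ω ρ a u) (k : ℕ) {θ : ℝ → ℝ}
    (hc : HasCompactSupport θ) : IsCompact (tsupport (innerCutoff ρ k) ×ˢ tsupport θ) :=
  (S.defining.hasCompactSupport_innerCutoff S.isBounded k).isCompact.prod hc.isCompact

theorem tsupport_prod_subset (S : Setting Ω ρ a u) (k : ℕ) {θ : ℝ → ℝ}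
    (hs : tsupport θ ⊆ Ioi 0) : tsupport (innerCutoff ρ k) ×ˢ tsupport θ ⊆ cyl Ω :=
  prod_mono (S.defining.tsupport_innerCutoff_subset_self k) hs

theorem tsupport_cutoff_mul_subset (k : ℕ) (θ : ℝ → ℝ) (f : E n × ℝ → ℝ) :
    tsupport (fun X : E n × ℝ => innerCutoff ρ k X.1 * θ X.2 * f X)
      ⊆ tsupport (innerCutoff ρ k) ×ˢ tsupport θ := by
  refine closure_minimal (fun X hX => ?_) ((isClosed_tsupport _).prod (isClosed_tsupport _))
  rw [Function.mem_support] at hX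
  exact ⟨subset_tsupport _ (left_ne_zero_of_mul (left_ne_zero_of_mul hX)),
    subset_tsupport _ (right_ne_zero_of_mul (left_ne_zero_of_mul hX))⟩

/-- Integration by parts of the third derivatives, against one component of the flux. -/
theorem integral_flux_inner_mul (S : Setting Ω ρ a u) {G : Fin n → Fin n → E n × ℝ → V n}
    (hG : HasThirdDerivatives Ω a u G) (i : Fin n) (k : ℕ) {θ : ℝ → ℝ} (hθ : Continuous θ)
    (hc : HasCompactSupport θ) (hs : tsupport θ ⊆ Ioi 0) (ξ : V n) :
    IntegrableOn (fun X : E n × ℝ => innerCutoff ρ k X.1 * θ X.2 *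
      (⟪a X.2 ‖grad u X‖ • grad u X, ξ⟫ * ⟪ξ, G i i X⟫)) (cyl Ω) ∧
    IntegrableOn (fun X : E n × ℝ => θ X.2 *
      (innerCutoff ρ k X.1 * ⟪matB a X.2 (grad u X) (grad (dx i u) X), ξ⟫
        + fderiv ℝ (innerCutoff ρ k) X.1 (EuclideanSpace.single i 1) *
          ⟪a X.2 ‖grad u X‖ • grad u X, ξ⟫) * ⟪ξ, grad (dx i u) X⟫) (cyl Ω) ∧
    ∫ X in cyl Ω, innerCutoff ρ k X.1 * θ X.2 *
      (⟪a X.2 ‖grad u X‖ • grad u X, ξ⟫ * ⟪ξ, G i i X⟫)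
      = -∫ X in cyl Ω, θ X.2 *
        (innerCutoff ρ k X.1 * ⟪matB a X.2 (grad u X) (grad (dx i u) X), ξ⟫
        + fderiv ℝ (innerCutoff ρ k) X.1 (EuclideanSpace.single i 1) *
          ⟪a X.2 ‖grad u X‖ • grad u X, ξ⟫) * ⟪ξ, grad (dx i u) X⟫ := by
  set ζ := innerCutoff ρ k with hζ
  set F : E n × ℝ → V n := fun X => a X.2 ‖grad u X‖ • grad u X with hF
  have hFc : ContinuousOn F (cyl Ω) := S.continuousOn_coeff_grad.smul S.continuousOn_grad
  have hζd : ContDiff ℝ 2 ζ := S.defining.contDiff_innerCutoff k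
  set v := EuclideanSpace.single i (1 : ℝ) with hv
  set η : E n × ℝ → ℝ := fun X => ζ X.1 * θ X.2 * ⟪F X, ξ⟫ with hη
  -- The line derivative of `η` in the direction `eᵢ`. That direction is horizontal, so `θ` is not
  -- differentiated. Only measurability and a bound of `κ` are used, as continuity of `ℬ` is not
  -- exploited where `∇u` vanishes.
  set κ : E n × ℝ → ℝ := fun X => θ X.2 *
    (ζ X.1 * ⟪matB a X.2 (grad u X) (grad (dx i u) X), ξ⟫ + fderiv ℝ ζ X.1 v * ⟪F X, ξ⟫) with hκ
  set K := tsupport ζ ×ˢ tsupport θ with hK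
  have hKc : IsCompact K := S.isCompact_tsupport_prod k hc
  have hKs : K ⊆ cyl Ω := S.tsupport_prod_subset k hs
  have hηK : tsupport η ⊆ K := tsupport_cutoff_mul_subset k θ _
  have hηs : tsupport η ⊆ cyl Ω := hηK.trans hKs
  have hηc : HasCompactSupport η := hKc.of_isClosed_subset (isClosed_tsupport _) hηK
  have hηcont : Continuous η := by
    refine ContinuousOn.continuous_of_tsupport_subset ?_ S.isOpen_cyl hηs
    exact (((hζd.continuous.comp continuous_fst).mul (hθ.comp continuous_snd)).continuousOn).mul
      (hFc.inner continuousOn_const)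
  have hκ0 : ∀ X, X ∉ K → κ X = 0 := by
    intro X hX
    simp only [hκ]
    by_cases h1 : X.2 ∈ tsupport θ
    · have h2 : X.1 ∉ tsupport ζ := fun h => hX ⟨h, h1⟩
      rw [image_eq_zero_of_notMem_tsupport h2, show fderiv ℝ ζ X.1 = 0 from
        image_eq_zero_of_notMem_tsupport fun h => h2 (tsupport_fderiv_subset ℝ h)]
      simp
    · rw [image_eq_zero_of_notMem_tsupport h1, zero_mul]
  have hκm' : AEStronglyMeasurable κ (volume.restrict (cyl Ω)) := by
    have h1 : Continuous fun X : E n × ℝ => fderiv ℝ ζ X.1 v :=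
      ((hζd.continuous_fderiv two_ne_zero).comp continuous_fst).clm_apply continuous_const
    refine (hθ.comp continuous_snd).aestronglyMeasurable.mul (AEStronglyMeasurable.add ?_ ?_)
    · exact (hζd.continuous.comp continuous_fst).aestronglyMeasurable.mul
        ((S.aestronglyMeasurable_matB (S.aestronglyMeasurable_of_continuousOn
          (S.continuousOn_grad_dx i))).inner aestronglyMeasurable_const)
    · exact h1.aestronglyMeasurable.mul ((S.aestronglyMeasurable_of_continuousOn hFc).inner
        aestronglyMeasurable_const)
  have hκm : AEStronglyMeasurable κ := by
    rw [← indicator_eq_self.2 (show Function.support κ ⊆ cyl Ω from fun X hX => by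
      by_contra h
      exact hX (hκ0 X fun h' => h (hKs h')))]
    exact (aestronglyMeasurable_indicator_iff S.isOpen_cyl.measurableSet).2 hκm'
  obtain ⟨Ca, hCa, hCb⟩ := S.coeff.bound
  -- The norm bound for `ℬ` replaces its continuity: `|κ|` is dominated on the compact set `K` by a
  -- continuous function.
  obtain ⟨M, hM⟩ : ∃ M, ∀ X, |κ X| ≤ M := by
    have hW : ContinuousOn (fun X : E n × ℝ => |θ X.2| * (|ζ X.1| *
        ((1 + Ca) * a X.2 ‖grad u X‖ * ‖grad (dx i u) X‖ * ‖ξ‖) +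
          |fderiv ℝ ζ X.1 v| * (‖F X‖ * ‖ξ‖))) K := by
      have h1 : Continuous fun X : E n × ℝ => fderiv ℝ ζ X.1 v :=
        ((hζd.continuous_fderiv two_ne_zero).comp continuous_fst).clm_apply continuous_const
      refine ((hθ.comp continuous_snd).abs.continuousOn).mul (ContinuousOn.add ?_ ?_)
      · exact ((hζd.continuous.comp continuous_fst).abs.continuousOn).mul
          (((continuousOn_const.mul (S.continuousOn_coeff_grad.mono hKs)).mul
          ((S.continuousOn_grad_dx i).mono hKs).norm).mul continuousOn_const)
      · exact h1.abs.continuousOn.mul ((hFc.mono hKs).norm.mul continuousOn_const)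
    obtain ⟨M, hM⟩ := hKc.exists_bound_of_continuousOn hW
    refine ⟨max M 0, fun X => ?_⟩
    by_cases hX : X ∈ K
    · refine le_max_of_le_left (le_trans ?_ ((le_abs_self _).trans (hM X hX)))
      have hpos := S.coeff_pos (hKs hX)
      rw [hκ, abs_mul]
      gcongr
      refine (abs_add_le _ _).trans ?_
      rw [abs_mul, abs_mul]
      gcongr
      · exact (abs_real_inner_le_norm _ _).trans (by
          gcongr; exact norm_matB_le S.coeff hCb (hKs hX).2 _ _)
      · exact abs_real_inner_le_norm _ _
    · rw [hκ0 X hX, abs_zero]; exact le_max_right _ _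
  have hd : ∀ X, HasLineDerivAt ℝ η (κ X) X (eX i) := by
    intro X
    by_cases hX : X ∈ cyl Ω
    · obtain ⟨x, y⟩ := X
      have h1 : HasFDerivAt (fun x => ζ x * θ y * ⟪ξ, F (x, y)⟫) _ x :=
        ((hζd.differentiable two_ne_zero x).hasFDerivAt.mul_const (θ y)).mul
          ((innerSL ℝ ξ).hasFDerivAt.comp x (S.hasFDerivAt_flux hX))
      have h2 := h1.hasLineDerivAt v
      have h3 : (fun t : ℝ => η ((x, y) + t • eX i))
          = fun t : ℝ => ζ (x + t • v) * θ y * ⟪ξ, F (x + t • v, y)⟫ := by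
        funext t
        have : ((x, y) : E n × ℝ) + t • eX i = (x + t • v, y) := by
          ext1 <;> simp [eX, hv]
        rw [this, hη]
        simp only [real_inner_comm]
      rw [HasLineDerivAt, h3]
      refine HasDerivAt.congr_deriv h2 ?_
      have h4 : (toV n) ((extDeriv₂ Ω u (x, y)) (v, 0)) = grad (dx i u) (x, y) :=
        S.toV_extDeriv₂ hX i
      simp only [add_apply, smul_apply, ContinuousLinearMap.comp_apply, smul_eq_mul,
        ContinuousLinearMap.inl_apply, innerSL_apply_apply, matBL_apply, h4, hκ, hF]
      rw [real_inner_comm ξ, real_inner_comm ξ]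
      ring
    · have h1 : κ X = 0 := hκ0 X fun h => hX (hKs h)
      have h2 : η =ᶠ[𝓝 X] fun _ => 0 :=
        notMem_tsupport_iff_eventuallyEq.1 fun h => hX (hηs h)
      have h3 : HasFDerivAt η (0 : E n × ℝ →L[ℝ] ℝ) X :=
        (hasFDerivAt_const (0 : ℝ) X).congr_of_eventuallyEq h2
      rw [h1]
      exact h3.hasLineDerivAt _
  have key := (hG.weakGradient i i).setIntegral_smul_eq_neg S.isOpen_cyl (S.contDiffOn_dx i)
    hηcont hηc hηs hκm hM hd
  have hi1 : IntegrableOn (fun X => η X • G i i X) (cyl Ω) :=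
    integrableOn_smul_of_tsupport_subset (hG.weakGradient i i).locallyIntegrable_grad hηcont hηc hηs
  have hi2 : IntegrableOn (fun X => κ X • grad (dx i u) X) (cyl Ω) := by
    have h1 : IntegrableOn (grad (dx i u)) K :=
      ((S.continuousOn_grad_dx i).mono hKs).integrableOn_compact hKc
    have h2 : IntegrableOn (fun X => κ X • grad (dx i u) X) K :=
      h1.bdd_smul M hκm.restrict (Eventually.of_forall hM)
    refine h2.of_forall_sdiff_eq_zero S.isOpen_cyl.measurableSet fun X hX => ?_
    rw [hκ0 X hX.2, zero_smul]
  have e1 : ∀ X, innerCutoff ρ k X.1 * θ X.2 * (⟪F X, ξ⟫ * ⟪ξ, G i i X⟫) = ⟪ξ, η X • G i i X⟫ :=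
    fun X => by rw [real_inner_smul_right, hη]; ring
  have e2 : ∀ X, κ X * ⟪ξ, grad (dx i u) X⟫ = ⟪ξ, κ X • grad (dx i u) X⟫ := fun X => by
    rw [real_inner_smul_right]
  refine ⟨(hi1.const_inner ξ).congr (Eventually.of_forall fun X => (e1 X).symm),
    (hi2.const_inner ξ).congr (Eventually.of_forall fun X => (e2 X).symm), ?_⟩
  calc _ = ∫ X in cyl Ω, ⟪ξ, η X • G i i X⟫ := integral_congr_ae (Eventually.of_forall e1)
    _ = ⟪ξ, ∫ X in cyl Ω, η X • G i i X⟫ := integral_inner hi1 ξ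
    _ = -⟪ξ, ∫ X in cyl Ω, κ X • grad (dx i u) X⟫ := by rw [key, inner_neg_right]
    _ = -∫ X in cyl Ω, ⟪ξ, κ X • grad (dx i u) X⟫ := by rw [integral_inner hi2]
    _ = _ := congrArg Neg.neg (integral_congr_ae (Eventually.of_forall fun X => (e2 X).symm))

/-- Summing the identities for single components over an orthonormal basis recombines the products
into inner products. The result is the weak form of `∂ᵢ(a⟨∇u, ∇uᵢ⟩) = a⟨∇u, ∇uᵢᵢ⟩ + ⟨ℬ∇uᵢ, ∇uᵢ⟩`,
multiplied by the cutoffs. -/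
theorem integral_cutoff_mul_flux (S : Setting Ω ρ a u) {G : Fin n → Fin n → E n × ℝ → V n}
    (hG : HasThirdDerivatives Ω a u G) (i : Fin n) (k : ℕ) {θ : ℝ → ℝ} (hθ : Continuous θ)
    (hc : HasCompactSupport θ) (hs : tsupport θ ⊆ Ioi 0) :
    ∫ X in cyl Ω, θ X.2 * (innerCutoff ρ k X.1 * (a X.2 ‖grad u X‖ * ⟪grad u X, G i i X⟫
      + ⟪matB a X.2 (grad u X) (grad (dx i u) X), grad (dx i u) X⟫)
      + fderiv ℝ (innerCutoff ρ k) X.1 (EuclideanSpace.single i 1) *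
        (a X.2 ‖grad u X‖ * ⟪grad u X, grad (dx i u) X⟫)) = 0 := by
  set b := stdOrthonormalBasis ℝ (V n)
  have h := fun j => S.integral_flux_inner_mul hG i k hθ hc hs (b j)
  have h1 := integral_finsetSum (μ := volume.restrict (cyl Ω)) Finset.univ fun j _ => (h j).1
  have h2 := integral_finsetSum (μ := volume.restrict (cyl Ω)) Finset.univ fun j _ => (h j).2.1
  have h3 := integrable_finsetSum (μ := volume.restrict (cyl Ω)) Finset.univ fun j _ => (h j).1
  have h4 := integrable_finsetSum (μ := volume.restrict (cyl Ω)) Finset.univ fun j _ => (h j).2.1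
  have h5 : (∫ X in cyl Ω, ∑ j, innerCutoff ρ k X.1 * θ X.2 *
      (⟪a X.2 ‖grad u X‖ • grad u X, b j⟫ * ⟪b j, G i i X⟫))
      + (∫ X in cyl Ω, ∑ j, θ X.2 *
        (innerCutoff ρ k X.1 * ⟪matB a X.2 (grad u X) (grad (dx i u) X), b j⟫
        + fderiv ℝ (innerCutoff ρ k) X.1 (EuclideanSpace.single i 1) *
          ⟪a X.2 ‖grad u X‖ • grad u X, b j⟫) * ⟪b j, grad (dx i u) X⟫) = 0 := by
    rw [h1, h2, ← Finset.sum_add_distrib]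
    exact Finset.sum_eq_zero fun j _ => by rw [(h j).2.2, neg_add_cancel]
  rw [← integral_add h3 h4] at h5
  rw [← h5]
  refine integral_congr_ae (Eventually.of_forall fun X => ?_)
  simp only [mul_assoc, add_mul, ← Finset.mul_sum, Finset.sum_add_distrib,
    OrthonormalBasis.sum_inner_mul_inner, real_inner_smul_left]
  ring

end Setting

end FluxIdentity

/-! ### The slice integral of the divergence as a curvature term. -/

section BoundaryFlux

variable {n : ℕ} {Ω : Set (E n)} {ρ : E n → ℝ} {a : ℝ → ℝ → ℝ} {u : E n × ℝ → ℝ}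
  {G : Fin n → Fin n → E n × ℝ → V n}

namespace Setting

theorem aestronglyMeasurable_third (hG : HasThirdDerivatives Ω a u G) (i j : Fin n) :
    AEStronglyMeasurable (G i j) (volume.restrict (cyl Ω)) :=
  (hG.weakGradient i j).locallyIntegrable_grad.aestronglyMeasurable

theorem mul_le_of_sq_le {r s e : ℝ} (hr : r ^ 2 ≤ e) (hs : s ^ 2 ≤ e) : r * s ≤ e := by
  nlinarith [sq_nonneg (r - s)]

theorem aestronglyMeasurable_coeff (S : Setting Ω ρ a u) :
    AEStronglyMeasurable (fun X : E n × ℝ => a X.2 ‖grad u X‖) (volume.restrict (cyl Ω)) :=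
  S.aestronglyMeasurable_of_continuousOn S.continuousOn_coeff_grad

theorem aestronglyMeasurable_grad (S : Setting Ω ρ a u) :
    AEStronglyMeasurable (grad u) (volume.restrict (cyl Ω)) :=
  S.aestronglyMeasurable_of_continuousOn S.continuousOn_grad

theorem aestronglyMeasurable_grad_dx (S : Setting Ω ρ a u) (i : Fin n) :
    AEStronglyMeasurable (grad (dx i u)) (volume.restrict (cyl Ω)) :=
  S.aestronglyMeasurable_of_continuousOn (S.continuousOn_grad_dx i)

theorem integrableBelow_flux_third (S : Setting Ω ρ a u) (hG : HasThirdDerivatives Ω a u G)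
    (i : Fin n) : IntegrableBelow Ω fun X => a X.2 ‖grad u X‖ * ⟪grad u X, G i i X⟫ := by
  refine S.integrableBelow_quadratic hG (c := 1) (S.aestronglyMeasurable_coeff.mul
    (S.aestronglyMeasurable_grad.inner (aestronglyMeasurable_third hG i i)))
    fun X hX e h1 h2 h3 => ?_
  have := S.coeff_pos hX
  rw [abs_mul, abs_of_pos this, one_mul]
  gcongr
  exact (abs_real_inner_le_norm _ _).trans (mul_le_of_sq_le h1 (h3 i i))

theorem integrableBelow_flux_grad_dx (S : Setting Ω ρ a u) (hG : HasThirdDerivatives Ω a u G)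
    (i : Fin n) :
    IntegrableBelow Ω fun X => a X.2 ‖grad u X‖ * ⟪grad u X, grad (dx i u) X⟫ := by
  refine S.integrableBelow_quadratic hG (c := 1) (S.aestronglyMeasurable_coeff.mul
    (S.aestronglyMeasurable_grad.inner (S.aestronglyMeasurable_grad_dx i)))
    fun X hX e h1 h2 h3 => ?_
  have := S.coeff_pos hX
  rw [abs_mul, abs_of_pos this, one_mul]
  gcongr
  exact (abs_real_inner_le_norm _ _).trans (mul_le_of_sq_le h1 (h2 i))

/-- The growth bound on `ℬ` reduces every such pairing to a product of two norms, each of which will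
be controlled by first and second derivatives of `u`. -/
theorem integrableBelow_inner_matB (S : Setting Ω ρ a u) (hG : HasThirdDerivatives Ω a u G)
    {ξ ζ : E n × ℝ → V n} (hξ : AEStronglyMeasurable ξ (volume.restrict (cyl Ω)))
    (hζ : AEStronglyMeasurable ζ (volume.restrict (cyl Ω))) {M : ℝ}
    (hle : ∀ X ∈ cyl Ω, ∀ e : ℝ, ‖grad u X‖ ^ 2 ≤ e → (∀ i, ‖grad (dx i u) X‖ ^ 2 ≤ e) →
      ‖ξ X‖ * ‖ζ X‖ ≤ M * e) :
    IntegrableBelow Ω fun X => ⟪matB a X.2 (grad u X) (ξ X), ζ X⟫ := by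
  obtain ⟨C, hC, hCb⟩ := S.coeff.bound
  refine S.integrableBelow_quadratic hG (c := (1 + C) * M)
    ((S.aestronglyMeasurable_matB hξ).inner hζ) fun X hX e h1 h2 h3 => ?_
  have := S.coeff_pos hX
  calc _ ≤ ‖matB a X.2 (grad u X) (ξ X)‖ * ‖ζ X‖ := abs_real_inner_le_norm _ _
    _ ≤ (1 + C) * a X.2 ‖grad u X‖ * ‖ξ X‖ * ‖ζ X‖ := by
        gcongr; exact norm_matB_le S.coeff hCb hX.2 _ _
    _ = (1 + C) * a X.2 ‖grad u X‖ * (‖ξ X‖ * ‖ζ X‖) := by ring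
    _ ≤ (1 + C) * a X.2 ‖grad u X‖ * (M * e) :=
        mul_le_mul_of_nonneg_left (hle X hX e h1 h2) (by positivity)
    _ = _ := by ring

theorem integrableBelow_inner_matB_dx (S : Setting Ω ρ a u) (hG : HasThirdDerivatives Ω a u G)
    (i : Fin n) : IntegrableBelow Ω fun X =>
      ⟪matB a X.2 (grad u X) (grad (dx i u) X), grad (dx i u) X⟫ :=
  S.integrableBelow_inner_matB hG (M := 1) (S.aestronglyMeasurable_grad_dx i)
    (S.aestronglyMeasurable_grad_dx i) fun X _ e _ h2 => by
      rw [one_mul]; exact mul_le_of_sq_le (h2 i) (h2 i)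

theorem integrableBelow_hessianForm (S : Setting Ω ρ a u) (hG : HasThirdDerivatives Ω a u G) :
    IntegrableBelow Ω (hessianForm a u) :=
  IntegrableBelow.sum _ fun i _ => S.integrableBelow_inner_matB_dx hG i

theorem integrableBelow_fluxForm (S : Setting Ω ρ a u) (hG : HasThirdDerivatives Ω a u G) :
    IntegrableBelow Ω (fluxForm a u G) :=
  IntegrableBelow.sum _ fun i _ => S.integrableBelow_flux_third hG i

/-- On almost every slice, the integral of `fluxForm + hessianForm` is the boundary integral of
`normalFlux`, as a limit of layer integrals. -/
theorem ae_tendsto_integral_normalFlux (S : Setting Ω ρ a u) (hG : HasThirdDerivatives Ω a u G) :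
    ∀ᵐ y ∂(volume : Measure ℝ).restrict (Ioi 0),
      Tendsto (fun k => ∫ x in Ω, layerKernel ρ k x * normalFlux Ω ρ a u y x) atTop
        (𝓝 (∫ x in Ω, (fluxForm a u G (x, y) + hessianForm a u (x, y)))) := by
  set H : ℕ → Fin n → E n × ℝ → ℝ := fun k i X =>
    innerCutoff ρ k X.1 * (a X.2 ‖grad u X‖ * ⟪grad u X, G i i X⟫
      + ⟪matB a X.2 (grad u X) (grad (dx i u) X), grad (dx i u) X⟫)
      + fderiv ℝ (innerCutoff ρ k) X.1 (EuclideanSpace.single i 1) *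
        (a X.2 ‖grad u X‖ * ⟪grad u X, grad (dx i u) X⟫) with hH
  have hHi : ∀ k i, IntegrableBelow Ω (H k i) := by
    intro k i
    have hζ := S.defining.contDiff_innerCutoff k
    have hd : Continuous fun x => fderiv ℝ (innerCutoff ρ k) x (EuclideanSpace.single i 1) :=
      (hζ.continuous_fderiv two_ne_zero).clm_apply continuous_const
    obtain ⟨M, hM⟩ := hd.bounded_above_of_compact_support
      ((S.defining.hasCompactSupport_innerCutoff S.isBounded k).fderiv_apply ℝ _)
    refine (((S.integrableBelow_flux_third hG i).add (S.integrableBelow_inner_matB_dx hG i)).bdd_mul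
      (hζ.continuous.comp continuous_fst) (M := 1) fun X => ?_).add
      ((S.integrableBelow_flux_grad_dx hG i).bdd_mul (hd.comp continuous_fst) (M := M)
        fun X => hM X.1)
    rw [Function.comp, abs_of_nonneg (innerCutoff_nonneg _ _)]
    exact innerCutoff_le_one _ _
  -- The exceptional heights depend on `k`; there are countably many `k`, so a single null set
  -- serves for the passage to the limit.
  have h1 : ∀ k, ∀ᵐ y ∂(volume : Measure ℝ).restrict (Ioi 0),
      ∫ x in Ω, ∑ i, H k i (x, y) = 0 := by
    intro k
    refine IntegrableBelow.ae_integral_slice_eq_zero S.isOpen (f := fun X => ∑ i, H k i X)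
      (IntegrableBelow.sum _ fun i _ => hHi k i) fun θ hθ hc hs => ?_
    obtain ⟨R, hR, h0⟩ := IntegrableBelow.exists_forall_eq_zero_of_hasCompactSupport hc
    obtain ⟨M, hM⟩ := hθ.continuous.bounded_above_of_compact_support hc
    simp only [Finset.mul_sum]
    rw [integral_finsetSum _ fun i _ =>
      (hHi k i).integrableOn_cyl_mul S.isOpen hθ.continuous hR h0 hM]
    exact Finset.sum_eq_zero fun i _ => S.integral_cutoff_mul_flux hG i k hθ.continuous hc hs
  filter_upwards [ae_all_iff.2 h1, ((S.integrableBelow_fluxForm hG).add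
    (S.integrableBelow_hessianForm hG)).ae_integrableOn_slice,
    ae_restrict_mem measurableSet_Ioi] with y hy hJ hy0
  refine (S.defining.tendsto_integral_innerCutoff_mul S.isOpen hJ).congr fun k => ?_
  have h2 : IntegrableOn (fun x => innerCutoff ρ k x *
      (fluxForm a u G (x, y) + hessianForm a u (x, y))) Ω :=
    Integrable.bdd_mul (c := 1) hJ
      (S.defining.contDiff_innerCutoff k).continuous.aestronglyMeasurable
      (Eventually.of_forall fun x => by
        rw [Real.norm_of_nonneg (innerCutoff_nonneg _ _)]; exact innerCutoff_le_one _ _)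
  rw [← sub_eq_zero, ← integral_sub h2 (S.defining.integrableOn_layerKernel_mul S.isBounded k
    (S.continuousOn_normalFlux hy0)), ← hy k]
  refine setIntegral_congr_fun S.isOpen.measurableSet fun x hx => ?_
  simp only [hH, S.normalFlux_eq hy0 hx, S.defining.fderiv_innerCutoff, Finset.sum_add_distrib,
    ← Finset.mul_sum, fluxForm, hessianForm, neg_mul, Finset.sum_neg_distrib, mul_assoc]
  ring

/-- This is where the curvature hypothesis acts: the limit of layer integrals of a function that is
nonpositive on `∂Ω` is nonpositive, and negative as soon as the function is negative at one boundary
point. -/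
theorem ae_integral_fluxForm_add_hessianForm_nonpos (S : Setting Ω ρ a u)
    (hG : HasThirdDerivatives Ω a u G)
    (hcurv : ∀ p ∈ frontier Ω, ∀ κ : ℝ, IsPrincipalCurvature Ω p κ → 0 < κ) :
    ∀ᵐ y ∂(volume : Measure ℝ).restrict (Ioi 0),
      ∫ x in Ω, (fluxForm a u G (x, y) + hessianForm a u (x, y)) ≤ 0 ∧
      (∫ x in Ω, (fluxForm a u G (x, y) + hessianForm a u (x, y)) = 0 →
        ∀ p ∈ frontier Ω, extDeriv Ω u (p, y) ∘L ContinuousLinearMap.inl ℝ (E n) ℝ = 0) := by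
  filter_upwards [S.ae_tendsto_integral_normalFlux hG, ae_restrict_mem measurableSet_Ioi]
    with y hy hy0
  have hc := S.continuousOn_normalFlux hy0
  have hle : ∀ p ∈ frontier Ω, normalFlux Ω ρ a u y p ≤ 0 := fun p hp =>
    (S.normalFlux_nonpos hcurv hy0 hp).1
  refine ⟨S.defining.nonpos_of_tendsto_integral_layerKernel S.isOpen S.isBounded S.convex
    S.nonempty hc hle hy, fun h0 p hp => ?_⟩
  by_contra hne
  exact (S.defining.lt_zero_of_tendsto_integral_layerKernel S.dim_pos S.isOpen S.isBounded S.convex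
    S.nonempty hc hle hp ((S.normalFlux_nonpos hcurv hy0 hp).2 hne) hy).ne h0

end Setting

end BoundaryFlux

/-! ### Integration by parts for the traces on the bottom. -/

section BottomTrace

section Abstract

variable {α : Type*} [MeasurableSpace α] {μ : Measure α}

/-- Split `c S` into `c (S - T)`, which is small by the uniform bound on `c`, and `c T`, to which
dominated convergence applies. -/
theorem tendsto_integral_mul_of_tendsto_lintegral {c S : ℕ → α → ℝ} {c₀ T : α → ℝ} {M : ℝ}
    (hc : ∀ k, AEStronglyMeasurable (c k) μ) (hM : ∀ k, ∀ᵐ x ∂μ, |c k x| ≤ M)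
    (hlim : ∀ᵐ x ∂μ, Tendsto (fun k => c k x) atTop (𝓝 (c₀ x)))
    (hS : ∀ k, Integrable (S k) μ) (hT : Integrable T μ)
    (h : Tendsto (fun k => ∫⁻ x, ‖S k x - T x‖ₑ ∂μ) atTop (𝓝 0)) :
    Tendsto (fun k => ∫ x, c k x * S k x ∂μ) atTop (𝓝 (∫ x, c₀ x * T x ∂μ)) := by
  have hcT : ∀ k, Integrable (fun x => c k x * T x) μ := fun k => hT.bdd_mul (hc k) (hM k)
  have h1 : Tendsto (fun k => ∫ x, c k x * T x ∂μ) atTop (𝓝 (∫ x, c₀ x * T x ∂μ)) := by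
    refine tendsto_integral_of_dominated_convergence (fun x => M * |T x|)
      (fun k => (hcT k).aestronglyMeasurable) (hT.abs.const_mul M) (fun k => ?_) ?_
    · filter_upwards [hM k] with x hx
      rw [norm_mul]
      exact mul_le_mul_of_nonneg_right hx (abs_nonneg _)
    · filter_upwards [hlim] with x hx using hx.mul_const _
  have h2 : Tendsto (fun k => ∫ x, c k x * (S k x - T x) ∂μ) atTop (𝓝 0) := by
    have h3 : Tendsto (fun k => ∫⁻ x, ‖c k x * (S k x - T x)‖ₑ ∂μ) atTop (𝓝 0) := by
      have h4 := ENNReal.Tendsto.const_mul (a := ENNReal.ofReal M) h (Or.inr ENNReal.ofReal_ne_top)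
      rw [mul_zero] at h4
      refine tendsto_of_tendsto_of_tendsto_of_le_of_le tendsto_const_nhds h4 (fun _ => zero_le)
        fun k => ?_
      change ∫⁻ x, ‖c k x * (S k x - T x)‖ₑ ∂μ ≤ ENNReal.ofReal M * ∫⁻ x, ‖S k x - T x‖ₑ ∂μ
      rw [← lintegral_const_mul' _ _ ENNReal.ofReal_ne_top]
      refine lintegral_mono_ae ?_
      filter_upwards [hM k] with x hx
      rw [enorm_mul]
      gcongr
      rw [Real.enorm_eq_ofReal_abs]
      exact ENNReal.ofReal_le_ofReal hx
    rw [tendsto_zero_iff_norm_tendsto_zero]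
    have h5 := (ENNReal.tendsto_toReal ENNReal.zero_ne_top).comp h3
    rw [ENNReal.toReal_zero] at h5
    refine squeeze_zero (fun _ => norm_nonneg _) (fun k => ?_) h5
    have hi : Integrable (fun x => c k x * (S k x - T x)) μ :=
      ((hS k).sub hT).bdd_mul (hc k) (hM k)
    rw [Function.comp, ← integral_norm_eq_lintegral_enorm hi.aestronglyMeasurable]
    exact norm_integral_le_integral_norm _
  refine ((h2.add h1).congr fun k => ?_).trans (by rw [zero_add])
  have hi : Integrable (fun x => c k x * (S k x - T x)) μ :=
    ((hS k).sub hT).bdd_mul (hc k) (hM k)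
  rw [← integral_add hi (hcT k)]
  exact integral_congr_ae (Eventually.of_forall fun x => by ring)

theorem eLpNorm_two_le_of_integral_sq_le {f : α → ℝ} (hf : MemLp f 2 μ) {δ : ℝ} (hδ : 0 ≤ δ)
    (h : ∫ x, f x ^ 2 ∂μ ≤ δ ^ 2) : eLpNorm f 2 μ ≤ ENNReal.ofReal δ := by
  rw [hf.eLpNorm_eq_integral_rpow_norm two_ne_zero ENNReal.ofNat_ne_top]
  refine ENNReal.ofReal_le_ofReal ?_
  simp only [ENNReal.toReal_ofNat, Real.rpow_ofNat, Real.norm_eq_abs, sq_abs]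
  rw [← one_div, ← Real.sqrt_eq_rpow]
  exact Real.sqrt_le_iff.2 ⟨hδ, h⟩

/-- Factor `p² - τ² = (p - τ)(p + τ)` and apply Hölder, the `L²` norms of `p + τ` being controlled
by those of `p - τ` and `τ`. -/
theorem tendsto_lintegral_sq_sub_sq {p : ℕ → α → ℝ} {τ : α → ℝ}
    (hp : ∀ k, AEStronglyMeasurable (p k) μ) (hτ : MemLp τ 2 μ)
    (h : Tendsto (fun k => eLpNorm (p k - τ) 2 μ) atTop (𝓝 0)) :
    Tendsto (fun k => ∫⁻ x, ‖p k x ^ 2 - τ x ^ 2‖ₑ ∂μ) atTop (𝓝 0) := by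
  have hfin : 2 * eLpNorm τ 2 μ ≠ ⊤ := ENNReal.mul_ne_top ENNReal.ofNat_ne_top hτ.eLpNorm_ne_top
  have h1 : Tendsto (fun k => eLpNorm (p k - τ) 2 μ * (eLpNorm (p k - τ) 2 μ + 2 * eLpNorm τ 2 μ))
      atTop (𝓝 0) := by
    have := ENNReal.Tendsto.mul h (Or.inr (by simpa using hfin)) (h.add_const (2 * eLpNorm τ 2 μ))
      (Or.inr ENNReal.zero_ne_top)
    simpa using this
  refine tendsto_of_tendsto_of_tendsto_of_le_of_le tendsto_const_nhds h1 (fun _ => zero_le)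
    fun k => ?_
  have hs : AEStronglyMeasurable (p k - τ) μ := (hp k).sub hτ.aestronglyMeasurable
  have h2 : eLpNorm ((p k - τ) • (p k + τ)) 1 μ ≤ eLpNorm (p k - τ) 2 μ * eLpNorm (p k + τ) 2 μ :=
    eLpNorm_smul_le_mul_eLpNorm ((hp k).add hτ.aestronglyMeasurable) hs
  have h3 : eLpNorm (p k + τ) 2 μ ≤ eLpNorm (p k - τ) 2 μ + 2 * eLpNorm τ 2 μ := by
    have h4 : p k + τ = (p k - τ) + (τ + τ) := by ring
    rw [h4, two_mul]
    refine (eLpNorm_add_le hs (hτ.aestronglyMeasurable.add hτ.aestronglyMeasurable) (by norm_num)).trans ?_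
    gcongr
    exact eLpNorm_add_le hτ.aestronglyMeasurable hτ.aestronglyMeasurable (by norm_num)
  calc _ = eLpNorm ((p k - τ) • (p k + τ)) 1 μ := by
        rw [eLpNorm_one_eq_lintegral_enorm]
        refine lintegral_congr fun x => ?_
        congr 1
        simp only [Pi.smul_apply', Pi.sub_apply, Pi.add_apply, smul_eq_mul]
        ring
    _ ≤ _ := h2.trans (by gcongr)

/-- A sequence that is Cauchy in `L²` and converges in `L¹` converges in `L²`. -/
theorem tendsto_eLpNorm_two_of_cauchy {p : ℕ → α → ℝ} {τ : α → ℝ}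
    (hp : ∀ k, AEStronglyMeasurable (p k) μ) (hτ : AEStronglyMeasurable τ μ)
    (h : Tendsto (fun k => ∫⁻ x, ‖p k x - τ x‖ₑ ∂μ) atTop (𝓝 0))
    (hC : ∀ δ > 0, ∃ N, ∀ k ≥ N, ∀ l ≥ N, eLpNorm (p k - p l) 2 μ ≤ ENNReal.ofReal δ) :
    Tendsto (fun k => eLpNorm (p k - τ) 2 μ) atTop (𝓝 0) := by
  rw [ENNReal.tendsto_atTop_zero]
  intro ε hε
  obtain ⟨δ, hδ, hδε⟩ : ∃ δ > 0, ENNReal.ofReal δ ≤ ε := by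
    rcases eq_or_ne ε ⊤ with h' | h'
    · exact ⟨1, one_pos, h' ▸ le_top⟩
    · exact ⟨ε.toReal, ENNReal.toReal_pos hε.ne' h', ENNReal.ofReal_toReal_le⟩
  obtain ⟨N, hN⟩ := hC δ hδ
  refine ⟨N, fun k hk => le_trans ?_ hδε⟩
  -- Fix `k` and let `l` tend to infinity: convergence in measure suffices for lower semicontinuity
  -- of the `L²` norm.
  have hm : TendstoInMeasure μ (fun l => p k - p l) atTop (p k - τ) := by
    refine tendstoInMeasure_of_tendsto_eLpNorm one_ne_zero (fun l => (hp k).sub (hp l))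
      ((hp k).sub hτ) (h.congr fun l => ?_)
    rw [eLpNorm_one_eq_lintegral_enorm]
    refine lintegral_congr fun x => ?_
    rw [← enorm_neg]
    congr 1
    simp only [Pi.sub_apply]
    ring
  exact eLpNorm_le_of_tendstoInMeasure (eventually_ge_atTop N |>.mono fun l hl => hN k hk l hl) hm
    fun l => (hp k).sub (hp l)

end Abstract

variable {n : ℕ} {Ω : Set (E n)} {ρ : E n → ℝ} {a : ℝ → ℝ → ℝ} {u : E n × ℝ → ℝ}

/-- Traces are limits of averages over heights, so individual slices need not converge. But if at
every small height some member of the finite family were far from its trace, the sum of the averages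
would not be small. A good height common to the whole family therefore exists. -/
theorem exists_lintegral_trace_le {ι : Type*} [Fintype ι]
    {φ : ι → E n × ℝ → ℝ} {τ : ι → E n → ℝ}
    (hm : ∀ i, AEStronglyMeasurable (φ i) (volume.restrict (cyl Ω)))
    (h : ∀ i, HasL2Trace Ω (φ i) (τ i)) {ε : ℝ} (hε : 0 < ε) :
    ∃ y ∈ Ioo 0 ε, ∀ i, ∫⁻ x in Ω, ‖φ i (x, y) - τ i x‖ₑ ≤ ENNReal.ofReal ε := by
  have hs := tendsto_finsetSum Finset.univ fun i _ => (h i).2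
  rw [Finset.sum_const_zero] at hs
  obtain ⟨t, htε, ht⟩ := ((hs.eventually (gt_mem_nhds (ENNReal.ofReal_pos.2 hε))).and
    (Ioo_mem_nhdsGT hε)).exists
  by_contra! hcon
  refine htε.not_ge ?_
  have hmt : ∀ i, AEMeasurable (fun X : E n × ℝ => ‖φ i X - τ i X.1‖ₑ)
      ((volume.restrict Ω).prod (volume.restrict (Ioo 0 t))) := fun i => by
    have h1 := (hm i).mono_set (IntegrableBelow.prod_Ioo_subset_cyl t)
    rw [restrict_prod_eq] at h1
    exact (h1.sub (h i).1.aestronglyMeasurable.comp_fst).enorm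
  have h0 : ENNReal.ofReal t ≠ 0 := (ENNReal.ofReal_pos.2 ht.1).ne'
  simp only [div_eq_mul_inv]
  rw [← Finset.sum_mul, ← div_eq_mul_inv, ENNReal.le_div_iff_mul_le (Or.inl h0)
    (Or.inl ENNReal.ofReal_ne_top)]
  have h1 : ∀ i, ∫⁻ X in Ω ×ˢ Ioo 0 t, ‖φ i X - τ i X.1‖ₑ
      = ∫⁻ y in Ioo 0 t, ∫⁻ x in Ω, ‖φ i (x, y) - τ i x‖ₑ := fun i => by
    rw [restrict_prod_eq, lintegral_prod_symm _ (hmt i)]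
  simp only [h1]
  rw [← lintegral_finsetSum' _ fun i _ => (hmt i).lintegral_prod_left']
  calc _ = ∫⁻ _ in Ioo 0 t, ENNReal.ofReal ε := by
        rw [setLIntegral_const, Real.volume_Ioo, sub_zero]
    _ ≤ _ := setLIntegral_mono' measurableSet_Ioo fun y hy => by
        obtain ⟨i, hi⟩ := hcon y ⟨hy.1, hy.2.trans ht.2⟩
        exact hi.le.trans (Finset.single_le_sum
          (f := fun i => ∫⁻ x in Ω, ‖φ i (x, y) - τ i x‖ₑ) (fun _ _ => zero_le) (Finset.mem_univ i))

theorem exists_seq_tendsto_trace {ι : Type*} [Fintype ι]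
    {φ : ι → E n × ℝ → ℝ} {τ : ι → E n → ℝ}
    (hm : ∀ i, AEStronglyMeasurable (φ i) (volume.restrict (cyl Ω)))
    (h : ∀ i, HasL2Trace Ω (φ i) (τ i)) :
    ∃ y : ℕ → ℝ, (∀ k, 0 < y k) ∧ (∀ k, y k ≤ 1) ∧ Tendsto y atTop (𝓝 0) ∧
      ∀ i, Tendsto (fun k => ∫⁻ x in Ω, ‖φ i (x, y k) - τ i x‖ₑ) atTop (𝓝 0) := by
  have hk : ∀ k : ℕ, (0 : ℝ) < 1 / (k + 1) := fun k => by positivity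
  choose y hy hyi using fun k : ℕ => exists_lintegral_trace_le hm h (hk k)
  refine ⟨y, fun k => (hy k).1, fun k => (hy k).2.le.trans ?_, ?_, fun i => ?_⟩
  · rw [div_le_one (by positivity)]
    linarith [k.cast_nonneg (α := ℝ)]
  · exact squeeze_zero (fun k => (hy k).1.le) (fun k => (hy k).2.le) tendsto_one_div_add_atTop_nhds_zero_nat
  · have h1 := ENNReal.tendsto_ofReal (tendsto_one_div_add_atTop_nhds_zero_nat (𝕜 := ℝ))
    rw [ENNReal.ofReal_zero] at h1
    exact tendsto_of_tendsto_of_tendsto_of_le_of_le tendsto_const_nhds h1 (fun _ => zero_le)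
      fun k => hyi k i

namespace Setting

theorem continuousOn_dxx (S : Setting Ω ρ a u) (i j : Fin n) :
    ContinuousOn (dx i (dx j u)) (cyl Ω) :=
  ((S.continuousOn_extDeriv₂.mono cyl_subset).clm_apply continuousOn_const |>.clm_apply
    continuousOn_const).congr fun _ hX => S.dx_dx i j hX

theorem exists_abs_sub_le (S : Setting Ω ρ a u) {w : E n × ℝ → ℝ}
    (hw : ContinuousOn w (closure Ω ×ˢ Ici 0)) {y : ℕ → ℝ} (hy0 : ∀ k, 0 < y k)
    (hy1 : ∀ k, y k ≤ 1) (hy : Tendsto y atTop (𝓝 0)) {δ : ℝ} (hδ : 0 < δ) :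
    ∃ N, ∀ k ≥ N, ∀ x ∈ closure Ω, |w (x, y k) - w (x, 0)| ≤ δ := by
  have hc : IsCompact (closure Ω ×ˢ Icc (0 : ℝ) 1) := S.isCompact_closure.prod isCompact_Icc
  have hu := hc.uniformContinuousOn_of_continuous
    (hw.mono (prod_mono subset_rfl Icc_subset_Ici_self))
  obtain ⟨r, hr, hru⟩ := Metric.uniformContinuousOn_iff.1 hu δ hδ
  obtain ⟨N, hN⟩ := Metric.tendsto_atTop.1 hy r hr
  refine ⟨N, fun k hk x hx => ?_⟩
  have := hru (x, y k) ⟨hx, (hy0 k).le, hy1 k⟩ (x, 0) ⟨hx, le_rfl, zero_le_one⟩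
    (by rw [Prod.dist_eq, dist_self]; simpa using hN k hk)
  rw [Real.dist_eq] at this
  exact this.le

/-- The horizontal derivatives, extended to the lateral boundary. -/
def extDx (Ω : Set (E n)) (u : E n × ℝ → ℝ) (y : ℝ) (i : Fin n) (x : E n) : ℝ :=
  extDeriv Ω u (x, y) (eX i)

/-- The horizontal Laplacian, extended to the lateral boundary. -/
def extLaplacian (Ω : Set (E n)) (u : E n × ℝ → ℝ) (y : ℝ) (x : E n) : ℝ :=
  ∑ i, extDeriv₂ Ω u (x, y) (eX i) (eX i)

theorem continuousOn_extDx (S : Setting Ω ρ a u) {y : ℝ} (hy : 0 < y) (i : Fin n) :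
    ContinuousOn (extDx Ω u y i) (closure Ω) :=
  (continuousOn_slice S.continuousOn_extDeriv hy).clm_apply continuousOn_const

theorem continuousOn_extLaplacian (S : Setting Ω ρ a u) {y : ℝ} (hy : 0 < y) :
    ContinuousOn (extLaplacian Ω u y) (closure Ω) :=
  continuousOn_finsetSum _ fun _ _ => ((continuousOn_slice S.continuousOn_extDeriv₂ hy).clm_apply
    continuousOn_const).clm_apply continuousOn_const

theorem dxx_sum_eq (S : Setting Ω ρ a u) {x : E n} (hx : x ∈ Ω) {y : ℝ} (hy : 0 < y) :
    ∑ i, dx i (dx i u) (x, y) = extLaplacian Ω u y x :=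
  Finset.sum_congr rfl fun i _ => S.dx_dx i i (show (x, y) ∈ cyl Ω from ⟨hx, hy⟩)

theorem integrableOn_of_continuousOn (S : Setting Ω ρ a u) {h : E n → ℝ}
    (hh : ContinuousOn h (closure Ω)) : IntegrableOn h Ω :=
  (hh.integrableOn_compact S.isCompact_closure).mono_set subset_closure

theorem memLp_two_of_continuousOn (S : Setting Ω ρ a u) {h : E n → ℝ}
    (hh : ContinuousOn h (closure Ω)) : MemLp h 2 (volume.restrict Ω) :=
  (memLp_two_iff_integrable_sq (S.integrableOn_of_continuousOn hh).aestronglyMeasurable).2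
    (S.integrableOn_of_continuousOn (hh.pow 2))

theorem integral_mul_extLaplacian (S : Setting Ω ρ a u) {y : ℝ} (hy : 0 < y)
    {φ : E n → ℝ} {φ' : E n → E n →L[ℝ] ℝ} (hφ : ∀ x ∈ Ω, HasFDerivAt φ (φ' x) x)
    (hφ' : ContinuousOn φ' (closure Ω)) :
    ∫ x in Ω, φ x * extLaplacian Ω u y x
      = -∫ x in Ω, ∑ i, φ' x (EuclideanSpace.single i 1) * extDx Ω u y i x := by
  obtain ⟨C, hC⟩ := S.exists_norm_le_of_continuousOn hφ'
  have h1 := S.integral_mul_laplacian_of_hasFDerivAt hy hφ hC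
  rw [← setIntegral_congr_fun S.isOpen.measurableSet fun x hx => congrArg (φ x * ·)
    (S.dxx_sum_eq hx hy), h1]
  congr 1
  exact setIntegral_congr_fun S.isOpen.measurableSet fun x hx =>
    Finset.sum_congr rfl fun i _ => by rw [S.dx_eq hx hy]; rfl

/-- The distance of two slices of `∇ₓu`, by Green's formula. -/
theorem integral_sum_sq_sub (S : Setting Ω ρ a u) {y z : ℝ} (hy : 0 < y) (hz : 0 < z) :
    ∫ x in Ω, ∑ i, (extDx Ω u y i x - extDx Ω u z i x) ^ 2
      = -∫ x in Ω, (u (x, y) - u (x, z)) * (extLaplacian Ω u y x - extLaplacian Ω u z x) := by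
  have hd : ∀ x ∈ Ω, HasFDerivAt (fun x => u (x, y) - u (x, z))
      ((extDeriv Ω u (x, y)).comp (ContinuousLinearMap.inl ℝ (E n) ℝ) -
        (extDeriv Ω u (x, z)).comp (ContinuousLinearMap.inl ℝ (E n) ℝ)) x := fun x hx =>
    (S.hasFDerivAt_slice hx hy).sub (S.hasFDerivAt_slice hx hz)
  have hc := (S.continuousOn_slice_deriv hy).sub (S.continuousOn_slice_deriv hz)
  have h1 := S.integral_mul_extLaplacian hy hd hc
  have h2 := S.integral_mul_extLaplacian hz hd hc
  have hu : ContinuousOn (fun x => u (x, y) - u (x, z)) (closure Ω) :=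
    (continuousOn_slice S.regular.contDiffOn.continuousOn hy).sub
      (continuousOn_slice S.regular.contDiffOn.continuousOn hz)
  have hi : ∀ {t : ℝ}, 0 < t → IntegrableOn (fun x => ∑ i,
      ((extDeriv Ω u (x, y)).comp (ContinuousLinearMap.inl ℝ (E n) ℝ) -
        (extDeriv Ω u (x, z)).comp (ContinuousLinearMap.inl ℝ (E n) ℝ)) (EuclideanSpace.single i 1)
        * extDx Ω u t i x) Ω := fun ht =>
    S.integrableOn_of_continuousOn (continuousOn_finsetSum _ fun i _ =>
      (hc.clm_apply continuousOn_const).mul (S.continuousOn_extDx ht i))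
  have hj : ∀ {t : ℝ}, 0 < t → IntegrableOn (fun x => (u (x, y) - u (x, z)) *
      extLaplacian Ω u t x) Ω := fun ht =>
    S.integrableOn_of_continuousOn (hu.mul (S.continuousOn_extLaplacian ht))
  have h3 := integral_sub (hj hy) (hj hz)
  have h4 := integral_sub (hi hy) (hi hz)
  simp only [mul_sub]
  rw [h3, h1, h2, neg_sub_neg, ← neg_sub, neg_neg, ← h4]
  refine integral_congr_ae (Eventually.of_forall fun x => ?_)
  simp only [← Finset.sum_sub_distrib, ← mul_sub, sq]
  rfl

/-- At the bottom, integration by parts holds for the traces of `∇ₓu` and `D²ₓu`. -/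
theorem integral_trace_laplacian (S : Setting Ω ρ a u) {f : ℝ → ℝ} (hf : ContDiff ℝ 1 f)
    {τ T : Fin n → E n → ℝ} (hτ : ∀ i, HasL2Trace Ω (dx i u) (τ i))
    (hT : ∀ i, HasL2Trace Ω (dx i (dx i u)) (T i)) :
    ∫ x in Ω, f (u (x, 0)) * ∑ i, T i x = -∫ x in Ω, deriv f (u (x, 0)) * ∑ i, τ i x ^ 2 := by
  have hfin : IsFiniteMeasure ((volume : Measure (E n)).restrict Ω) :=
    ⟨by rw [Measure.restrict_apply_univ]; exact S.isBounded.measure_lt_top⟩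
  have hmeas := S.isOpen.measurableSet
  -- First and second derivatives must converge along the same heights, since Green's formula links
  -- them on each slice.
  obtain ⟨y, hy0, hy1, hy, hlim⟩ := exists_seq_tendsto_trace (ι := Fin n ⊕ Fin n)
    (φ := Sum.elim (fun i => dx i u) fun i => dx i (dx i u)) (τ := Sum.elim τ T)
    (fun i => by
      rcases i with i | i
      · exact S.aestronglyMeasurable_of_continuousOn (S.contDiffOn_dx i).continuousOn
      · exact S.aestronglyMeasurable_of_continuousOn (S.continuousOn_dxx i i))
    (fun i => by
      rcases i with i | i
      · exact hτ i
      · exact hT i)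
  have hp : ∀ i, Tendsto (fun k => ∫⁻ x in Ω, ‖extDx Ω u (y k) i x - τ i x‖ₑ) atTop (𝓝 0) :=
    fun i => (hlim (Sum.inl i)).congr fun k => setLIntegral_congr_fun hmeas fun x hx => by
      simp only [Sum.elim_inl, S.dx_eq hx (hy0 k)]; rfl
  have hTi : ∀ i, Integrable (T i) (volume.restrict Ω) := fun i =>
    (hT i).1.integrable one_le_two
  have hTs : Integrable (fun x => ∑ i, T i x) (volume.restrict Ω) :=
    integrable_finsetSum _ fun i _ => hTi i
  have hL : Tendsto (fun k => ∫⁻ x in Ω, ‖extLaplacian Ω u (y k) x - ∑ i, T i x‖ₑ)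
      atTop (𝓝 0) := by
    have h1 := tendsto_finsetSum Finset.univ fun i _ => hlim (Sum.inr i)
    rw [Finset.sum_const_zero] at h1
    refine tendsto_of_tendsto_of_tendsto_of_le_of_le tendsto_const_nhds h1 (fun _ => zero_le)
      fun k => ?_
    change ∫⁻ x in Ω, ‖extLaplacian Ω u (y k) x - ∑ i, T i x‖ₑ
      ≤ ∑ i, ∫⁻ x in Ω, ‖dx i (dx i u) (x, y k) - T i x‖ₑ
    have hm : ∀ i ∈ Finset.univ, AEMeasurable (fun x => ‖dx i (dx i u) (x, y k) - T i x‖ₑ)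
        (volume.restrict Ω) := fun i _ => ((ContinuousOn.aestronglyMeasurable
      (f := fun x => dx i (dx i u) (x, y k)) ((S.continuousOn_dxx i i).comp (by fun_prop)
      fun x hx => ⟨hx, hy0 k⟩) hmeas).sub (hTi i).aestronglyMeasurable).enorm
    rw [← lintegral_finsetSum' _ hm]
    refine setLIntegral_mono' hmeas fun x hx => ?_
    rw [← S.dxx_sum_eq hx (hy0 k), ← Finset.sum_sub_distrib]
    exact enorm_sum_le _ _
  have hDc : ∀ k i, ContinuousOn (extDx Ω u (y k) i) (closure Ω) := fun k i =>
    S.continuousOn_extDx (hy0 k) i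
  have hLc : ∀ k, ContinuousOn (extLaplacian Ω u (y k)) (closure Ω) := fun k =>
    S.continuousOn_extLaplacian (hy0 k)
  have hLi := fun k => S.integrableOn_of_continuousOn (hLc k)
  have huc : ∀ k, ContinuousOn (fun x => u (x, y k)) (closure Ω) := fun k =>
    continuousOn_slice S.regular.contDiffOn.continuousOn (hy0 k)
  -- boundedness in `L¹` of the Laplacians
  obtain ⟨N₁, hN₁⟩ : ∃ N, ∀ k ≥ N, ∫ x in Ω, |extLaplacian Ω u (y k) x|
      ≤ 1 + ∫ x in Ω, |∑ i, T i x| := by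
    have h1 := (ENNReal.tendsto_toReal ENNReal.zero_ne_top).comp hL
    rw [ENNReal.toReal_zero] at h1
    obtain ⟨N, hN⟩ := eventually_atTop.1 (h1.eventually (gt_mem_nhds one_pos))
    refine ⟨N, fun k hk => ?_⟩
    have h2 := hN k hk
    have h3 : Integrable (fun x => extLaplacian Ω u (y k) x - ∑ i, T i x) (volume.restrict Ω) :=
      (hLi k).sub hTs
    rw [Function.comp, ← integral_norm_eq_lintegral_enorm h3.aestronglyMeasurable] at h2
    calc _ ≤ ∫ x in Ω, (|extLaplacian Ω u (y k) x - ∑ i, T i x| + |∑ i, T i x|) :=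
          integral_mono (hLi k).abs (h3.abs.add hTs.abs) fun x => by
            have := abs_add_le (extLaplacian Ω u (y k) x - ∑ i, T i x) (∑ i, T i x)
            rwa [sub_add_cancel] at this
      _ = _ := integral_add h3.abs hTs.abs
      _ ≤ _ := by
          have : ∫ x in Ω, |extLaplacian Ω u (y k) x - ∑ i, T i x| < 1 := h2
          linarith
  set B := 1 + ∫ x in Ω, |∑ i, T i x| with hB
  have hB0 : 0 < B := by
    have : 0 ≤ ∫ x in Ω, |∑ i, T i x| := integral_nonneg fun _ => abs_nonneg _
    linarith
  -- The squares `uᵢ²` need `L²` convergence, while the trace only provides `L¹`. Green's formula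
  -- supplies it: the squared `L²` distance of two slices of `∇ₓu` is at most the sup distance of
  -- the slices of `u`, which tends to zero, times the `L¹` norms of the Laplacians, which are
  -- bounded.
  have hL2 : ∀ i, Tendsto (fun k => eLpNorm (extDx Ω u (y k) i - τ i) 2 (volume.restrict Ω))
      atTop (𝓝 0) := by
    intro i
    refine tendsto_eLpNorm_two_of_cauchy
      (fun k => (S.integrableOn_of_continuousOn (hDc k i)).aestronglyMeasurable)
      (hτ i).1.aestronglyMeasurable (hp i) fun δ hδ => ?_
    -- Two slices, each within `δ² / (4B)` of the bottom, differ by at most `δ² / (2B)`; the two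
    -- Laplacians contribute at most `2B`.
    obtain ⟨N, hN⟩ := S.exists_abs_sub_le S.regular.continuousOn hy0 hy1 hy
      (δ := δ ^ 2 / (4 * B)) (by positivity)
    refine ⟨max N N₁, fun k hk l hl => ?_⟩
    refine eLpNorm_two_le_of_integral_sq_le (f := extDx Ω u (y k) i - extDx Ω u (y l) i)
      (S.memLp_two_of_continuousOn ((hDc k i).sub (hDc l i))) hδ.le ?_
    have hI1 := S.integrableOn_of_continuousOn (((hDc k i).sub (hDc l i)).pow 2)
    have hI2 : IntegrableOn (fun x => ∑ i, (extDx Ω u (y k) i x - extDx Ω u (y l) i x) ^ 2) Ω :=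
      S.integrableOn_of_continuousOn (continuousOn_finsetSum _ fun i _ =>
        ((hDc k i).sub (hDc l i)).pow 2)
    have hI3 : IntegrableOn (fun x => (u (x, y k) - u (x, y l)) *
        (extLaplacian Ω u (y k) x - extLaplacian Ω u (y l) x)) Ω :=
      S.integrableOn_of_continuousOn (((huc k).sub (huc l)).mul ((hLc k).sub (hLc l)))
    calc _ ≤ ∫ x in Ω, ∑ i, (extDx Ω u (y k) i x - extDx Ω u (y l) i x) ^ 2 :=
          integral_mono hI1 hI2 fun x => Finset.single_le_sum
            (f := fun i => (extDx Ω u (y k) i x - extDx Ω u (y l) i x) ^ 2)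
            (fun _ _ => sq_nonneg _) (Finset.mem_univ i)
      _ = ∫ x in Ω, -((u (x, y k) - u (x, y l)) *
            (extLaplacian Ω u (y k) x - extLaplacian Ω u (y l) x)) := by
          rw [S.integral_sum_sq_sub (hy0 k) (hy0 l), integral_neg]
      _ ≤ ∫ x in Ω, δ ^ 2 / (2 * B) * (|extLaplacian Ω u (y k) x| + |extLaplacian Ω u (y l) x|) := by
          refine setIntegral_mono_on hI3.neg (((hLi k).abs.add (hLi l).abs).const_mul _) hmeas
            fun x hx => ?_
          have h1 := hN k (le_of_max_le_left hk) x (subset_closure hx)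
          have h2 := hN l (le_of_max_le_left hl) x (subset_closure hx)
          have h3 : |u (x, y k) - u (x, y l)| ≤ δ ^ 2 / (2 * B) := by
            have h4 : δ ^ 2 / (2 * B) = δ ^ 2 / (4 * B) + δ ^ 2 / (4 * B) := by
              field_simp; norm_num
            rw [h4]
            have h5 : u (x, y k) - u (x, y l) = (u (x, y k) - u (x, 0)) - (u (x, y l) - u (x, 0)) := by
              ring
            rw [h5]
            exact (abs_sub _ _).trans (add_le_add h1 h2)
          refine (neg_le_abs _).trans ?_
          rw [abs_mul]
          exact mul_le_mul h3 (abs_sub _ _) (abs_nonneg _) (by positivity)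
      _ = δ ^ 2 / (2 * B) * ((∫ x in Ω, |extLaplacian Ω u (y k) x|)
            + ∫ x in Ω, |extLaplacian Ω u (y l) x|) := by
          rw [integral_const_mul, integral_add (hLi k).abs (hLi l).abs]
      _ ≤ δ ^ 2 / (2 * B) * (B + B) := by
          gcongr
          · exact hN₁ k (le_of_max_le_right hk)
          · exact hN₁ l (le_of_max_le_right hl)
      _ = δ ^ 2 := by field_simp; norm_num
  have hsq : ∀ i, Tendsto (fun k => ∫⁻ x in Ω, ‖extDx Ω u (y k) i x ^ 2 - τ i x ^ 2‖ₑ)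
      atTop (𝓝 0) := fun i => tendsto_lintegral_sq_sub_sq
    (fun k => (S.integrableOn_of_continuousOn (hDc k i)).aestronglyMeasurable) (hτ i).1 (hL2 i)
  -- the two limits
  have hcomp : ∀ F : ℝ → ℝ, Continuous F → ∀ {P : ℕ → E n → ℝ} {Q : E n → ℝ},
      (∀ k, ContinuousOn (P k) (closure Ω)) → Integrable Q (volume.restrict Ω) →
      Tendsto (fun k => ∫⁻ x in Ω, ‖P k x - Q x‖ₑ) atTop (𝓝 0) →
      Tendsto (fun k => ∫ x in Ω, F (u (x, y k)) * P k x) atTop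
        (𝓝 (∫ x in Ω, F (u (x, 0)) * Q x)) := by
    intro F hF P Q hP hQ hPQ
    have hFu : ContinuousOn (fun X => F (u X)) (closure Ω ×ˢ Ici 0) :=
      hF.comp_continuousOn S.regular.continuousOn
    obtain ⟨M, hM⟩ := (S.isCompact_closure.prod (isCompact_Icc (a := (0 : ℝ)) (b := 1))).exists_bound_of_continuousOn
      (hFu.mono (prod_mono subset_rfl Icc_subset_Ici_self))
    refine tendsto_integral_mul_of_tendsto_lintegral (M := M)
      (fun k => (S.integrableOn_of_continuousOn (hF.comp_continuousOn (huc k))).aestronglyMeasurable)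
      (fun k => ?_) ?_ (fun k => S.integrableOn_of_continuousOn (hP k)) hQ hPQ
    · filter_upwards [ae_restrict_mem hmeas] with x hx
      exact hM (x, y k) ⟨subset_closure hx, (hy0 k).le, hy1 k⟩
    · filter_upwards [ae_restrict_mem hmeas] with x hx
      rw [Metric.tendsto_atTop]
      intro ε hε
      obtain ⟨N, hN⟩ := S.exists_abs_sub_le hFu hy0 hy1 hy (half_pos hε)
      exact ⟨N, fun k hk => (hN k hk x (subset_closure hx)).trans_lt (half_lt_self hε)⟩
  have hl1 := hcomp f hf.continuous hLc hTs hL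
  have hτs : ∀ i, Integrable (fun x => τ i x ^ 2) (volume.restrict Ω) := fun i =>
    (hτ i).1.integrable_sq
  have hl2 := tendsto_finsetSum Finset.univ fun i _ => hcomp (deriv f) (hf.continuous_deriv le_rfl)
    (P := fun k x => extDx Ω u (y k) i x ^ 2) (fun k => (hDc k i).pow 2) (hτs i) (hsq i)
  have hfi : ∀ i, Integrable (fun x => deriv f (u (x, 0)) * τ i x ^ 2) (volume.restrict Ω) := by
    intro i
    have h0 : ContinuousOn (fun x => deriv f (u (x, 0))) (closure Ω) :=
      (hf.continuous_deriv le_rfl).comp_continuousOn (S.regular.continuousOn.comp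
        (f := fun x : E n => (x, (0 : ℝ))) (by fun_prop) fun x hx => ⟨hx, self_mem_Ici⟩)
    obtain ⟨M, hM⟩ := S.exists_norm_le_of_continuousOn h0
    exact (hτs i).bdd_mul (S.integrableOn_of_continuousOn h0).aestronglyMeasurable
      ((ae_restrict_mem hmeas).mono hM)
  refine tendsto_nhds_unique hl1 ((hl2.neg.congr fun k => ?_).trans_eq ?_)
  · have hd : ∀ x ∈ Ω, HasFDerivAt (fun x => f (u (x, y k))) (deriv f (u (x, y k)) •
        (extDeriv Ω u (x, y k)).comp (ContinuousLinearMap.inl ℝ (E n) ℝ)) x := fun x hx =>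
      (hf.differentiable one_ne_zero _).hasDerivAt.comp_hasFDerivAt x (S.hasFDerivAt_slice hx (hy0 k))
    have hdc := ((hf.continuous_deriv le_rfl).comp_continuousOn (huc k)).smul
      (S.continuousOn_slice_deriv (hy0 k))
    have hI : ∀ i ∈ Finset.univ, Integrable (fun x => deriv f (u (x, y k)) *
        extDx Ω u (y k) i x ^ 2) (volume.restrict Ω) := fun i _ =>
      S.integrableOn_of_continuousOn (((hf.continuous_deriv le_rfl).comp_continuousOn (huc k)).mul
        ((hDc k i).pow 2))
    rw [S.integral_mul_extLaplacian (hy0 k) hd hdc, ← integral_finsetSum _ hI]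
    congr 1
    refine integral_congr_ae (Eventually.of_forall fun x => Finset.sum_congr rfl fun i _ => ?_)
    simp only [extDx, smul_apply, smul_eq_mul, eX, sq, mul_assoc]
    rfl
  · congr 2
    rw [← integral_finsetSum _ fun i _ => hfi i]
    simp only [Finset.mul_sum]

end Setting

end BottomTrace

/-! ### Vertical cutoffs and the identity from testing with `η² Δₓu`. -/

section EnergyIdentity

variable {n : ℕ} {Ω : Set (E n)} {ρ : E n → ℝ} {a : ℝ → ℝ → ℝ} {u : E n × ℝ → ℝ}
  {G : Fin n → Fin n → E n × ℝ → V n}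

/-- The vertical unit vector. -/
def eY (n : ℕ) : V n := WithLp.toLp 2 ((0 : E n), (1 : ℝ))

theorem norm_eY : ‖eY n‖ = 1 := by
  have h : ‖eY n‖ ^ 2 = 1 := by
    rw [WithLp.prod_norm_sq_eq_of_L2]; simp [eY]
  rw [← Real.sqrt_sq (norm_nonneg (eY n)), h, Real.sqrt_one]

theorem inner_grad_eY (w : E n × ℝ → ℝ) (X : E n × ℝ) :
    ⟪grad w X, eY n⟫ = dy w X := inner_grad w X _

/-- A cutoff function of the vertical variable, equal to `1` near the bottom. -/
structure IsVerticalCutoff (η : ℝ → ℝ) (R M : ℝ) : Prop where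
  contDiff : ContDiff ℝ ∞ η
  pos : 0 < R
  eq_one : ∀ y, 0 < y → y ≤ 1 → η y = 1
  eq_zero : ∀ y ≥ R, η y = 0
  abs_le : ∀ y, |η y| ≤ 1
  abs_deriv_le : ∀ y, |deriv η y| ≤ M

namespace IsVerticalCutoff

variable {η : ℝ → ℝ} {R M : ℝ}

theorem differentiable (h : IsVerticalCutoff η R M) : Differentiable ℝ η :=
  h.contDiff.differentiable (by simp)

theorem continuous_deriv (h : IsVerticalCutoff η R M) : Continuous (deriv η) :=
  (contDiff_infty.1 h.contDiff 1).continuous_deriv (by norm_num)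

theorem deriv_eq_zero (h : IsVerticalCutoff η R M) {y : ℝ} (hy : R + 1 ≤ y) : deriv η y = 0 := by
  have : η =ᶠ[𝓝 y] fun _ => 0 := by
    filter_upwards [lt_mem_nhds (show R < y by linarith)] with t ht using h.eq_zero t ht.le
  rw [this.deriv_eq, deriv_const]

theorem deriv_sq_apply (h : IsVerticalCutoff η R M) (y : ℝ) :
    deriv (fun y => η y ^ 2) y = 2 * η y * deriv η y := by
  have := ((h.differentiable y).hasDerivAt.fun_pow 2).deriv
  simpa [mul_comm, mul_left_comm] using this

theorem sq (h : IsVerticalCutoff η R M) : IsVerticalCutoff (fun y => η y ^ 2) R (2 * M) where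
  contDiff := h.contDiff.pow 2
  pos := h.pos
  eq_one y h0 hy := by simp [h.eq_one y h0 hy]
  eq_zero y hy := by simp [h.eq_zero y hy]
  abs_le y := by rw [abs_pow]; exact pow_le_one₀ (abs_nonneg _) (h.abs_le y)
  abs_deriv_le y := by
    rw [h.deriv_sq_apply, abs_mul, abs_mul, abs_two]
    have h1 := h.abs_le y
    have h2 := h.abs_deriv_le y
    have := mul_le_mul h1 h2 (abs_nonneg _) zero_le_one
    linarith

theorem contDiff_comp_snd (h : IsVerticalCutoff η R M) :
    ContDiff ℝ ∞ fun X : E n × ℝ => η X.2 := h.contDiff.comp contDiff_snd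

theorem grad_comp_snd (h : IsVerticalCutoff η R M) (X : E n × ℝ) :
    grad (fun X : E n × ℝ => η X.2) X = deriv η X.2 • eY n := by
  have h1 : fderiv ℝ (fun X : E n × ℝ => η X.2) X
      = deriv η X.2 • ContinuousLinearMap.snd ℝ (E n) ℝ :=
    ((h.differentiable X.2).hasDerivAt.comp_hasFDerivAt X hasFDerivAt_snd).fderiv
  refine ext_inner_right ℝ fun ξ => ?_
  rw [inner_grad, h1, real_inner_smul_left, eY, WithLp.prod_inner_apply]
  simp

theorem integrableOn_mul (h : IsVerticalCutoff η R M) (hΩ : IsOpen Ω) {F : E n × ℝ → ℝ}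
    (hF : IntegrableBelow Ω F) : IntegrableOn (fun X => η X.2 * F X) (cyl Ω) :=
  hF.integrableOn_cyl_mul hΩ h.contDiff.continuous h.pos h.eq_zero h.abs_le

theorem integrableOn_deriv_mul (h : IsVerticalCutoff η R M) (hΩ : IsOpen Ω) {F : E n × ℝ → ℝ}
    (hF : IntegrableBelow Ω F) : IntegrableOn (fun X => deriv η X.2 * F X) (cyl Ω) :=
  hF.integrableOn_cyl_mul hΩ h.continuous_deriv (by linarith [h.pos])
    (fun _ hy => h.deriv_eq_zero hy) h.abs_deriv_le

/-- Products of a vertical cutoff with weakly differentiable functions of finite energy are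
test functions. -/
theorem isTest (h : IsVerticalCutoff η R M) (S : Setting Ω ρ a u) {w : E n × ℝ → ℝ}
    {Gw : E n × ℝ → V n} {τ : E n → ℝ} (hw : HasWeakGradient (cyl Ω) w Gw)
    (hτ : HasL2Trace Ω w τ)
    (h1 : IntegrableBelow Ω fun X => a X.2 ‖grad u X‖ * ‖Gw X‖ ^ 2)
    (h2 : IntegrableBelow Ω fun X => a X.2 ‖grad u X‖ * w X ^ 2) :
    IsTest Ω a u (fun X => η X.2 * w X) (fun X => η X.2 • Gw X + w X • (deriv η X.2 • eY n)) τ where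
  weakGradient := by
    have := hw.mul_left S.isOpen_cyl (h.contDiff_comp_snd (n := n))
    simpa only [h.grad_comp_snd] using this
  bounded_support := ⟨R, fun X _ hX => by rw [h.eq_zero _ hX.le, zero_mul]⟩
  integrable := by
    -- The constants come from `(p + q)² ≤ 2p² + 2q²`, with `M` bounding `η'`.
    have h3 : IntegrableBelow Ω fun X : E n × ℝ =>
        2 * (a X.2 ‖grad u X‖ * ‖Gw X‖ ^ 2) + 2 * M ^ 2 * (a X.2 ‖grad u X‖ * w X ^ 2) :=
      (h1.const_mul 2).add (h2.const_mul (2 * M ^ 2))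
    have h4 : IntegrableBelow Ω fun X : E n × ℝ => a X.2 ‖grad u X‖ *
        ‖η X.2 • Gw X + w X • (deriv η X.2 • eY n)‖ ^ 2 := by
      refine h3.mono' S.isOpen ?_ fun X hX => ?_
      · have hηm : AEStronglyMeasurable (fun X : E n × ℝ => η X.2) (volume.restrict (cyl Ω)) :=
          (h.contDiff.continuous.comp continuous_snd).aestronglyMeasurable
        have hηm' : AEStronglyMeasurable (fun X : E n × ℝ => deriv η X.2)
            (volume.restrict (cyl Ω)) :=
          (h.continuous_deriv.comp continuous_snd).aestronglyMeasurable
        exact S.aestronglyMeasurable_coeff.mul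
          (((hηm.smul hw.locallyIntegrable_grad.aestronglyMeasurable).add
            (hw.locallyIntegrable.aestronglyMeasurable.smul (hηm'.smul_const _))).norm.pow 2)
      · have hp := S.coeff_pos hX
        rw [Real.norm_of_nonneg (by positivity)]
        have h5 : ‖η X.2 • Gw X + w X • (deriv η X.2 • eY n)‖ ≤ ‖Gw X‖ + M * |w X| := by
          refine (norm_add_le _ _).trans (add_le_add ?_ ?_)
          · rw [norm_smul]
            exact mul_le_of_le_one_left (norm_nonneg _) (h.abs_le _)
          · rw [norm_smul, norm_smul, norm_eY, mul_one, mul_comm, Real.norm_eq_abs, Real.norm_eq_abs]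
            exact mul_le_mul_of_nonneg_right (h.abs_deriv_le _) (abs_nonneg _)
        have h6 : ‖η X.2 • Gw X + w X • (deriv η X.2 • eY n)‖ ^ 2
            ≤ 2 * ‖Gw X‖ ^ 2 + 2 * M ^ 2 * w X ^ 2 := by
          have h7 := pow_le_pow_left₀ (norm_nonneg _) h5 2
          have h8 : (M * |w X|) ^ 2 = M ^ 2 * w X ^ 2 := by rw [mul_pow, sq_abs]
          nlinarith [sq_nonneg (‖Gw X‖ - M * |w X|)]
        calc _ ≤ a X.2 ‖grad u X‖ * (2 * ‖Gw X‖ ^ 2 + 2 * M ^ 2 * w X ^ 2) := by gcongr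
          _ = _ := by ring
    refine h4.integrableOn_cyl S.isOpen (R := R + 1) (by linarith [h.pos]) fun X _ hX => ?_
    rw [h.eq_zero _ (by linarith), h.deriv_eq_zero hX]
    simp
  trace := by
    refine ⟨hτ.1, hτ.2.congr' ?_⟩
    -- For heights below `1` the cutoff equals `1`, so the averages defining the trace do not see
    -- it.
    filter_upwards [Ioo_mem_nhdsGT one_pos] with t ht
    congr 1
    refine setLIntegral_congr_fun (S.isOpen.prod isOpen_Ioo).measurableSet fun X hX => ?_
    simp only [h.eq_one X.2 hX.2.1 (hX.2.2.le.trans ht.2.le), one_mul]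

end IsVerticalCutoff

namespace Setting

theorem integral_cyl_eq_neg_of_slices {F₁ F₂ : E n × ℝ → ℝ}
    (h₁ : IntegrableOn F₁ (cyl Ω)) (h₂ : IntegrableOn F₂ (cyl Ω))
    (h : ∀ y > 0, ∫ x in Ω, F₁ (x, y) = -∫ x in Ω, F₂ (x, y)) :
    ∫ X in cyl Ω, F₁ X = -∫ X in cyl Ω, F₂ X := by
  rw [cyl, setIntegral_prod_symm h₁, setIntegral_prod_symm h₂, ← integral_neg]
  exact setIntegral_congr_fun measurableSet_Ioi fun y hy => h y hy

theorem integrableBelow_coeff_mul_third_sq (S : Setting Ω ρ a u)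
    (hG : HasThirdDerivatives Ω a u G) (i j : Fin n) :
    IntegrableBelow Ω fun X => a X.2 ‖grad u X‖ * ‖G i j X‖ ^ 2 := by
  refine S.integrableBelow_quadratic hG (c := 1) (S.aestronglyMeasurable_coeff.mul
    ((aestronglyMeasurable_third hG i j).norm.pow 2)) fun X hX e h1 h2 h3 => ?_
  have := S.coeff_pos hX
  rw [abs_of_nonneg (by positivity), one_mul]
  gcongr
  exact h3 i j

theorem integrableBelow_coeff_mul_grad_dx_sq (S : Setting Ω ρ a u)
    (hG : HasThirdDerivatives Ω a u G) (i : Fin n) :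
    IntegrableBelow Ω fun X => a X.2 ‖grad u X‖ * ‖grad (dx i u) X‖ ^ 2 := by
  refine S.integrableBelow_quadratic hG (c := 1) (S.aestronglyMeasurable_coeff.mul
    ((S.aestronglyMeasurable_grad_dx i).norm.pow 2)) fun X hX e h1 h2 h3 => ?_
  have := S.coeff_pos hX
  rw [abs_of_nonneg (by positivity), one_mul]
  gcongr
  exact h2 i

theorem sq_dx_le (i : Fin n) (w : E n × ℝ → ℝ) (X : E n × ℝ) : dx i w X ^ 2 ≤ ‖grad w X‖ ^ 2 := by
  rw [norm_sq_grad, norm_sq_gradx]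
  have h : dx i w X ^ 2 ≤ ∑ i, dx i w X ^ 2 := Finset.single_le_sum
    (f := fun i => dx i w X ^ 2) (fun _ _ => sq_nonneg _) (Finset.mem_univ i)
  linarith [sq_nonneg (dy w X)]

theorem sq_dy_le (w : E n × ℝ → ℝ) (X : E n × ℝ) : dy w X ^ 2 ≤ ‖grad w X‖ ^ 2 := by
  rw [norm_sq_grad]
  linarith [sq_nonneg ‖gradx w X‖]

theorem aestronglyMeasurable_dx (S : Setting Ω ρ a u) (i : Fin n) :
    AEStronglyMeasurable (dx i u) (volume.restrict (cyl Ω)) :=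
  S.aestronglyMeasurable_of_continuousOn (S.contDiffOn_dx i).continuousOn

theorem aestronglyMeasurable_dy (S : Setting Ω ρ a u) :
    AEStronglyMeasurable (dy u) (volume.restrict (cyl Ω)) :=
  S.aestronglyMeasurable_of_continuousOn (S.contDiffOn_fderiv.continuousOn.clm_apply
    continuousOn_const)

theorem integrableBelow_coeff_mul_dx_sq (S : Setting Ω ρ a u)
    (hG : HasThirdDerivatives Ω a u G) (i : Fin n) :
    IntegrableBelow Ω fun X => a X.2 ‖grad u X‖ * dx i u X ^ 2 := by
  refine S.integrableBelow_quadratic hG (c := 1) (S.aestronglyMeasurable_coeff.mul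
    ((S.aestronglyMeasurable_dx i).pow 2)) fun X hX e h1 h2 h3 => ?_
  have := S.coeff_pos hX
  rw [abs_of_nonneg (by positivity), one_mul]
  gcongr
  exact (sq_dx_le i u X).trans h1

theorem integrableBelow_coeff_mul_dxx_sq (S : Setting Ω ρ a u)
    (hG : HasThirdDerivatives Ω a u G) (i j : Fin n) :
    IntegrableBelow Ω fun X => a X.2 ‖grad u X‖ * dx i (dx j u) X ^ 2 := by
  refine S.integrableBelow_quadratic hG (c := 1) (S.aestronglyMeasurable_coeff.mul
    ((S.aestronglyMeasurable_of_continuousOn (S.continuousOn_dxx i j)).pow 2))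
    fun X hX e h1 h2 h3 => ?_
  have := S.coeff_pos hX
  rw [abs_of_nonneg (by positivity), one_mul]
  gcongr
  exact (sq_dx_le i (dx j u) X).trans (h2 j)

theorem integrableBelow_coeff_mul_dy_mul_dxx (S : Setting Ω ρ a u)
    (hG : HasThirdDerivatives Ω a u G) (i : Fin n) :
    IntegrableBelow Ω fun X => a X.2 ‖grad u X‖ * dy u X * dx i (dx i u) X := by
  refine S.integrableBelow_quadratic hG (c := 1) ((S.aestronglyMeasurable_coeff.mul
    S.aestronglyMeasurable_dy).mul
    (S.aestronglyMeasurable_of_continuousOn (S.continuousOn_dxx i i))) fun X hX e h1 h2 h3 => ?_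
  have := S.coeff_pos hX
  rw [abs_mul, abs_mul, abs_of_pos this, one_mul, mul_assoc]
  refine mul_le_mul_of_nonneg_left (mul_le_of_sq_le ?_ ?_) this.le
  · rw [sq_abs]; exact (sq_dy_le u X).trans h1
  · rw [sq_abs]; exact (sq_dx_le i (dx i u) X).trans (h2 i)

theorem integrableBelow_dx_mul_inner_matB (S : Setting Ω ρ a u)
    (hG : HasThirdDerivatives Ω a u G) (i : Fin n) :
    IntegrableBelow Ω fun X => dx i u X *
      ⟪matB a X.2 (grad u X) (grad (dx i u) X), eY n⟫ := by
  have h := S.integrableBelow_inner_matB hG (M := 1) (S.aestronglyMeasurable_grad_dx i)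
    (ζ := fun X => dx i u X • eY n) ((S.aestronglyMeasurable_dx i).smul_const _)
    fun X hX e h1 h2 => by
      rw [norm_smul, norm_eY, mul_one, one_mul]
      refine mul_le_of_sq_le (h2 i) ?_
      rw [Real.norm_eq_abs, sq_abs]
      exact (sq_dx_le i u X).trans h1
  simpa only [real_inner_smul_right] using h

variable {g : ℝ → ℝ → ℝ} {f : ℝ → ℝ} {η : ℝ → ℝ} {R M : ℝ}

/-- Convergence of the `g_u` term is part of the definition of stability; it is read off from the
admissible function `η uᵢ`. -/
theorem integrableOn_reaction (S : Setting Ω ρ a u) (hG : HasThirdDerivatives Ω a u G)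
    (hu : IsStableSolution Ω a g f u) (hη : IsVerticalCutoff η R M) (i : Fin n) :
    IntegrableOn (fun X => deriv (g X.2) (u X) * (η X.2 * dx i u X) ^ 2) (cyl Ω) := by
  obtain ⟨τ, hτ⟩ := S.regular.trace_dx i
  exact (hu.stable _ _ _ (hη.isTest S (hasWeakGradient_grad S.isOpen_cyl (S.contDiffOn_dx i)) hτ
    (S.integrableBelow_coeff_mul_grad_dx_sq hG i) (S.integrableBelow_coeff_mul_dx_sq hG i))).1

/-- The identity obtained by testing the equation with `η² Δₓu`. -/
theorem energy_identity (S : Setting Ω ρ a u) (hG : HasThirdDerivatives Ω a u G)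
    (hg : IsInteriorReaction g) (hf : ContDiff ℝ 1 f) (hu : IsStableSolution Ω a g f u)
    (hη : IsVerticalCutoff η R M) {τ : Fin n → E n → ℝ} (hτ : ∀ i, HasL2Trace Ω (dx i u) (τ i)) :
    (∫ X in cyl Ω, η X.2 ^ 2 * fluxForm a u G X)
      - (∫ X in cyl Ω, 2 * η X.2 * deriv η X.2 *
          ∑ i, dx i u X * ⟪matB a X.2 (grad u X) (grad (dx i u) X), eY n⟫)
      - (∫ X in cyl Ω, ∑ i, deriv (g X.2) (u X) * (η X.2 * dx i u X) ^ 2)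
      + (∫ x in Ω, deriv f (u (x, 0)) * ∑ i, τ i x ^ 2) = 0 := by
  choose T hT using fun i => S.regular.trace_dxx i i
  have hη2 := hη.sq
  -- The test functions are `η² uᵢᵢ`, one for each `i`. Only after summing over `i` do the
  -- Laplacian, and with it Green's formula, appear.
  have hw := fun i => hu.solution.weak _ _ _ (hη2.isTest S (hG.weakGradient i i) (hT i)
    (S.integrableBelow_coeff_mul_third_sq hG i i) (S.integrableBelow_coeff_mul_dxx_sq hG i i))
  have hI1 := fun i => hη2.integrableOn_mul S.isOpen (S.integrableBelow_flux_third hG i)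
  have hI2 := fun i => hη2.integrableOn_deriv_mul S.isOpen
    (S.integrableBelow_coeff_mul_dy_mul_dxx hG i)
  have hI3 := fun i => (hw i).1
  have hw' : ∀ i, (∫ X in cyl Ω, η X.2 ^ 2 * (a X.2 ‖grad u X‖ * ⟪grad u X, G i i X⟫))
      + (∫ X in cyl Ω, deriv (fun y => η y ^ 2) X.2 *
          (a X.2 ‖grad u X‖ * dy u X * dx i (dx i u) X))
      + (∫ X in cyl Ω, g X.2 (u X) * (η X.2 ^ 2 * dx i (dx i u) X))
      = ∫ x in Ω, f (u (x, 0)) * T i x := fun i => by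
    rw [← (hw i).2, ← integral_add (hI1 i) (hI2 i)]
    congr 1
    refine integral_congr_ae (Eventually.of_forall fun X => ?_)
    simp only [inner_add_right, real_inner_smul_right, inner_grad_eY]
    ring
  have hu0 : ContinuousOn (fun x => f (u (x, 0))) (closure Ω) :=
    hf.continuous.comp_continuousOn (S.regular.continuousOn.comp
      (f := fun x : E n => (x, (0 : ℝ))) (by fun_prop) fun x hx => ⟨hx, self_mem_Ici⟩)
  obtain ⟨N, hN⟩ := S.exists_norm_le_of_continuousOn hu0
  have hfin : IsFiniteMeasure ((volume : Measure (E n)).restrict Ω) :=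
    ⟨by rw [Measure.restrict_apply_univ]; exact S.isBounded.measure_lt_top⟩
  have hI4 : ∀ i ∈ Finset.univ, Integrable (fun x => f (u (x, 0)) * T i x) (volume.restrict Ω) :=
    fun i _ => ((hT i).1.integrable one_le_two).bdd_mul
      (S.integrableOn_of_continuousOn hu0).aestronglyMeasurable
      ((ae_restrict_mem S.isOpen.measurableSet).mono hN)
  have hsum := Finset.sum_congr (s₁ := Finset.univ) rfl fun i _ => hw' i
  rw [Finset.sum_add_distrib, Finset.sum_add_distrib, ← integral_finsetSum _ fun i _ => hI1 i,
    ← integral_finsetSum _ fun i _ => hI2 i, ← integral_finsetSum _ fun i _ => hI3 i,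
    ← integral_finsetSum _ hI4] at hsum
  simp only [← Finset.mul_sum] at hsum
  -- The bottom term `f(u) Δₓu` becomes `-f'(u) |∇ₓu|²` in terms of traces. The two identities below
  -- treat, slice by slice, the vertical flux and the reaction `g` in the same way.
  rw [S.integral_trace_laplacian hf hτ hT] at hsum
  have h2 : ∫ X in cyl Ω, deriv (fun y => η y ^ 2) X.2 *
      ∑ i, a X.2 ‖grad u X‖ * dy u X * dx i (dx i u) X
      = -∫ X in cyl Ω, deriv (fun y => η y ^ 2) X.2 *
          ∑ i, dx i u X * ⟪matB a X.2 (grad u X) (grad (dx i u) X), eY n⟫ := by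
    refine integral_cyl_eq_neg_of_slices
      (hη2.integrableOn_deriv_mul S.isOpen (IntegrableBelow.sum _ fun i _ =>
        S.integrableBelow_coeff_mul_dy_mul_dxx hG i))
      (hη2.integrableOn_deriv_mul S.isOpen (IntegrableBelow.sum _ fun i _ =>
        S.integrableBelow_dx_mul_inner_matB hG i)) fun y hy => ?_
    simp only [integral_const_mul, ← Finset.mul_sum]
    rw [S.integral_flux_mul_laplacian hy, mul_neg]
    rfl
  have h3 : ∫ X in cyl Ω, ∑ i, g X.2 (u X) * (η X.2 ^ 2 * dx i (dx i u) X)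
      = -∫ X in cyl Ω, ∑ i, deriv (g X.2) (u X) * (η X.2 * dx i u X) ^ 2 := by
    refine integral_cyl_eq_neg_of_slices (integrable_finsetSum _ fun i _ => hI3 i)
      (integrable_finsetSum _ fun i _ => S.integrableOn_reaction hG hu hη i) fun y hy => ?_
    have h4 := S.integral_locallyLipschitz_comp_mul_laplacian hy (hg.locallyLipschitz y hy)
    calc _ = ∫ x in Ω, η y ^ 2 * (g y (u (x, y)) * ∑ i, dx i (dx i u) (x, y)) :=
          integral_congr_ae (Eventually.of_forall fun x => by
            simp only [Finset.mul_sum]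
            exact Finset.sum_congr rfl fun i _ => by ring)
      _ = -(∫ x in Ω, η y ^ 2 * ∑ i, deriv (g y) (u (x, y)) * dx i u (x, y) ^ 2) := by
          rw [integral_const_mul, integral_const_mul, h4, mul_neg]
      _ = _ := by
          congr 1
          refine integral_congr_ae (Eventually.of_forall fun x => ?_)
          simp only [Finset.mul_sum]
          exact Finset.sum_congr rfl fun i _ => by ring
  simp only [← Finset.mul_sum] at h2 h3
  rw [h2, h3] at hsum
  simp only [hη.deriv_sq_apply] at hsum
  simp only [fluxForm, Finset.mul_sum] at hsum ⊢
  linarith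

end Setting

end EnergyIdentity

/-! ### Smooth approximation of `|∇ₓu|` as a stability test function. -/

section Stability

variable {n : ℕ} {Ω : Set (E n)} {ρ : E n → ℝ} {a : ℝ → ℝ → ℝ} {u : E n × ℝ → ℝ}
  {G : Fin n → Fin n → E n × ℝ → V n}

/-- A smooth approximation of the norm. -/
def smoothNorm (ε : ℝ) (p : E n) : ℝ := √(‖p‖ ^ 2 + ε ^ 2) - ε

theorem smoothNorm_nonneg (ε : ℝ) (p : E n) : 0 ≤ smoothNorm ε p := by
  refine sub_nonneg.2 ((le_abs_self ε).trans ?_)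
  exact Real.abs_le_sqrt (by linarith [sq_nonneg ‖p‖])

theorem smoothNorm_le {ε : ℝ} (hε : 0 ≤ ε) (p : E n) : smoothNorm ε p ≤ ‖p‖ := by
  rw [smoothNorm, sub_le_iff_le_add]
  exact Real.sqrt_le_iff.2 ⟨by positivity, by nlinarith [norm_nonneg p]⟩

/-- The regularised norm is a genuine norm in one more dimension. The triangle inequality there
shows that `smoothNorm ε` is `1`-Lipschitz, uniformly in `ε`. -/
theorem sqrt_eq_norm_toLp (ε : ℝ) (p : E n) :
    √(‖p‖ ^ 2 + ε ^ 2) = ‖(WithLp.toLp 2 (p, ε) : V n)‖ := by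
  rw [WithLp.prod_norm_eq_of_L2]
  simp

theorem abs_smoothNorm_sub_le (ε : ℝ) (p q : E n) :
    |smoothNorm ε p - smoothNorm ε q| ≤ ‖p - q‖ := by
  rw [smoothNorm, smoothNorm, sub_sub_sub_cancel_right, sqrt_eq_norm_toLp, sqrt_eq_norm_toLp]
  refine (abs_norm_sub_norm_le _ _).trans_eq ?_
  rw [← WithLp.toLp_sub, Prod.mk_sub_mk, sub_self, ← sqrt_eq_norm_toLp]
  simp [Real.sqrt_sq]

theorem norm_le_sum_abs (p : E n) : ‖p‖ ≤ ∑ i, |p i| := by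
  conv_lhs => rw [← sum_single_smul p]
  refine (norm_sum_le _ _).trans (Finset.sum_le_sum fun i _ => ?_)
  rw [norm_smul]
  simp

theorem continuous_smoothNorm (ε : ℝ) : Continuous (smoothNorm ε : E n → ℝ) := by
  unfold smoothNorm; fun_prop

theorem tendsto_smoothNorm (p : E n) :
    Tendsto (fun ε => smoothNorm ε p) (𝓝 0) (𝓝 ‖p‖) := by
  have h : Continuous fun ε : ℝ => smoothNorm ε p := by unfold smoothNorm; fun_prop
  have h2 := h.tendsto 0
  have h3 : smoothNorm 0 p = ‖p‖ := by simp [smoothNorm, Real.sqrt_sq]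
  rwa [h3] at h2

/-- The gradient of `smoothNorm ε (∇ₓu)`; for `ε = 0`, the gradient of `|∇ₓu|`, with value `0`
where `∇ₓu = 0`. -/
def gradNormGradx (u : E n × ℝ → ℝ) (ε : ℝ) (X : E n × ℝ) : V n :=
  ∑ i, (dx i u X / √(‖gradx u X‖ ^ 2 + ε ^ 2)) • grad (dx i u) X

theorem abs_dx_le (u : E n × ℝ → ℝ) (i : Fin n) (X : E n × ℝ) : |dx i u X| ≤ ‖gradx u X‖ := by
  have := PiLp.norm_apply_le (gradx u X) i
  simpa [gradx] using this

theorem norm_gradNormGradx_le (u : E n × ℝ → ℝ) (ε : ℝ) (X : E n × ℝ) :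
    ‖gradNormGradx u ε X‖ ≤ ∑ i, ‖grad (dx i u) X‖ := by
  refine (norm_sum_le _ _).trans (Finset.sum_le_sum fun i _ => ?_)
  rw [norm_smul]
  refine mul_le_of_le_one_left (norm_nonneg _) ?_
  rw [norm_div, Real.norm_eq_abs, Real.norm_of_nonneg (Real.sqrt_nonneg _)]
  refine div_le_one_of_le₀ ((abs_dx_le u i X).trans ?_) (Real.sqrt_nonneg _)
  exact Real.le_sqrt_of_sq_le (by linarith [sq_nonneg ε])

/-- Where `∇ₓu = 0` both sides vanish, so the convention for division by zero is harmless. -/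
theorem norm_gradx_smul_gradNormGradx (u : E n × ℝ → ℝ) (X : E n × ℝ) :
    ‖gradx u X‖ • gradNormGradx u 0 X = ∑ i, dx i u X • grad (dx i u) X := by
  rw [gradNormGradx, Finset.smul_sum]
  refine Finset.sum_congr rfl fun i _ => ?_
  rw [smul_smul]
  congr 1
  have h0 : √(‖gradx u X‖ ^ 2 + 0 ^ 2) = ‖gradx u X‖ := by simp [Real.sqrt_sq]
  rw [h0]
  rcases eq_or_ne ‖gradx u X‖ 0 with h | h
  · have := abs_dx_le u i X
    rw [h] at this
    rw [h, zero_mul, abs_nonpos_iff.1 this]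
  · field_simp

/-- At zeros of `∇ₓu` all numerators are zero, so the sum is zero for every `ε` and no smoothness of
the norm at the origin is involved. -/
theorem tendsto_gradNormGradx (u : E n × ℝ → ℝ) (X : E n × ℝ) :
    Tendsto (fun ε => gradNormGradx u ε X) (𝓝 0) (𝓝 (gradNormGradx u 0 X)) := by
  refine tendsto_finsetSum _ fun i _ => Tendsto.smul_const ?_ _
  rcases eq_or_ne ‖gradx u X‖ 0 with h | h
  · have := abs_dx_le u i X
    rw [h] at this
    simp [abs_nonpos_iff.1 this]
  · have hc : ContinuousAt (fun ε : ℝ => dx i u X / √(‖gradx u X‖ ^ 2 + ε ^ 2)) 0 := by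
      refine ContinuousAt.div continuousAt_const (by fun_prop) ?_
      simpa [Real.sqrt_sq] using h
    exact hc.tendsto

theorem IntegrableBelow.tendsto_integral_cyl (hΩ : IsOpen Ω) {F : ℕ → E n × ℝ → ℝ}
    {F₀ b : E n × ℝ → ℝ} (hb : IntegrableBelow Ω b)
    (hm : ∀ k, AEStronglyMeasurable (F k) (volume.restrict (cyl Ω)))
    (hle : ∀ k, ∀ X ∈ cyl Ω, |F k X| ≤ b X) {R : ℝ} (hR : 0 < R)
    (h0 : ∀ k, ∀ X ∈ cyl Ω, R ≤ X.2 → F k X = 0)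
    (hlim : ∀ X ∈ cyl Ω, Tendsto (fun k => F k X) atTop (𝓝 (F₀ X))) :
    Tendsto (fun k => ∫ X in cyl Ω, F k X) atTop (𝓝 (∫ X in cyl Ω, F₀ X)) := by
  have hms : MeasurableSet (Ω ×ˢ Ioo 0 R) := (hΩ.prod isOpen_Ioo).measurableSet
  refine tendsto_integral_of_dominated_convergence ((Ω ×ˢ Ioo 0 R).indicator b) hm
    ((integrable_indicator_iff hms).2 (hb R hR)).restrict (fun k => ?_) ?_
  · filter_upwards [ae_restrict_mem (hΩ.prod isOpen_Ioi).measurableSet] with X hX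
    by_cases h : X.2 < R
    · rw [indicator_of_mem (show X ∈ Ω ×ˢ Ioo 0 R from ⟨hX.1, hX.2, h⟩)]
      exact hle k X hX
    · rw [h0 k X hX (not_lt.1 h), norm_zero]
      exact indicator_nonneg (fun Y hY =>
        (abs_nonneg _).trans (hle k Y (prod_Ioo_subset_cyl R hY))) _
  · filter_upwards [ae_restrict_mem (hΩ.prod isOpen_Ioi).measurableSet] with X hX using hlim X hX

namespace Setting

theorem contDiffOn_smoothNorm_gradx (S : Setting Ω ρ a u) {ε : ℝ} (hε : 0 < ε) :
    ContDiffOn ℝ 1 (fun X => smoothNorm ε (gradx u X)) (cyl Ω) := by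
  have h1 : ContDiffOn ℝ 1 (fun X => ∑ i, dx i u X ^ 2 + ε ^ 2) (cyl Ω) :=
    (ContDiffOn.sum fun i _ => (S.contDiffOn_dx i).pow 2).add contDiffOn_const
  have h2 := (h1.sqrt fun X _ => by
    have : 0 ≤ ∑ i, dx i u X ^ 2 := Finset.sum_nonneg fun _ _ => sq_nonneg _
    positivity).sub (contDiffOn_const (c := ε))
  simpa only [smoothNorm, norm_sq_gradx] using h2

theorem grad_smoothNorm_gradx (S : Setting Ω ρ a u) {ε : ℝ} (hε : 0 < ε) {X : E n × ℝ}
    (hX : X ∈ cyl Ω) :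
    grad (fun X => smoothNorm ε (gradx u X)) X = gradNormGradx u ε X := by
  have h0 : 0 ≤ ∑ i, dx i u X ^ 2 := Finset.sum_nonneg fun _ _ => sq_nonneg _
  have hd : ∀ i, HasFDerivAt (dx i u) (fderiv ℝ (dx i u) X) X := fun i =>
    (((S.contDiffOn_dx i).differentiableOn one_ne_zero X hX).differentiableAt
      (S.isOpen_cyl.mem_nhds hX)).hasFDerivAt
  have h1 : HasFDerivAt (fun X => ∑ i, dx i u X ^ 2 + ε ^ 2)
      (∑ i, (2 * dx i u X) • fderiv ℝ (dx i u) X) X := by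
    refine (HasFDerivAt.fun_sum fun i _ => ?_).add_const _
    exact HasFDerivAt.congr_fderiv (f := fun X => dx i u X ^ 2) ((hd i).pow 2) (by simp)
  have h2 := (h1.sqrt (by positivity)).sub_const ε
  have h3 : (fun X => smoothNorm ε (gradx u X)) = fun X => √(∑ i, dx i u X ^ 2 + ε ^ 2) - ε := by
    funext Y
    rw [smoothNorm, norm_sq_gradx]
  rw [grad_eq, h3, h2.fderiv, map_smul, map_sum, gradNormGradx, Finset.smul_sum, norm_sq_gradx]
  refine Finset.sum_congr rfl fun i _ => ?_
  rw [map_smul, smul_smul, grad_eq]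
  congr 1
  field_simp

/-- The regularised norm is `1`-Lipschitz, so its distance from the proposed trace is at most the
sum of the distances of the components of `∇ₓu` from theirs. -/
theorem hasL2Trace_smoothNorm (S : Setting Ω ρ a u) {ε : ℝ} (hε : 0 ≤ ε)
    {τ : Fin n → E n → ℝ} (hτ : ∀ i, HasL2Trace Ω (dx i u) (τ i)) :
    HasL2Trace Ω (fun X => smoothNorm ε (gradx u X))
      fun x => smoothNorm ε (WithLp.toLp 2 fun i => τ i x) := by
  have hm : AEStronglyMeasurable (fun x => smoothNorm ε (WithLp.toLp 2 fun i => τ i x : E n))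
      (volume.restrict Ω) :=
    (continuous_smoothNorm ε).comp_aestronglyMeasurable
      ((PiLp.continuous_toLp 2 _).comp_aestronglyMeasurable
        (aemeasurable_pi_iff.2 fun i =>
          (hτ i).1.aestronglyMeasurable.aemeasurable).aestronglyMeasurable)
  have hsum : MemLp (fun x => ∑ i, |τ i x|) 2 (volume.restrict Ω) :=
    memLp_finsetSum _ fun i _ => (hτ i).1.abs
  refine ⟨hsum.mono hm (Eventually.of_forall fun x => ?_), ?_⟩
  · rw [Real.norm_of_nonneg (smoothNorm_nonneg _ _)]
    refine ((smoothNorm_le hε _).trans (norm_le_sum_abs _)).trans (le_abs_self _)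
  · have h1 := tendsto_finsetSum Finset.univ fun i _ => (hτ i).2
    rw [Finset.sum_const_zero] at h1
    refine tendsto_of_tendsto_of_tendsto_of_le_of_le tendsto_const_nhds h1 (fun _ => zero_le)
      fun t => ?_
    have hmt : ∀ i ∈ Finset.univ, AEMeasurable (fun X : E n × ℝ => ‖dx i u X - τ i X.1‖ₑ)
        (volume.restrict (Ω ×ˢ Ioo 0 t)) := fun i _ => by
      have h2 := (S.aestronglyMeasurable_dx i).mono_set (IntegrableBelow.prod_Ioo_subset_cyl t)
      rw [restrict_prod_eq] at h2 ⊢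
      exact (h2.sub (hτ i).1.aestronglyMeasurable.comp_fst).enorm
    simp only [div_eq_mul_inv]
    rw [← Finset.sum_mul, ← lintegral_finsetSum' _ hmt]
    gcongr with X
    have h3 : |smoothNorm ε (gradx u X) - smoothNorm ε (WithLp.toLp 2 fun i => τ i X.1)|
        ≤ ∑ i, |dx i u X - τ i X.1| := by
      refine (abs_smoothNorm_sub_le _ _ _).trans ((norm_le_sum_abs _).trans_eq ?_)
      simp [gradx]
    rw [Real.enorm_eq_ofReal_abs]
    refine (ENNReal.ofReal_le_ofReal h3).trans_eq ?_
    rw [ENNReal.ofReal_sum_of_nonneg fun _ _ => abs_nonneg _]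
    simp only [Real.enorm_eq_ofReal_abs]

end Setting

end Stability

/-! ### Stability for `η |∇ₓu|`, and its combination with the energy identity. -/

section EnergyInequality

variable {n : ℕ} {Ω : Set (E n)} {ρ : E n → ℝ} {a : ℝ → ℝ → ℝ} {u : E n × ℝ → ℝ}
  {G : Fin n → Fin n → E n × ℝ → V n} {g : ℝ → ℝ → ℝ} {f : ℝ → ℝ} {η : ℝ → ℝ} {R M : ℝ}

/-- The quadratic form `⟨ℬ∇|∇ₓu|, ∇|∇ₓu|⟩`. -/
def normForm (a : ℝ → ℝ → ℝ) (u : E n × ℝ → ℝ) (X : E n × ℝ) : ℝ :=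
  ⟪matB a X.2 (grad u X) (gradNormGradx u 0 X), gradNormGradx u 0 X⟫

theorem inner_matB_add_self (a : ℝ → ℝ → ℝ) (y : ℝ) (η ξ ζ : V n) (r s : ℝ) :
    ⟪matB a y η (r • ξ + s • ζ), r • ξ + s • ζ⟫
      = r ^ 2 * ⟪matB a y η ξ, ξ⟫ + 2 * (r * s) * ⟪matB a y η ξ, ζ⟫
        + s ^ 2 * ⟪matB a y η ζ, ζ⟫ := by
  have h := inner_matB_comm a y η ζ ξ
  simp only [← matBL_apply] at h ⊢
  simp only [map_add, map_smul, inner_add_left, inner_add_right, real_inner_smul_left,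
    real_inner_smul_right]
  rw [h]
  ring

theorem inner_matB_sum_smul (a : ℝ → ℝ → ℝ) (y : ℝ) (η : V n) {ι : Type*} (s : Finset ι)
    (c : ι → ℝ) (ξ : ι → V n) (ζ : V n) :
    ⟪matB a y η (∑ i ∈ s, c i • ξ i), ζ⟫ = ∑ i ∈ s, c i * ⟪matB a y η (ξ i), ζ⟫ := by
  simp only [← matBL_apply, map_sum, map_smul, sum_inner, real_inner_smul_left]

namespace Setting

theorem sum_norm_sq_le {D : Fin n → V n} {e : ℝ} (h : ∀ i, ‖D i‖ ^ 2 ≤ e) (he : 0 ≤ e) :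
    (∑ i, ‖D i‖) ^ 2 ≤ (n : ℝ) ^ 2 * e := by
  have h1 : ∑ i, ‖D i‖ ≤ n * √e := by
    calc _ ≤ ∑ _i : Fin n, √e := Finset.sum_le_sum fun i _ => Real.le_sqrt_of_sq_le (h i)
      _ = _ := by simp
  calc _ ≤ (n * √e) ^ 2 := pow_le_pow_left₀ (Finset.sum_nonneg fun _ _ => norm_nonneg _) h1 2
    _ = _ := by rw [mul_pow, Real.sq_sqrt he]

theorem norm_sq_gradx_le (u : E n × ℝ → ℝ) (X : E n × ℝ) : ‖gradx u X‖ ^ 2 ≤ ‖grad u X‖ ^ 2 := by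
  rw [norm_sq_grad]; linarith [sq_nonneg (dy u X)]

theorem aestronglyMeasurable_gradx (S : Setting Ω ρ a u) :
    AEStronglyMeasurable (gradx u) (volume.restrict (cyl Ω)) :=
  S.aestronglyMeasurable_of_continuousOn S.continuousOn_gradx

theorem aestronglyMeasurable_gradNormGradx (S : Setting Ω ρ a u) (ε : ℝ) :
    AEStronglyMeasurable (gradNormGradx u ε) (volume.restrict (cyl Ω)) := by
  have h1 : AEStronglyMeasurable (fun X => √(‖gradx u X‖ ^ 2 + ε ^ 2)) (volume.restrict (cyl Ω)) :=
    Real.continuous_sqrt.comp_aestronglyMeasurable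
      ((S.aestronglyMeasurable_gradx.norm.pow 2).add aestronglyMeasurable_const)
  exact Finset.aestronglyMeasurable_fun_sum _ fun i _ =>
    ((S.aestronglyMeasurable_dx i).aemeasurable.div h1.aemeasurable).aestronglyMeasurable.smul
      (S.aestronglyMeasurable_grad_dx i)

theorem integrableBelow_coeff_mul_sum_sq (S : Setting Ω ρ a u) (hG : HasThirdDerivatives Ω a u G) :
    IntegrableBelow Ω fun X => a X.2 ‖grad u X‖ *
      ((∑ i, ‖grad (dx i u) X‖) ^ 2 + ‖gradx u X‖ ^ 2) := by
  refine S.integrableBelow_quadratic hG (c := (n : ℝ) ^ 2 + 1) (S.aestronglyMeasurable_coeff.mul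
    (((Finset.aestronglyMeasurable_fun_sum _ fun i _ =>
      (S.aestronglyMeasurable_grad_dx i).norm).pow 2).add (S.aestronglyMeasurable_gradx.norm.pow 2)))
    fun X hX e h1 h2 _ => ?_
  have hp := S.coeff_pos hX
  have h3 := sum_norm_sq_le h2 ((sq_nonneg _).trans h1)
  have h4 := (norm_sq_gradx_le u X).trans h1
  rw [abs_of_nonneg (by positivity)]
  calc _ ≤ a X.2 ‖grad u X‖ * ((n : ℝ) ^ 2 * e + e) := by gcongr
    _ = _ := by ring

theorem integrableBelow_coeff_mul_gradx_sq (S : Setting Ω ρ a u)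
    (hG : HasThirdDerivatives Ω a u G) :
    IntegrableBelow Ω fun X => a X.2 ‖grad u X‖ * ‖gradx u X‖ ^ 2 := by
  refine (S.integrableBelow_coeff_mul_sum_sq hG).mono' S.isOpen
    (S.aestronglyMeasurable_coeff.mul (S.aestronglyMeasurable_gradx.norm.pow 2)) fun X hX => ?_
  have hp := S.coeff_pos hX
  rw [Real.norm_of_nonneg (by positivity)]
  gcongr
  exact le_add_of_nonneg_left (sq_nonneg _)

/-- The stability inequality for `φ = (√(|∇ₓu|² + ε²) - ε) η`. -/
theorem stability_smoothNorm (S : Setting Ω ρ a u) (hG : HasThirdDerivatives Ω a u G)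
    (hu : IsStableSolution Ω a g f u) (hη : IsVerticalCutoff η R M) {τ : Fin n → E n → ℝ}
    (hτ : ∀ i, HasL2Trace Ω (dx i u) (τ i)) {ε : ℝ} (hε : 0 < ε) :
    IntegrableOn (fun X => deriv (g X.2) (u X) * (η X.2 * smoothNorm ε (gradx u X)) ^ 2) (cyl Ω) ∧
    0 ≤ (∫ X in cyl Ω, ⟪matB a X.2 (grad u X) (η X.2 • gradNormGradx u ε X
            + smoothNorm ε (gradx u X) • (deriv η X.2 • eY n)),
          η X.2 • gradNormGradx u ε X + smoothNorm ε (gradx u X) • (deriv η X.2 • eY n)⟫)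
      + (∫ X in cyl Ω, deriv (g X.2) (u X) * (η X.2 * smoothNorm ε (gradx u X)) ^ 2)
      - ∫ x in Ω, deriv f (u (x, 0)) * smoothNorm ε (WithLp.toLp 2 fun i => τ i x : E n) ^ 2 := by
  have hq := S.integrableBelow_coeff_mul_sum_sq hG
  have hm := S.contDiffOn_smoothNorm_gradx hε
  have hgr : ∀ X ∈ cyl Ω, grad (fun X => smoothNorm ε (gradx u X)) X = gradNormGradx u ε X :=
    fun X hX => S.grad_smoothNorm_gradx hε hX
  have ht := hη.isTest S (hasWeakGradient_grad S.isOpen_cyl hm) (S.hasL2Trace_smoothNorm hε.le hτ)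
    (hq.mono' S.isOpen (S.aestronglyMeasurable_coeff.mul
      ((S.aestronglyMeasurable_of_continuousOn
        (BoundaryReaction.continuousOn_grad S.isOpen_cyl hm)).norm.pow 2)) fun X hX => by
        have hp := S.coeff_pos hX
        rw [Real.norm_of_nonneg (by positivity), hgr X hX]
        have := pow_le_pow_left₀ (norm_nonneg _) (norm_gradNormGradx_le u ε X) 2
        gcongr
        linarith [sq_nonneg ‖gradx u X‖])
    (hq.mono' S.isOpen (S.aestronglyMeasurable_coeff.mul
      ((S.aestronglyMeasurable_of_continuousOn hm.continuousOn).pow 2)) fun X hX => by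
        have hp := S.coeff_pos hX
        rw [Real.norm_of_nonneg (by positivity)]
        have := pow_le_pow_left₀ (smoothNorm_nonneg _ _) (smoothNorm_le hε.le (gradx u X)) 2
        gcongr
        linarith [sq_nonneg (∑ i, ‖grad (dx i u) X‖)])
  obtain ⟨h1, h2⟩ := hu.stable _ _ _ ht
  refine ⟨h1, ?_⟩
  rw [setIntegral_congr_fun S.isOpen_cyl.measurableSet fun X hX => by rw [hgr X hX]] at h2
  exact h2

/-- The stability inequality for `φ = |∇ₓu| η`. -/
theorem stability_norm (S : Setting Ω ρ a u) (hG : HasThirdDerivatives Ω a u G)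
    (hf : ContDiff ℝ 1 f) (hu : IsStableSolution Ω a g f u) (hη : IsVerticalCutoff η R M)
    {τ : Fin n → E n → ℝ} (hτ : ∀ i, HasL2Trace Ω (dx i u) (τ i)) :
    0 ≤ (∫ X in cyl Ω, ⟪matB a X.2 (grad u X) (η X.2 • gradNormGradx u 0 X
            + ‖gradx u X‖ • (deriv η X.2 • eY n)),
          η X.2 • gradNormGradx u 0 X + ‖gradx u X‖ • (deriv η X.2 • eY n)⟫)
      + (∫ X in cyl Ω, ∑ i, deriv (g X.2) (u X) * (η X.2 * dx i u X) ^ 2)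
      - ∫ x in Ω, deriv f (u (x, 0)) * ∑ i, τ i x ^ 2 := by
  obtain ⟨C, hC, hCb⟩ := S.coeff.bound
  set ε : ℕ → ℝ := fun k => 1 / ((k : ℝ) + 1) with hεd
  have hε : ∀ k, 0 < ε k := fun k => by positivity
  have hε0 : Tendsto ε atTop (𝓝 0) := tendsto_one_div_add_atTop_nhds_zero_nat
  have hst := fun k => S.stability_smoothNorm hG hu hη hτ (hε k)
  set W : ℕ → E n × ℝ → V n := fun k X => η X.2 • gradNormGradx u (ε k) X
    + smoothNorm (ε k) (gradx u X) • (deriv η X.2 • eY n) with hW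
  have hηm : AEStronglyMeasurable (fun X : E n × ℝ => η X.2) (volume.restrict (cyl Ω)) :=
    (hη.contDiff.continuous.comp continuous_snd).aestronglyMeasurable
  have hηm' : AEStronglyMeasurable (fun X : E n × ℝ => deriv η X.2) (volume.restrict (cyl Ω)) :=
    (hη.continuous_deriv.comp continuous_snd).aestronglyMeasurable
  have hWm : ∀ k, AEStronglyMeasurable (W k) (volume.restrict (cyl Ω)) := fun k =>
    (hηm.smul (S.aestronglyMeasurable_gradNormGradx _)).add
      (((continuous_smoothNorm (ε k)).comp_aestronglyMeasurable S.aestronglyMeasurable_gradx).smul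
        (hηm'.smul_const _))
  have hWle : ∀ k X, ‖W k X‖ ^ 2
      ≤ 2 * (1 + M ^ 2) * ((∑ i, ‖grad (dx i u) X‖) ^ 2 + ‖gradx u X‖ ^ 2) := by
    intro k X
    have h1 : ‖W k X‖ ≤ (∑ i, ‖grad (dx i u) X‖) + M * ‖gradx u X‖ := by
      refine (norm_add_le _ _).trans (add_le_add ?_ ?_)
      · rw [norm_smul]
        exact (mul_le_of_le_one_left (norm_nonneg _) (hη.abs_le _)).trans
          (norm_gradNormGradx_le u _ X)
      · rw [norm_smul, norm_smul, norm_eY, mul_one, mul_comm,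
          Real.norm_of_nonneg (smoothNorm_nonneg _ _)]
        exact mul_le_mul (hη.abs_deriv_le _) (smoothNorm_le (hε k).le _) (smoothNorm_nonneg _ _)
          ((abs_nonneg _).trans (hη.abs_deriv_le 0))
    have h2 := pow_le_pow_left₀ (norm_nonneg _) h1 2
    nlinarith [sq_nonneg ((∑ i, ‖grad (dx i u) X‖) - M * ‖gradx u X‖),
      mul_nonneg (sq_nonneg M) (sq_nonneg (∑ i, ‖grad (dx i u) X‖)), sq_nonneg ‖gradx u X‖]
  -- the quadratic form
  have hl1 : Tendsto (fun k => ∫ X in cyl Ω, ⟪matB a X.2 (grad u X) (W k X), W k X⟫) atTop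
      (𝓝 (∫ X in cyl Ω, ⟪matB a X.2 (grad u X) (η X.2 • gradNormGradx u 0 X
            + ‖gradx u X‖ • (deriv η X.2 • eY n)),
          η X.2 • gradNormGradx u 0 X + ‖gradx u X‖ • (deriv η X.2 • eY n)⟫)) := by
    refine IntegrableBelow.tendsto_integral_cyl S.isOpen
      ((S.integrableBelow_coeff_mul_sum_sq hG).const_mul ((1 + C) * (2 * (1 + M ^ 2))))
      (fun k => (S.aestronglyMeasurable_matB (hWm k)).inner (hWm k)) (fun k X hX => ?_)
      (R := R + 1) (by linarith [hη.pos]) (fun k X _ hX => ?_) fun X hX => ?_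
    · have hp := S.coeff_pos hX
      calc _ ≤ ‖matB a X.2 (grad u X) (W k X)‖ * ‖W k X‖ := abs_real_inner_le_norm _ _
        _ ≤ (1 + C) * a X.2 ‖grad u X‖ * ‖W k X‖ * ‖W k X‖ := by
            gcongr; exact norm_matB_le S.coeff hCb hX.2 _ _
        _ = (1 + C) * a X.2 ‖grad u X‖ * ‖W k X‖ ^ 2 := by ring
        _ ≤ (1 + C) * a X.2 ‖grad u X‖ *
            (2 * (1 + M ^ 2) * ((∑ i, ‖grad (dx i u) X‖) ^ 2 + ‖gradx u X‖ ^ 2)) :=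
            mul_le_mul_of_nonneg_left (hWle k X) (by positivity)
        _ = _ := by ring
    · have : W k X = 0 := by
        simp only [hW]
        rw [hη.eq_zero _ (by linarith), hη.deriv_eq_zero hX]
        simp
      rw [this, inner_zero_right]
    · have h1 : Tendsto (fun k => W k X) atTop (𝓝 (η X.2 • gradNormGradx u 0 X
          + ‖gradx u X‖ • (deriv η X.2 • eY n))) :=
        (((tendsto_gradNormGradx u X).comp hε0).const_smul _).add
          (((tendsto_smoothNorm (gradx u X)).comp hε0).smul_const _)
      simp only [← matBL_apply]
      exact (((matBL a X.2 (grad u X)).continuous.tendsto _).comp h1).inner h1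
  -- the reaction in the interior
  have hl2 : Tendsto (fun k => ∫ X in cyl Ω,
      deriv (g X.2) (u X) * (η X.2 * smoothNorm (ε k) (gradx u X)) ^ 2) atTop
      (𝓝 (∫ X in cyl Ω, ∑ i, deriv (g X.2) (u X) * (η X.2 * dx i u X) ^ 2)) := by
    have hint : IntegrableOn (fun X => ∑ i, deriv (g X.2) (u X) * (η X.2 * dx i u X) ^ 2) (cyl Ω) :=
      integrable_finsetSum _ fun i _ => S.integrableOn_reaction hG hu hη i
    have heq : ∀ X, ∑ i, deriv (g X.2) (u X) * (η X.2 * dx i u X) ^ 2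
        = deriv (g X.2) (u X) * (η X.2 * ‖gradx u X‖) ^ 2 := fun X => by
      rw [mul_pow, norm_sq_gradx, Finset.mul_sum, Finset.mul_sum]
      exact Finset.sum_congr rfl fun i _ => by rw [mul_pow]
    refine tendsto_integral_of_dominated_convergence _ (fun k => (hst k).1.aestronglyMeasurable)
      hint.norm (fun k => Eventually.of_forall fun X => ?_) (Eventually.of_forall fun X => ?_)
    · rw [heq, norm_mul, norm_mul, norm_pow, norm_pow, norm_mul, norm_mul,
        Real.norm_of_nonneg (smoothNorm_nonneg _ _), norm_norm]
      have := smoothNorm_le (hε k).le (gradx u X)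
      have := smoothNorm_nonneg (ε k) (gradx u X)
      gcongr
    · rw [heq]
      exact ((((tendsto_smoothNorm (gradx u X)).comp hε0).const_mul _).pow 2).const_mul _
  -- the reaction on the bottom
  have hl3 : Tendsto (fun k => ∫ x in Ω, deriv f (u (x, 0)) *
      smoothNorm (ε k) (WithLp.toLp 2 fun i => τ i x : E n) ^ 2) atTop
      (𝓝 (∫ x in Ω, deriv f (u (x, 0)) * ∑ i, τ i x ^ 2)) := by
    have hu0 : ContinuousOn (fun x => deriv f (u (x, 0))) (closure Ω) :=
      (hf.continuous_deriv le_rfl).comp_continuousOn (S.regular.continuousOn.comp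
        (f := fun x : E n => (x, (0 : ℝ))) (by fun_prop) fun x hx => ⟨hx, self_mem_Ici⟩)
    obtain ⟨N, hN⟩ := S.exists_norm_le_of_continuousOn hu0
    have hum := (S.integrableOn_of_continuousOn hu0).aestronglyMeasurable
    have hint : Integrable (fun x => deriv f (u (x, 0)) * ∑ i, τ i x ^ 2) (volume.restrict Ω) :=
      (integrable_finsetSum _ fun i _ => (hτ i).1.integrable_sq).bdd_mul hum
        ((ae_restrict_mem S.isOpen.measurableSet).mono hN)
    have heq : ∀ x, ∑ i, τ i x ^ 2 = ‖(WithLp.toLp 2 fun i => τ i x : E n)‖ ^ 2 := fun x => by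
      rw [EuclideanSpace.norm_sq_eq]; simp
    refine tendsto_integral_of_dominated_convergence
      (fun x => ‖deriv f (u (x, 0)) * ∑ i, τ i x ^ 2‖) (fun k => ?_)
      hint.norm (fun k => Eventually.of_forall fun x => ?_) (Eventually.of_forall fun x => ?_)
    · have := (S.hasL2Trace_smoothNorm (hε k).le hτ).1.aestronglyMeasurable
      exact hum.mul (this.pow 2)
    · rw [heq, norm_mul, norm_mul, norm_pow, norm_pow,
        Real.norm_of_nonneg (smoothNorm_nonneg _ _), norm_norm]
      have := smoothNorm_le (hε k).le (WithLp.toLp 2 fun i => τ i x : E n)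
      have := smoothNorm_nonneg (ε k) (WithLp.toLp 2 fun i => τ i x : E n)
      gcongr
    · rw [heq]
      have h1 : Tendsto (fun k => smoothNorm (ε k) (WithLp.toLp 2 fun i => τ i x : E n)) atTop
          (𝓝 ‖(WithLp.toLp 2 fun i => τ i x : E n)‖) :=
        (tendsto_smoothNorm (WithLp.toLp 2 fun i => τ i x : E n)).comp hε0
      exact (h1.pow 2).const_mul (deriv f (u (x, 0)))
  exact ge_of_tendsto' ((hl1.add hl2).sub hl3) fun k => (hst k).2

theorem integrableBelow_normForm (S : Setting Ω ρ a u) (hG : HasThirdDerivatives Ω a u G) :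
    IntegrableBelow Ω (normForm a u) :=
  S.integrableBelow_inner_matB hG (M := (n : ℝ) ^ 2) (S.aestronglyMeasurable_gradNormGradx 0)
    (S.aestronglyMeasurable_gradNormGradx 0) fun X _ e h1 h2 => by
      rw [← sq]
      exact (pow_le_pow_left₀ (norm_nonneg _) (norm_gradNormGradx_le u 0 X) 2).trans
        (sum_norm_sq_le h2 ((sq_nonneg _).trans h1))

theorem integrableBelow_inner_matB_eY (S : Setting Ω ρ a u) (hG : HasThirdDerivatives Ω a u G) :
    IntegrableBelow Ω fun X => ‖gradx u X‖ ^ 2 * ⟪matB a X.2 (grad u X) (eY n), eY n⟫ := by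
  have hm : AEStronglyMeasurable (fun X => ‖gradx u X‖ ^ 2) (volume.restrict (cyl Ω)) :=
    S.aestronglyMeasurable_gradx.norm.pow 2
  have hm' : AEStronglyMeasurable (fun X => ‖gradx u X‖ ^ 2 • eY n) (volume.restrict (cyl Ω)) :=
    hm.smul_const (eY n)
  have h := S.integrableBelow_inner_matB hG (M := 1) (ξ := fun X => eY n)
    (ζ := fun X => ‖gradx u X‖ ^ 2 • eY n) aestronglyMeasurable_const hm' fun X _ e h1 h2 => by
      rw [norm_smul, norm_eY, mul_one, one_mul, one_mul, norm_pow, norm_norm]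
      exact (norm_sq_gradx_le u X).trans h1
  simpa only [real_inner_smul_right] using h

/-- The energy identity and the stability inequality, combined. -/
theorem energy_inequality (S : Setting Ω ρ a u) (hG : HasThirdDerivatives Ω a u G)
    (hg : IsInteriorReaction g) (hf : ContDiff ℝ 1 f) (hu : IsStableSolution Ω a g f u)
    (hη : IsVerticalCutoff η R M) :
    ∫ X in cyl Ω, η X.2 ^ 2 * ((hessianForm a u X - normForm a u X)
        - (fluxForm a u G X + hessianForm a u X))
      ≤ ∫ X in cyl Ω, deriv η X.2 ^ 2 *
        (‖gradx u X‖ ^ 2 * ⟪matB a X.2 (grad u X) (eY n), eY n⟫) := by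
  choose τ hτ using fun i => S.regular.trace_dx i
  have h1 := S.energy_identity hG hg hf hu hη hτ
  have h2 := S.stability_norm hG hf hu hη hτ
  have hη2 := hη.sq
  have hA := hη2.integrableOn_mul S.isOpen (S.integrableBelow_normForm hG)
  have hF := hη2.integrableOn_mul S.isOpen (S.integrableBelow_fluxForm hG)
  have hQ := hη2.integrableOn_deriv_mul S.isOpen (IntegrableBelow.sum Finset.univ fun i _ =>
    S.integrableBelow_dx_mul_inner_matB hG i)
  simp only [hη.deriv_sq_apply] at hQ
  have hD : IntegrableOn (fun X => deriv η X.2 ^ 2 *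
      (‖gradx u X‖ ^ 2 * ⟪matB a X.2 (grad u X) (eY n), eY n⟫)) (cyl Ω) :=
    (S.integrableBelow_inner_matB_eY hG).integrableOn_cyl_mul S.isOpen
      (θ := fun y => deriv η y ^ 2) (hη.continuous_deriv.pow 2) (R := R + 1)
      (by linarith [hη.pos]) (fun y hy => by rw [hη.deriv_eq_zero hy]; simp) (M := M ^ 2)
      fun y => by
        rw [abs_pow]; exact pow_le_pow_left₀ (abs_nonneg _) (hη.abs_deriv_le y) 2
  have heq : ∀ X, ⟪matB a X.2 (grad u X) (η X.2 • gradNormGradx u 0 X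
            + ‖gradx u X‖ • (deriv η X.2 • eY n)),
          η X.2 • gradNormGradx u 0 X + ‖gradx u X‖ • (deriv η X.2 • eY n)⟫
      = η X.2 ^ 2 * normForm a u X + 2 * η X.2 * deriv η X.2 *
          (∑ i, dx i u X * ⟪matB a X.2 (grad u X) (grad (dx i u) X), eY n⟫)
        + deriv η X.2 ^ 2 * (‖gradx u X‖ ^ 2 * ⟪matB a X.2 (grad u X) (eY n), eY n⟫) := by
    intro X
    -- The mixed term contains `|∇ₓu| ∇|∇ₓu| = Σ uᵢ ∇uᵢ`, which makes it equal to the mixed term of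
    -- the energy identity, so that the two cancel.
    have h3 : ‖gradx u X‖ * ⟪matB a X.2 (grad u X) (gradNormGradx u 0 X), eY n⟫
        = ∑ i, dx i u X * ⟪matB a X.2 (grad u X) (grad (dx i u) X), eY n⟫ := by
      rw [← inner_matB_sum_smul, ← norm_gradx_smul_gradNormGradx, ← matBL_apply, ← matBL_apply,
        map_smul, real_inner_smul_left]
    rw [smul_smul, inner_matB_add_self, ← h3, normForm]
    ring
  simp only [heq] at h2
  have hAQ : IntegrableOn (fun X => η X.2 ^ 2 * normForm a u X + 2 * η X.2 * deriv η X.2 *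
      (∑ i, dx i u X * ⟪matB a X.2 (grad u X) (grad (dx i u) X), eY n⟫)) (cyl Ω) := hA.add hQ
  rw [integral_add hAQ hD, integral_add hA hQ] at h2
  -- Adding and subtracting `hessianForm` splits the integrand into the Cauchy–Schwarz defect and
  -- the divergence term, each with a known sign.
  have h4 : ∫ X in cyl Ω, η X.2 ^ 2 * ((hessianForm a u X - normForm a u X)
        - (fluxForm a u G X + hessianForm a u X))
      = -((∫ X in cyl Ω, η X.2 ^ 2 * normForm a u X) + ∫ X in cyl Ω, η X.2 ^ 2 * fluxForm a u G X) := by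
    rw [← integral_add hA hF, ← integral_neg]
    exact integral_congr_ae (Eventually.of_forall fun X => by ring)
  rw [h4]
  linarith

/-- A variance identity for the form `ℬ`: with weights `Nᵢ = uᵢ / |∇ₓu|`, `Σ Nᵢ² = 1`, and `Z = Σ Nᵢ
zᵢ`, one has `Σ |zᵢ|² - |Z|² = Σ |zᵢ - Nᵢ Z|²`. It gives the sign of the defect and, by positivity
of `ℬ`, its equality case. -/
theorem hessianForm_sub_normForm (a : ℝ → ℝ → ℝ) {X : E n × ℝ} (h : ‖gradx u X‖ ≠ 0) :
    hessianForm a u X - normForm a u X = ∑ i, ⟪matB a X.2 (grad u X)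
      (grad (dx i u) X - (dx i u X / ‖gradx u X‖) • gradNormGradx u 0 X),
      grad (dx i u) X - (dx i u X / ‖gradx u X‖) • gradNormGradx u 0 X⟫ := by
  have h0 : √(‖gradx u X‖ ^ 2 + 0 ^ 2) = ‖gradx u X‖ := by simp [Real.sqrt_sq]
  have hN : ∑ i, (dx i u X / ‖gradx u X‖) ^ 2 = 1 := by
    simp only [div_pow, ← Finset.sum_div, ← norm_sq_gradx]
    field_simp
  have hZ : gradNormGradx u 0 X = ∑ i, (dx i u X / ‖gradx u X‖) • grad (dx i u) X := by
    simp only [gradNormGradx, h0]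
  have hc : ∑ i, (dx i u X / ‖gradx u X‖) *
      ⟪matB a X.2 (grad u X) (grad (dx i u) X), gradNormGradx u 0 X⟫ = normForm a u X := by
    rw [← inner_matB_sum_smul, ← hZ]; rfl
  have hexp : ∀ i, ⟪matB a X.2 (grad u X)
      (grad (dx i u) X - (dx i u X / ‖gradx u X‖) • gradNormGradx u 0 X),
      grad (dx i u) X - (dx i u X / ‖gradx u X‖) • gradNormGradx u 0 X⟫
      = ⟪matB a X.2 (grad u X) (grad (dx i u) X), grad (dx i u) X⟫
        - 2 * ((dx i u X / ‖gradx u X‖) *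
          ⟪matB a X.2 (grad u X) (grad (dx i u) X), gradNormGradx u 0 X⟫)
        + (dx i u X / ‖gradx u X‖) ^ 2 * normForm a u X := by
    intro i
    have := inner_matB_add_self a X.2 (grad u X) (grad (dx i u) X) (gradNormGradx u 0 X) 1
      (-(dx i u X / ‖gradx u X‖))
    rw [one_smul, neg_smul, ← sub_eq_add_neg] at this
    rw [this, normForm]
    ring
  simp only [hexp, Finset.sum_add_distrib, Finset.sum_sub_distrib, ← Finset.mul_sum,
    ← Finset.sum_mul, hN, hc, hessianForm]
  ring

theorem normForm_of_norm_gradx_eq_zero {X : E n × ℝ} (h : ‖gradx u X‖ = 0) :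
    normForm a u X = 0 := by
  have : gradNormGradx u 0 X = 0 := by
    refine Finset.sum_eq_zero fun i _ => ?_
    have := abs_dx_le u i X
    rw [h] at this
    simp [abs_nonpos_iff.1 this]
  rw [normForm, this, inner_zero_right]

theorem hessianForm_sub_normForm_nonneg (S : Setting Ω ρ a u) {X : E n × ℝ} (hX : X ∈ cyl Ω) :
    0 ≤ hessianForm a u X - normForm a u X := by
  rcases eq_or_ne ‖gradx u X‖ 0 with h | h
  · rw [normForm_of_norm_gradx_eq_zero h, sub_zero]
    exact Finset.sum_nonneg fun i _ => inner_matB_self_nonneg S.coeff hX.2 _ _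
  · rw [hessianForm_sub_normForm a h]
    exact Finset.sum_nonneg fun i _ => inner_matB_self_nonneg S.coeff hX.2 _ _

/-- Where the defect vanishes, all `∇uᵢ` are parallel. -/
theorem smul_grad_dx_eq_of_defect_eq_zero (S : Setting Ω ρ a u) {X : E n × ℝ} (hX : X ∈ cyl Ω)
    (h0 : hessianForm a u X - normForm a u X = 0) (i : Fin n) :
    ‖gradx u X‖ ^ 2 • grad (dx i u) X = dx i u X • ∑ j, dx j u X • grad (dx j u) X := by
  rcases eq_or_ne ‖gradx u X‖ 0 with h | h
  · have := abs_dx_le u i X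
    rw [h] at this
    simp [h, abs_nonpos_iff.1 this]
  · rw [hessianForm_sub_normForm a h, Finset.sum_eq_zero_iff_of_nonneg fun i _ =>
      inner_matB_self_nonneg S.coeff hX.2 _ _] at h0
    have h1 : grad (dx i u) X - (dx i u X / ‖gradx u X‖) • gradNormGradx u 0 X = 0 := by
      by_contra hne
      exact (inner_matB_self_pos S.coeff hX.2 (grad u X) hne).ne' (h0 i (Finset.mem_univ i))
    rw [sub_eq_zero.1 h1, ← norm_gradx_smul_gradNormGradx, smul_smul, smul_smul]
    congr 1
    field_simp

end Setting

end EnergyInequality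

/-! ### Logarithmic cutoffs under quadratic growth. -/

section LogCutoff

/-- The logarithmic cutoff: `1` for `1 + y² ≤ exp (2 L)`, and `0` for `1 + y² ≥ exp (4 L)`. -/
def logCutoff (L y : ℝ) : ℝ := 1 - cutoff (Real.log (1 + y ^ 2) / (2 * L))

theorem contDiff_logCutoff (L : ℝ) : ContDiff ℝ ∞ (logCutoff L) := by
  refine contDiff_const.sub ((contDiff_cutoff (m := ⊤)).comp (ContDiff.div_const ?_ _))
  exact (contDiff_const.add (contDiff_id.pow 2)).log fun y => by positivity

theorem deriv_logCutoff {L : ℝ} (hL : 0 < L) (y : ℝ) : deriv (logCutoff L) y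
    = -(deriv cutoff (Real.log (1 + y ^ 2) / (2 * L)) * (y / (1 + y ^ 2) / L)) := by
  have h1 : HasDerivAt (fun y : ℝ => 1 + y ^ 2) (2 * y) y := by
    simpa using ((hasDerivAt_id y).fun_pow 2).const_add 1
  have h2 := (h1.log (by positivity)).div_const (2 * L)
  have h3 : HasDerivAt cutoff (deriv cutoff (Real.log (1 + y ^ 2) / (2 * L)))
      (Real.log (1 + y ^ 2) / (2 * L)) :=
    ((contDiff_cutoff (m := 1)).differentiable one_ne_zero _).hasDerivAt
  have h4 : HasDerivAt (logCutoff L) (-(deriv cutoff (Real.log (1 + y ^ 2) / (2 * L)) *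
      (2 * y / (1 + y ^ 2) / (2 * L)))) y := by
    have h5 := HasDerivAt.comp y (h₂ := cutoff) (h := fun y => Real.log (1 + y ^ 2) / (2 * L)) h3 h2
    exact h5.const_sub 1
  rw [h4.deriv]
  have : 1 + y ^ 2 ≠ 0 := by positivity
  field_simp

theorem exists_deriv_cutoff_le : ∃ K > 0, ∀ t, deriv cutoff t ≤ K := by
  obtain ⟨K, hK⟩ := isCompact_Icc.exists_bound_of_continuousOn
    (continuous_deriv_cutoff.continuousOn (s := Icc 1 2))
  refine ⟨max K 1, by positivity, fun t => ?_⟩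
  by_cases h : t ∈ Icc (1 : ℝ) 2
  · exact (le_abs_self _).trans ((hK t h).trans (le_max_left _ _))
  · have h0 : deriv cutoff t = 0 := by
      by_contra h0
      refine h ⟨?_, ?_⟩
      · by_contra! h1; exact h0 (deriv_cutoff_of_lt h1)
      · by_contra! h1; exact h0 (deriv_cutoff_of_gt h1)
    rw [h0]; positivity

theorem logCutoff_eq_one {L y : ℝ} (hL : 0 < L) (hy : 1 + y ^ 2 ≤ Real.exp (2 * L)) :
    logCutoff L y = 1 := by
  rw [logCutoff, cutoff_of_le, sub_zero]
  rw [div_le_one (by positivity)]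
  exact (Real.log_le_iff_le_exp (by positivity)).2 hy

theorem isVerticalCutoff_logCutoff {L K : ℝ} (hL : 1 ≤ L) (hK : ∀ t, deriv cutoff t ≤ K) :
    IsVerticalCutoff (logCutoff L) (Real.exp (2 * L)) K where
  contDiff := contDiff_logCutoff L
  pos := Real.exp_pos _
  eq_one y h0 hy := logCutoff_eq_one (by linarith) <| by
    have := Real.add_one_le_exp (2 * L)
    nlinarith
  eq_zero y hy := by
    rw [logCutoff, cutoff_of_ge, sub_self]
    rw [le_div_iff₀ (by positivity), Real.le_log_iff_exp_le (by positivity)]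
    calc Real.exp (2 * (2 * L)) = Real.exp (2 * L) ^ 2 := by rw [← Real.exp_nat_mul]; norm_num
      _ ≤ y ^ 2 := pow_le_pow_left₀ (Real.exp_pos _).le hy 2
      _ ≤ 1 + y ^ 2 := by linarith
  abs_le y := by
    rw [logCutoff, abs_le]
    constructor <;> linarith [cutoff_nonneg (Real.log (1 + y ^ 2) / (2 * L)),
      cutoff_le_one (Real.log (1 + y ^ 2) / (2 * L))]
  abs_deriv_le y := by
    rw [deriv_logCutoff (by linarith), abs_neg, abs_mul, abs_of_nonneg (deriv_cutoff_nonneg _)]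
    refine (mul_le_of_le_one_right (deriv_cutoff_nonneg _) ?_).trans (hK _)
    rw [div_div, abs_div, abs_of_pos (by positivity : (0 : ℝ) < (1 + y ^ 2) * L),
      div_le_one (by positivity)]
    nlinarith [sq_nonneg (|y| - 1), sq_abs y, sq_nonneg y]

/-- The squared derivative of the cutoff is controlled dyadically. -/
theorem deriv_logCutoff_sq_le {N : ℕ} (hN : 1 ≤ N) {K : ℝ} (hK : ∀ t, deriv cutoff t ≤ K) {y : ℝ}
    (hy : 0 < y) : deriv (logCutoff N) y ^ 2 ≤ ∑ m ∈ Finset.range (2 * N + 1) with N ≤ m,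
      (Ioo (0 : ℝ) (Real.exp (m + 1))).indicator
        (fun _ => K ^ 2 / (N : ℝ) ^ 2 * Real.exp (-(2 * m))) y := by
  have hN0 : (0 : ℝ) < N := by exact_mod_cast hN
  have hnn : ∀ m : ℕ, 0 ≤ (Ioo (0 : ℝ) (Real.exp (m + 1))).indicator
        (fun _ => K ^ 2 / (N : ℝ) ^ 2 * Real.exp (-(2 * m))) y := fun m =>
    indicator_nonneg (fun _ _ => by positivity) y
  have hd := deriv_logCutoff hN0 y
  set s := Real.log (1 + y ^ 2) with hs
  by_cases h : deriv (logCutoff N) y = 0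
  · rw [h]
    simpa using Finset.sum_nonneg fun m _ => hnn m
  have h0 : deriv cutoff (s / (2 * N)) ≠ 0 := fun h0 => h (by rw [hd, h0]; simp)
  have h1 : 1 ≤ s / (2 * N) := by
    by_contra! h1; exact h0 (deriv_cutoff_of_lt h1)
  have h2 : s / (2 * N) ≤ 2 := by
    by_contra! h1; exact h0 (deriv_cutoff_of_gt h1)
  rw [le_div_iff₀ (by positivity)] at h1
  rw [div_le_iff₀ (by positivity)] at h2
  have hexp : Real.exp s = 1 + y ^ 2 := Real.exp_log (by positivity)
  -- With `e^s = 1 + y²` this is the exponential shell `e^{2m} ≤ 1 + y² < e^{2(m+1)}` containing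
  -- `y`. The derivative of the cutoff lives where `2N ≤ s ≤ 4N`, so only the shells `N ≤ m ≤ 2N`
  -- occur.
  set m := ⌊s / 2⌋₊
  have hm1 : (m : ℝ) ≤ s / 2 := Nat.floor_le (by linarith)
  have hm2 : s / 2 < m + 1 := Nat.lt_floor_add_one _
  have hmem : m ∈ (Finset.range (2 * N + 1)).filter (N ≤ ·) := by
    rw [Finset.mem_filter, Finset.mem_range]
    refine ⟨?_, Nat.le_floor (by linarith)⟩
    have : (m : ℝ) < 2 * N + 1 := by linarith
    exact_mod_cast this
  refine le_trans ?_ (Finset.single_le_sum (fun m _ => hnn m) hmem)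
  rw [indicator_of_mem]
  · have h3 : deriv (logCutoff N) y ^ 2
        = deriv cutoff (s / (2 * N)) ^ 2 / (N : ℝ) ^ 2 * (y ^ 2 / (1 + y ^ 2) * (1 + y ^ 2)⁻¹) := by
      rw [hd]; field_simp
    have h4 : (1 + y ^ 2)⁻¹ ≤ Real.exp (-(2 * m)) := by
      rw [← hexp, ← Real.exp_neg]
      exact Real.exp_le_exp.2 (by linarith)
    have h5 : y ^ 2 / (1 + y ^ 2) ≤ 1 := by
      rw [div_le_one (by positivity)]; linarith
    have h6 := pow_le_pow_left₀ (deriv_cutoff_nonneg (s / (2 * N))) (hK (s / (2 * N))) 2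
    rw [h3]
    have h7 : y ^ 2 / (1 + y ^ 2) * (1 + y ^ 2)⁻¹ ≤ Real.exp (-(2 * m)) :=
      (mul_le_of_le_one_left (by positivity) h5).trans h4
    exact mul_le_mul (by gcongr) h7 (by positivity) (by positivity)
  · refine ⟨hy, ?_⟩
    have h3 : y ^ 2 < Real.exp (m + 1) ^ 2 := by
      rw [← Real.exp_nat_mul]
      calc y ^ 2 < Real.exp s := by rw [hexp]; linarith
        _ < _ := Real.exp_lt_exp.2 (by push_cast; linarith)
    exact lt_of_pow_lt_pow_left₀ 2 (Real.exp_pos _).le h3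

variable {n : ℕ} {Ω : Set (E n)}

/-- On the shell `m` the squared derivative is at most `K² N⁻² e^{-2m}`, while the integral of `F`
below height `e^{m+1}` is at most `C e^{2(m+1)}`. Every shell thus contributes at most `K² C e² /
N²`, and there are at most `2N + 1` of them, so the total is of order `1 / N`. -/
theorem integral_deriv_logCutoff_sq_mul_le (hΩ : IsOpen Ω) {F : E n × ℝ → ℝ}
    (hF : IntegrableBelow Ω F) (h0 : ∀ X ∈ cyl Ω, 0 ≤ F X) {C : ℝ}
    (hC : ∀ R ≥ 1, ∫ X in Ω ×ˢ Ioo 0 R, F X ≤ C * R ^ 2) {K : ℝ} (hK : ∀ t, deriv cutoff t ≤ K)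
    {N : ℕ} (hN : 1 ≤ N) :
    ∫ X in cyl Ω, deriv (logCutoff N) X.2 ^ 2 * F X
      ≤ K ^ 2 * C * Real.exp 2 * ((2 * N + 1) / (N : ℝ) ^ 2) := by
  have hN0 : (0 : ℝ) < N := by exact_mod_cast hN
  have hη := isVerticalCutoff_logCutoff (L := N) (by exact_mod_cast hN) hK
  have hC0 : 0 ≤ C := by
    have h1 : 0 ≤ ∫ X in Ω ×ˢ Ioo 0 (1 : ℝ), F X :=
      setIntegral_nonneg (hΩ.prod isOpen_Ioo).measurableSet fun X hX =>
        h0 X (IntegrableBelow.prod_Ioo_subset_cyl 1 hX)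
    have := hC 1 le_rfl
    linarith
  have hmeas : ∀ m : ℕ, MeasurableSet (Ω ×ˢ Ioo (0 : ℝ) (Real.exp (m + 1))) := fun m =>
    (hΩ.prod isOpen_Ioo).measurableSet
  have hres : ∀ m : ℕ, (volume.restrict (cyl Ω)).restrict (Ω ×ˢ Ioo (0 : ℝ) (Real.exp (m + 1)))
      = volume.restrict (Ω ×ˢ Ioo (0 : ℝ) (Real.exp (m + 1))) := fun m => by
    rw [Measure.restrict_restrict (hmeas m),
      inter_eq_left.2 (IntegrableBelow.prod_Ioo_subset_cyl _)]
  have hint : ∀ m : ℕ, IntegrableOn ((Ω ×ˢ Ioo (0 : ℝ) (Real.exp (m + 1))).indicator F) (cyl Ω) :=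
    fun m => by
      rw [IntegrableOn, integrable_indicator_iff (hmeas m), IntegrableOn, hres]
      exact hF _ (Real.exp_pos _)
  have hle : ∀ m : ℕ, Real.exp (-(2 * m)) * ∫ X in Ω ×ˢ Ioo (0 : ℝ) (Real.exp (m + 1)), F X
      ≤ C * Real.exp 2 := fun m => by
    have h1 := hC (Real.exp (m + 1)) (Real.one_le_exp (by positivity))
    calc _ ≤ Real.exp (-(2 * m)) * (C * Real.exp (m + 1) ^ 2) :=
          mul_le_mul_of_nonneg_left h1 (Real.exp_pos _).le
      _ = C * Real.exp (-(2 * m) + 2 * (m + 1)) := by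
          rw [← Real.exp_nat_mul, Real.exp_add]; push_cast; ring
      _ = _ := by ring_nf
  calc ∫ X in cyl Ω, deriv (logCutoff N) X.2 ^ 2 * F X
      ≤ ∫ X in cyl Ω, ∑ m ∈ Finset.range (2 * N + 1) with N ≤ m,
          (K ^ 2 / (N : ℝ) ^ 2 * Real.exp (-(2 * m))) *
            (Ω ×ˢ Ioo (0 : ℝ) (Real.exp (m + 1))).indicator F X := by
        refine setIntegral_mono_on ?_ (integrable_finsetSum _ fun m _ => (hint m).const_mul _)
          (hΩ.prod isOpen_Ioi).measurableSet fun X hX => ?_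
        · exact hF.integrableOn_cyl_mul hΩ (θ := fun y => deriv (logCutoff N) y ^ 2)
            (hη.continuous_deriv.pow 2) (R := Real.exp (2 * N) + 1) (by positivity)
            (fun y hy => by rw [hη.deriv_eq_zero hy]; simp) (M := K ^ 2) fun y => by
              rw [abs_pow]; exact pow_le_pow_left₀ (abs_nonneg _) (hη.abs_deriv_le y) 2
        · refine (mul_le_mul_of_nonneg_right (deriv_logCutoff_sq_le hN hK hX.2) (h0 X hX)).trans
            (le_of_eq ?_)
          rw [Finset.sum_mul]
          refine Finset.sum_congr rfl fun m _ => ?_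
          by_cases hm : X.2 ∈ Ioo (0 : ℝ) (Real.exp (m + 1))
          · rw [indicator_of_mem hm, indicator_of_mem (show X ∈ Ω ×ˢ _ from ⟨hX.1, hm⟩)]
          · rw [indicator_of_notMem hm, indicator_of_notMem (fun h : X ∈ Ω ×ˢ _ => hm h.2)]
            simp
    _ = ∑ m ∈ Finset.range (2 * N + 1) with N ≤ m, (K ^ 2 / (N : ℝ) ^ 2) *
          (Real.exp (-(2 * m)) * ∫ X in Ω ×ˢ Ioo (0 : ℝ) (Real.exp (m + 1)), F X) := by
        rw [integral_finsetSum _ fun m _ => (hint m).const_mul _]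
        refine Finset.sum_congr rfl fun m _ => ?_
        rw [integral_const_mul, integral_indicator (hmeas m), hres, mul_assoc]
    _ ≤ ∑ m ∈ Finset.range (2 * N + 1) with N ≤ m, K ^ 2 / (N : ℝ) ^ 2 * (C * Real.exp 2) :=
        Finset.sum_le_sum fun m _ => mul_le_mul_of_nonneg_left (hle m) (by positivity)
    _ ≤ ∑ m ∈ Finset.range (2 * N + 1), K ^ 2 / (N : ℝ) ^ 2 * (C * Real.exp 2) :=
        Finset.sum_le_sum_of_subset_of_nonneg (Finset.filter_subset _ _) fun _ _ _ => by positivity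
    _ = _ := by
        rw [Finset.sum_const, Finset.card_range, nsmul_eq_mul]
        push_cast
        ring

/-- Under quadratic growth of the integral of `F`, the strips are exhausted by cutoffs whose
gradients have arbitrarily small energy with respect to `F`. -/
theorem exists_isVerticalCutoff (hΩ : IsOpen Ω) {F : E n × ℝ → ℝ}
    (hF : IntegrableBelow Ω F) (h0 : ∀ X ∈ cyl Ω, 0 ≤ F X) {C : ℝ}
    (hC : ∀ R ≥ 1, ∫ X in Ω ×ˢ Ioo 0 R, F X ≤ C * R ^ 2) (R₀ : ℝ) {δ : ℝ} (hδ : 0 < δ) :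
    ∃ η R M, IsVerticalCutoff η R M ∧ (∀ y ∈ Ioo 0 R₀, η y = 1) ∧
      ∫ X in cyl Ω, deriv η X.2 ^ 2 * F X ≤ δ := by
  obtain ⟨K, -, hK⟩ := exists_deriv_cutoff_le
  have hlim : Tendsto (fun N : ℕ => K ^ 2 * C * Real.exp 2 * ((2 * N + 1) / (N : ℝ) ^ 2)) atTop
      (𝓝 0) := by
    have h1 : Tendsto (fun N : ℕ => 2 * (1 / (N : ℝ)) + (1 / (N : ℝ)) ^ 2) atTop (𝓝 0) := by
      simpa using (tendsto_one_div_atTop_nhds_zero_nat (𝕜 := ℝ)).const_mul 2 |>.add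
        ((tendsto_one_div_atTop_nhds_zero_nat (𝕜 := ℝ)).pow 2)
    have h2 := h1.const_mul (K ^ 2 * C * Real.exp 2)
    rw [mul_zero] at h2
    refine h2.congr' ?_
    filter_upwards [eventually_ge_atTop 1] with N hN
    have : (N : ℝ) ≠ 0 := by positivity
    field_simp
  -- `N ≥ R₀²` ensures `1 + y² ≤ 1 + N ≤ e^{2N}` for `0 < y < R₀`, so that the cutoff is `1` there.
  obtain ⟨N, hN1, hN2, hN3⟩ := ((hlim.eventually_lt_const hδ).and
    ((eventually_ge_atTop 1).and (eventually_ge_atTop ⌈R₀ ^ 2⌉₊))).exists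
  refine ⟨logCutoff N, _, K, isVerticalCutoff_logCutoff (by exact_mod_cast hN2) hK, fun y hy => ?_,
    (integral_deriv_logCutoff_sq_mul_le hΩ hF h0 hC hK hN2).trans hN1.le⟩
  have hN0 : (1 : ℝ) ≤ N := by exact_mod_cast hN2
  have h1 : R₀ ^ 2 ≤ N := Nat.ceil_le.1 hN3
  have h2 := pow_le_pow_left₀ hy.1.le hy.2.le 2
  refine logCutoff_eq_one (by linarith) ?_
  have := Real.add_one_le_exp (2 * (N : ℝ))
  linarith

end LogCutoff

/-! ### Vanishing of the defect and of the boundary flux. -/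

section Vanishing

variable {n : ℕ} {Ω : Set (E n)} {ρ : E n → ℝ} {a : ℝ → ℝ → ℝ} {u : E n × ℝ → ℝ}
  {G : Fin n → Fin n → E n × ℝ → V n} {g : ℝ → ℝ → ℝ} {f : ℝ → ℝ}

namespace Setting

/-- The right-hand side of the energy inequality can be made arbitrarily small. -/
theorem exists_cutoff_integral_le (S : Setting Ω ρ a u) (hG : HasThirdDerivatives Ω a u G)
    (hg : IsInteriorReaction g) (hf : ContDiff ℝ 1 f) (hu : IsStableSolution Ω a g f u)
    (h_energy : ∃ C > 0, ∀ R ≥ 1,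
      ∫ X in Ω ×ˢ Ioo (0 : ℝ) R, a X.2 ‖grad u X‖ * ‖gradx u X‖ ^ 2 ≤ C * R ^ 2)
    (R₀ : ℝ) {δ : ℝ} (hδ : 0 < δ) :
    ∃ η R M, IsVerticalCutoff η R M ∧ (∀ y ∈ Ioo 0 R₀, η y = 1) ∧
      ∫ X in cyl Ω, η X.2 ^ 2 * ((hessianForm a u X - normForm a u X)
        - (fluxForm a u G X + hessianForm a u X)) ≤ δ := by
  obtain ⟨B, hB, hCb⟩ := S.coeff.bound
  obtain ⟨C, hC, hCe⟩ := h_energy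
  have hle : ∀ X ∈ cyl Ω, ‖gradx u X‖ ^ 2 * ⟪matB a X.2 (grad u X) (eY n), eY n⟫
      ≤ (1 + B) * (a X.2 ‖grad u X‖ * ‖gradx u X‖ ^ 2) := fun X hX => by
    have h1 : ⟪matB a X.2 (grad u X) (eY n), eY n⟫ ≤ (1 + B) * a X.2 ‖grad u X‖ := by
      refine (real_inner_le_norm _ _).trans ?_
      have := norm_matB_le S.coeff hCb hX.2 (grad u X) (eY n)
      rwa [norm_eY, mul_one] at *
    calc _ ≤ ‖gradx u X‖ ^ 2 * ((1 + B) * a X.2 ‖grad u X‖) :=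
          mul_le_mul_of_nonneg_left h1 (sq_nonneg _)
      _ = _ := by ring
  have hF := S.integrableBelow_inner_matB_eY hG
  obtain ⟨η, R, M, hη, h1, h2⟩ := exists_isVerticalCutoff S.isOpen hF
    (fun X hX => mul_nonneg (sq_nonneg _) (inner_matB_self_nonneg S.coeff hX.2 _ _))
    (C := (1 + B) * C) (fun R hR => by
      have hR0 : 0 < R := by linarith
      calc _ ≤ ∫ X in Ω ×ˢ Ioo (0 : ℝ) R, (1 + B) * (a X.2 ‖grad u X‖ * ‖gradx u X‖ ^ 2) :=
            setIntegral_mono_on (hF R hR0)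
              ((S.integrableBelow_coeff_mul_gradx_sq hG R hR0).const_mul _)
              (S.isOpen.prod isOpen_Ioo).measurableSet
              fun X hX => hle X (IntegrableBelow.prod_Ioo_subset_cyl R hX)
        _ = (1 + B) * ∫ X in Ω ×ˢ Ioo (0 : ℝ) R, a X.2 ‖grad u X‖ * ‖gradx u X‖ ^ 2 :=
            integral_const_mul _ _
        _ ≤ (1 + B) * (C * R ^ 2) := mul_le_mul_of_nonneg_left (hCe R hR) (by positivity)
        _ = _ := by ring) R₀ hδ
  exact ⟨η, R, M, hη, h1, (S.energy_inequality hG hg hf hu hη).trans h2⟩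

/-- Stability and quadratic energy growth force `hessianForm - normForm` to vanish almost everywhere,
and `∇ₓu` to vanish on the boundary of almost every slice. -/
theorem integral_slices_eq_zero (S : Setting Ω ρ a u) (hG : HasThirdDerivatives Ω a u G)
    (hg : IsInteriorReaction g) (hf : ContDiff ℝ 1 f) (hu : IsStableSolution Ω a g f u)
    (hcurv : ∀ p ∈ frontier Ω, ∀ κ : ℝ, IsPrincipalCurvature Ω p κ → 0 < κ)
    (h_energy : ∃ C > 0, ∀ R ≥ 1,
      ∫ X in Ω ×ˢ Ioo (0 : ℝ) R, a X.2 ‖grad u X‖ * ‖gradx u X‖ ^ 2 ≤ C * R ^ 2)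
    {R₀ : ℝ} (hR₀ : 0 < R₀) :
    (∀ᵐ X ∂(volume : Measure (E n × ℝ)).restrict (Ω ×ˢ Ioo 0 R₀),
        hessianForm a u X - normForm a u X = 0) ∧
      ∀ᵐ y ∂(volume : Measure ℝ).restrict (Ioo 0 R₀),
        ∀ p ∈ frontier Ω, extDeriv Ω u (p, y) ∘L ContinuousLinearMap.inl ℝ (E n) ℝ = 0 := by
  have hD := (S.integrableBelow_hessianForm hG).sub (S.integrableBelow_normForm hG)
  have hJ := (S.integrableBelow_fluxForm hG).add (S.integrableBelow_hessianForm hG)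
  have hDJ := hD.sub hJ
  set D : ℝ → ℝ := fun y => ∫ x in Ω, (hessianForm a u (x, y) - normForm a u (x, y)) with hDdef
  set J : ℝ → ℝ := fun y => ∫ x in Ω, (fluxForm a u G (x, y) + hessianForm a u (x, y)) with hJdef
  have hDi : IntegrableOn D (Ioo 0 R₀) := hD.integrableOn_integral_slice hR₀
  have hJi : IntegrableOn J (Ioo 0 R₀) := hJ.integrableOn_integral_slice hR₀
  have hD0 : ∀ y > 0, 0 ≤ D y := fun y hy =>
    setIntegral_nonneg S.isOpen.measurableSet fun x hx =>
      S.hessianForm_sub_normForm_nonneg (show (x, y) ∈ cyl Ω from ⟨hx, hy⟩)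
  have hae := S.ae_integral_fluxForm_add_hessianForm_nonpos hG hcurv
  have hDJ0 : ∀ᵐ y ∂(volume : Measure ℝ).restrict (Ioi 0), 0 ≤ D y - J y := by
    filter_upwards [hae, ae_restrict_mem measurableSet_Ioi] with y hy h0
    linarith [hy.1, hD0 y h0]
  have hslice : ∀ᵐ y ∂(volume : Measure ℝ).restrict (Ioi 0),
      ∫ x in Ω, ((hessianForm a u (x, y) - normForm a u (x, y))
        - (fluxForm a u G (x, y) + hessianForm a u (x, y))) = D y - J y := by
    filter_upwards [hD.ae_integrableOn_slice, hJ.ae_integrableOn_slice] with y h1 h2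
    exact integral_sub h1 h2
  have hmono : (volume : Measure ℝ).restrict (Ioo 0 R₀) ≤ volume.restrict (Ioi 0) :=
    Measure.restrict_mono Ioo_subset_Ioi_self le_rfl
  -- Since `D ≥ 0 ≥ J` on almost every slice, the integrand is nonnegative. Restricting to heights
  -- where `η = 1` therefore only decreases the integral, which the cutoffs make smaller than any
  -- `δ`.
  have hle : ∫ y in Ioo 0 R₀, (D y - J y) ≤ 0 := by
    refine le_of_forall_pos_le_add fun δ hδ => ?_
    obtain ⟨η, R, M, hη, h1, h2⟩ := S.exists_cutoff_integral_le hG hg hf hu h_energy R₀ hδ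
    have hint := hη.sq.integrableOn_mul S.isOpen hDJ
    have hint' : IntegrableOn (fun y => η y ^ 2 * (D y - J y)) (Ioi 0) := by
      have h3 := hint
      rw [IntegrableOn, cyl, restrict_prod_eq] at h3
      refine h3.integral_prod_right.congr ?_
      filter_upwards [hslice] with y hy
      rw [← hy, integral_const_mul]
    have h4 : ∫ X in cyl Ω, η X.2 ^ 2 * ((hessianForm a u X - normForm a u X)
        - (fluxForm a u G X + hessianForm a u X)) = ∫ y in Ioi 0, η y ^ 2 * (D y - J y) := by
      rw [cyl, setIntegral_prod_symm hint]
      refine integral_congr_ae ?_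
      filter_upwards [hslice] with y hy
      rw [← hy, integral_const_mul]
    rw [zero_add]
    calc ∫ y in Ioo 0 R₀, (D y - J y) = ∫ y in Ioo 0 R₀, η y ^ 2 * (D y - J y) :=
          setIntegral_congr_fun measurableSet_Ioo fun y hy => by simp [h1 y hy]
      _ ≤ ∫ y in Ioi 0, η y ^ 2 * (D y - J y) :=
          setIntegral_mono_set hint' (hDJ0.mono fun y hy => mul_nonneg (sq_nonneg _) hy)
            Ioo_subset_Ioi_self.eventuallyLE
      _ ≤ δ := by rw [← h4]; exact h2
  have hge : 0 ≤ᵐ[volume.restrict (Ioo 0 R₀)] fun y => D y - J y :=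
    (ae_mono hmono) hDJ0
  -- With `D ≥ 0 ≥ J`, equality `D = J` forces both to vanish: `D = 0` gives the pointwise defect,
  -- `J = 0` the equality case of the curvature term.
  have hzero : (fun y => D y - J y) =ᵐ[volume.restrict (Ioo 0 R₀)] 0 :=
    (integral_eq_zero_iff_of_nonneg_ae hge (hDi.sub hJi)).1
      (le_antisymm hle (integral_nonneg_of_ae hge))
  constructor
  · have h1 : 0 ≤ᵐ[volume.restrict (Ω ×ˢ Ioo 0 R₀)]
        fun X => hessianForm a u X - normForm a u X := by
      filter_upwards [ae_restrict_mem (S.isOpen.prod isOpen_Ioo).measurableSet] with X hX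
      exact S.hessianForm_sub_normForm_nonneg (IntegrableBelow.prod_Ioo_subset_cyl R₀ hX)
    refine (integral_eq_zero_iff_of_nonneg_ae h1 (hD R₀ hR₀)).1 ?_
    refine le_antisymm ?_ (integral_nonneg_of_ae h1)
    rw [setIntegral_prod_symm (hD R₀ hR₀)]
    refine (integral_nonpos_of_ae ?_)
    filter_upwards [hzero, ae_mono hmono hae] with y h2 h3
    have h2 : D y - J y = 0 := h2
    change D y ≤ 0
    linarith [h3.1]
  · filter_upwards [hzero, ae_mono hmono hae, ae_restrict_mem measurableSet_Ioo] with y h2 h3 h4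
    have h2 : D y - J y = 0 := h2
    exact h3.2 (le_antisymm h3.1 (by change 0 ≤ J y; linarith [hD0 y h4.1]))

end Setting

end Vanishing

/-! ### Constancy of `∇ₓu` along orthogonal segments. -/

section Rigidity

/-- A local Gronwall bound on `‖q - q 0‖`, wherever `q = q 0`, makes `q` constant. -/
theorem eq_of_eventually_norm_deriv_le {F : Type*} [NormedAddCommGroup F] [NormedSpace ℝ F]
    {q q' : ℝ → F} {c : ℝ} (hq : ∀ t ∈ Icc 0 c, HasDerivAt q (q' t) t)
    (hK : ∀ t ∈ Ico 0 c, q t = q 0 → ∃ K : ℝ, ∀ᶠ s in 𝓝[≥] t, ‖q' s‖ ≤ K * ‖q s - q 0‖) :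
    ∀ t ∈ Icc 0 c, q t = q 0 := by
  have hcont : ContinuousOn q (Icc 0 c) := fun t ht => (hq t ht).continuousAt.continuousWithinAt
  -- Continuous induction: the set where `q = q 0` is closed by continuity, and extends to the right
  -- of each of its points by Gronwall.
  refine IsClosed.Icc_subset_of_forall_mem_nhdsWithin (s := {t | q t = q 0}) ?_ rfl ?_
  · have := hcont.preimage_isClosed_of_isClosed isClosed_Icc (isClosed_singleton (x := q 0))
    rwa [inter_comm]
  · rintro t ⟨ht, ht0, htc⟩
    obtain ⟨K, hK⟩ := hK t ⟨ht0, htc⟩ ht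
    obtain ⟨b, hb, hsub⟩ := mem_nhdsGE_iff_exists_Icc_subset.1
      (hK.and (mem_nhdsWithin_of_mem_nhds (Iic_mem_nhds htc)))
    have hbI : Icc t b ⊆ Icc 0 c := fun s hs => ⟨ht0.trans hs.1, (hsub hs).2⟩
    have hzero := eq_zero_of_abs_deriv_le_mul_abs_self_of_eq_zero_right
      (f := fun s => q s - q 0) (f' := q') (K := K) (a := t) (b := b)
      ((hcont.mono hbI).sub continuousOn_const)
      (fun s hs => ((hq s (hbI (Ico_subset_Icc_self hs))).sub_const _).hasDerivWithinAt)
      (sub_eq_zero.2 ht) fun s hs => (hsub (Ico_subset_Icc_self hs)).1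
    exact mem_of_superset (Ioo_mem_nhdsGT hb) fun s hs =>
      sub_eq_zero.1 (hzero s (Ioo_subset_Icc_self hs))

theorem exists_ne_zero_inner_eq_zero {n : ℕ} (hn : 2 ≤ n) (w : E n) : ∃ v :
    E n, v ≠ 0 ∧ ⟪v, w⟫ = 0 := by
  have h1 : LinearMap.ker (innerSL ℝ w).toLinearMap ≠ ⊥ :=
    LinearMap.ker_ne_bot_of_finrank_lt (by simp; omega)
  obtain ⟨v, hv, hv0⟩ := (Submodule.ne_bot_iff _).1 h1
  exact ⟨v, hv0, by rw [real_inner_comm]; simpa using hv⟩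

/-- A ray from a point of a bounded convex open set leaves it through the boundary. -/
theorem exists_exit_time {F : Type*} [NormedAddCommGroup F] [NormedSpace ℝ F] {Ω : Set F}
    (hΩ : IsOpen Ω) (hbdd : Bornology.IsBounded Ω) (hconv : Convex ℝ Ω) {x v : F} (hx : x ∈ Ω)
    (hv : v ≠ 0) : ∃ b : ℝ, 0 < b ∧ x + b • v ∈ frontier Ω ∧ ∀ t ∈ Ico 0 b, x + t • v ∈ Ω := by
  have hcont : Continuous fun t : ℝ => x + t • v := by fun_prop
  obtain ⟨r, hr⟩ := hbdd.closure.subset_closedBall x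
  have hbound : ∀ t : ℝ, 0 ≤ t → x + t • v ∈ closure Ω → t ≤ r / ‖v‖ := fun t ht h => by
    have := hr h
    rw [mem_closedBall_iff_norm, add_sub_cancel_left, norm_smul, Real.norm_of_nonneg ht] at this
    rwa [le_div_iff₀ (norm_pos_iff.2 hv)]
  have hcomp : IsCompact (Icc 0 (r / ‖v‖) ∩ (fun t : ℝ => x + t • v) ⁻¹' closure Ω) :=
    isCompact_Icc.inter_right (isClosed_closure.preimage hcont)
  have h0 : x + (0 : ℝ) • v ∈ closure Ω := by simpa using subset_closure hx
  -- The exit time is the last moment at which the ray is in the closure; were it still in the open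
  -- set `Ω`, it could be continued.
  obtain ⟨b, ⟨hb1, hb2⟩, hmax⟩ := hcomp.exists_isGreatest
    ⟨0, ⟨le_rfl, hbound 0 le_rfl h0⟩, h0⟩
  have hbΩ : x + b • v ∉ Ω := fun h => by
    obtain ⟨ε, hε, hsub⟩ := Metric.isOpen_iff.1 (hΩ.preimage hcont) b h
    have h1 : x + (b + ε / 2) • v ∈ closure Ω := subset_closure <| by
      refine hsub (?_ : b + ε / 2 ∈ Metric.ball b ε)
      rw [mem_ball_iff_norm, add_sub_cancel_left, Real.norm_of_nonneg (by positivity)]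
      linarith
    have h2 := hmax ⟨⟨by linarith [hb1.1], hbound _ (by linarith [hb1.1]) h1⟩, h1⟩
    linarith
  have hb0 : 0 < b := by
    refine lt_of_le_of_ne hb1.1 fun h => hbΩ ?_
    rw [← h]; simpa using hx
  refine ⟨b, hb0, ⟨hb2, by rwa [hΩ.interior_eq]⟩, fun t ht => ?_⟩
  -- Before the exit the point is a convex combination of the interior point `x` and a point of the
  -- closure, with positive weight on `x`.
  have h1 := hconv.combo_interior_closure_mem_interior (a := 1 - t / b) (b := t / b)
    (by rwa [hΩ.interior_eq]) hb2 (by rw [sub_pos, div_lt_one hb0]; exact ht.2)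
    (div_nonneg ht.1 hb0.le) (by ring)
  rw [hΩ.interior_eq] at h1
  convert h1 using 1
  rw [smul_add, ← add_assoc, ← add_smul, sub_add_cancel, one_smul, smul_smul,
    div_mul_cancel₀ _ hb0.ne']

variable {n : ℕ} {Ω : Set (E n)} {ρ : E n → ℝ} {a : ℝ → ℝ → ℝ} {u : E n × ℝ → ℝ}
  {G : Fin n → Fin n → E n × ℝ → V n} {g : ℝ → ℝ → ℝ} {f : ℝ → ℝ}

namespace Setting

theorem hasDerivAt_gradx_line (S : Setting Ω ρ a u) {x v : E n} {t y : ℝ} (hx : x + t • v ∈ Ω)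
    (hy : 0 < y) : HasDerivAt (fun t : ℝ => gradx u (x + t • v, y))
      (∑ j, v j • gradx (dx j u) (x + t • v, y)) t := by
  have hX : (x + t • v, y) ∈ cyl Ω := ⟨hx, hy⟩
  have hl : HasDerivAt (fun t : ℝ => (x + t • v, y)) (v, (0 : ℝ)) t := by
    have h1 : HasDerivAt (fun t : ℝ => x + t • v) v t := by
      simpa using ((hasDerivAt_id t).smul_const v).const_add x
    exact h1.prodMk (hasDerivAt_const t y)
  have h1 : HasDerivAt (fun t : ℝ => fun i => dx i u (x + t • v, y))
      (fun i => ∑ j, v j * dx i (dx j u) (x + t • v, y)) t := by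
    refine hasDerivAt_pi.2 fun i => ?_
    have h2 : HasFDerivAt (dx i u) (fderiv ℝ (dx i u) (x + t • v, y)) (x + t • v, y) :=
      (((S.contDiffOn_dx i).contDiffAt (S.isOpen_cyl.mem_nhds hX)).differentiableAt
        one_ne_zero).hasFDerivAt
    have h3 := HasFDerivAt.comp_hasDerivAt (f := fun t : ℝ => (x + t • v, y)) t h2 hl
    refine h3.congr_deriv ?_
    rw [← sum_eX, map_sum]
    refine Finset.sum_congr rfl fun j _ => ?_
    rw [map_smul, S.fderiv_dx i hX, S.extDeriv₂_comm hX, ← S.dx_dx i j hX, smul_eq_mul]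
  have h2 := (EuclideanSpace.equiv (Fin n) ℝ).symm.hasFDerivAt.comp_hasDerivAt t h1
  refine h2.congr_deriv ?_
  ext i
  simp [gradx]

/-- If all the `∇uᵢ` are parallel, then `∇ₓu` is constant along segments orthogonal to it. -/
theorem gradx_eq_of_orthogonal (S : Setting Ω ρ a u)
    (hrel : ∀ X ∈ cyl Ω, ∀ i, ‖gradx u X‖ ^ 2 • grad (dx i u) X
      = dx i u X • ∑ j, dx j u X • grad (dx j u) X)
    {x v : E n} {y b : ℝ} (hy : 0 < y) (hb : ∀ t ∈ Ico 0 b, x + t • v ∈ Ω)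
    (hv : ⟪v, gradx u (x, y)⟫ = 0) (h0 : gradx u (x, y) ≠ 0) :
    ∀ t ∈ Ico 0 b, gradx u (x + t • v, y) = gradx u (x, y) := by
  intro c hc
  set q : ℝ → E n := fun t => gradx u (x + t • v, y) with hq
  have hq0 : q 0 = gradx u (x, y) := by simp [hq]
  set W : ℝ → E n := fun t => ∑ j, dx j u (x + t • v, y) • gradx (dx j u) (x + t • v, y) with hW
  have hmem : ∀ t ∈ Icc 0 c, x + t • v ∈ Ω := fun t ht => hb t ⟨ht.1, ht.2.trans_lt hc.2⟩
  have hrelx : ∀ t ∈ Icc 0 c, ∀ i, ‖q t‖ ^ 2 • gradx (dx i u) (x + t • v, y)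
      = dx i u (x + t • v, y) • W t := fun t ht i => by
    have h1 := congrArg (fun ζ : V n => (WithLp.ofLp ζ).1)
      (hrel (x + t • v, y) ⟨hmem t ht, hy⟩ i)
    simpa [grad, hW, Prod.fst_sum] using h1
  -- Contracting the parallelism relation with `v` gives `|q|² q' = ⟨v, q⟩ W` for `q = ∇ₓu` along
  -- the line.
  have hder : ∀ t ∈ Icc 0 c,
      ‖q t‖ ^ 2 • ∑ j, v j • gradx (dx j u) (x + t • v, y) = ⟪v, q t⟫ • W t := fun t ht => by
    rw [Finset.smul_sum]
    simp only [smul_comm (‖q t‖ ^ 2) (v _), hrelx t ht]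
    rw [PiLp.inner_apply, Finset.sum_smul]
    refine Finset.sum_congr rfl fun j _ => ?_
    rw [smul_smul]
    congr 1
    simp [hq, gradx, mul_comm]
  rw [← hq0] at h0 hv ⊢
  refine eq_of_eventually_norm_deriv_le (q := q)
    (fun t ht => S.hasDerivAt_gradx_line (hmem t ht) hy) (fun t ht htq => ?_) c ⟨hc.1, le_rfl⟩
  have hX : (x + t • v, y) ∈ cyl Ω := ⟨hmem t (Ico_subset_Icc_self ht), hy⟩
  have hl : ContinuousAt (fun t : ℝ => (x + t • v, y)) t := by fun_prop
  have hqc : ContinuousAt q t :=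
    ContinuousAt.comp (f := fun t : ℝ => (x + t • v, y))
      (S.continuousOn_gradx.continuousAt (S.isOpen_cyl.mem_nhds hX)) hl
  have hWc : ContinuousAt W t := by
    refine tendsto_finsetSum _ fun j _ => ?_
    have h1 : ContinuousAt (gradx (dx j u)) (x + t • v, y) := by
      have h2 := (S.continuousOn_grad_dx j).continuousAt (S.isOpen_cyl.mem_nhds hX)
      exact ((WithLp.prod_continuous_ofLp 2 (E n) ℝ).continuousAt.comp h2).fst
    have h2 := (S.contDiffOn_dx j).continuousOn.continuousAt (S.isOpen_cyl.mem_nhds hX)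
    exact (ContinuousAt.comp (f := fun t : ℝ => (x + t • v, y)) h2 hl).smul
      (ContinuousAt.comp (f := fun t : ℝ => (x + t • v, y)) h1 hl)
  have hqt : ‖q t‖ ^ 2 ≠ 0 := by
    rw [htq]; exact pow_ne_zero 2 (norm_ne_zero_iff.2 h0)
  have hlim : ContinuousAt (fun s => ‖v‖ * ‖W s‖ / ‖q s‖ ^ 2) t :=
    (continuousAt_const.mul hWc.norm).div (hqc.norm.pow 2) hqt
  refine ⟨‖v‖ * ‖W t‖ / ‖q t‖ ^ 2 + 1, ?_⟩
  filter_upwards [nhdsWithin_le_nhds (hlim.eventually_lt_const (lt_add_one _)),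
    nhdsWithin_le_nhds ((hqc.norm.pow 2).eventually_ne hqt),
    mem_nhdsWithin_of_mem_nhds (Iic_mem_nhds ht.2), self_mem_nhdsWithin] with s h1 h2 h3 h4
  have h5 := congrArg norm (hder s ⟨ht.1.trans h4, h3⟩)
  -- Orthogonality of `v` to the initial gradient makes the right-hand side linear in `q - q 0`,
  -- which is the Gronwall bound. It is local because one divides by `|q|²`, nonzero near points
  -- where `q = q 0`.
  have h6 : ⟪v, q s⟫ = ⟪v, q s - q 0⟫ := by rw [inner_sub_right, hv, sub_zero]
  have h2' : 0 < ‖q s‖ ^ 2 := lt_of_le_of_ne (sq_nonneg _) (Ne.symm h2)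
  rw [norm_smul, norm_smul, Real.norm_of_nonneg h2'.le, h6] at h5
  have h7 : ‖⟪v, q s - q 0⟫‖ ≤ ‖v‖ * ‖q s - q 0‖ := norm_inner_le_norm _ _
  calc _ = ‖⟪v, q s - q 0⟫‖ * ‖W s‖ / ‖q s‖ ^ 2 := by
        rw [← h5, mul_div_cancel_left₀ _ h2'.ne']
    _ ≤ ‖v‖ * ‖q s - q 0‖ * ‖W s‖ / ‖q s‖ ^ 2 := by gcongr
    _ = ‖v‖ * ‖W s‖ / ‖q s‖ ^ 2 * ‖q s - q 0‖ := by ring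
    _ ≤ _ := mul_le_mul_of_nonneg_right h1.le (norm_nonneg _)

/-- If `∇ₓu ≠ 0` at `x`, then `n ≥ 2` provides a direction orthogonal to it. Along that direction
the gradient stays constant up to the exit point on `∂Ω`, where by continuity of `extDeriv` it must
agree with the value zero. -/
theorem gradx_eq_zero (S : Setting Ω ρ a u) (hn : 2 ≤ n)
    (hrel : ∀ X ∈ cyl Ω, ∀ i, ‖gradx u X‖ ^ 2 • grad (dx i u) X
      = dx i u X • ∑ j, dx j u X • grad (dx j u) X) {y : ℝ} (hy : 0 < y)
    (hbd : ∀ p ∈ frontier Ω, extDeriv Ω u (p, y) ∘L ContinuousLinearMap.inl ℝ (E n) ℝ = 0)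
    {x : E n} (hx : x ∈ Ω) : gradx u (x, y) = 0 := by
  by_contra h0
  obtain ⟨v, hv0, hv⟩ := exists_ne_zero_inner_eq_zero hn (gradx u (x, y))
  obtain ⟨b, hb, hp, hmem⟩ := exists_exit_time S.isOpen S.isBounded S.convex hx hv0
  have hconst := S.gradx_eq_of_orthogonal hrel hy hmem hv h0
  refine h0 ?_
  ext i
  have hcl : ∀ t ∈ Icc 0 b, x + t • v ∈ closure Ω := fun t ht => by
    rcases ht.2.lt_or_eq with h | h
    · exact subset_closure (hmem t ⟨ht.1, h⟩)
    · rw [h]; exact frontier_subset_closure hp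
  have hcont : ContinuousOn (fun t : ℝ => extDeriv Ω u (x + t • v, y) (eX i)) (Icc 0 b) :=
    (S.continuousOn_extDeriv.comp (f := fun t : ℝ => (x + t • v, y)) (by fun_prop)
      fun t ht => ⟨hcl t ht, hy⟩).clm_apply continuousOn_const
  have heq : EqOn (fun t : ℝ => extDeriv Ω u (x + t • v, y) (eX i))
      (fun _ => gradx u (x, y) i) (Ico 0 b) := fun t ht => by
    have h1 := congrArg (fun w : E n => w i) (hconst t ht)
    rw [← h1]
    exact (S.dx_eq (hmem t ht) hy i).symm
  have h1 := heq.of_subset_closure hcont continuousOn_const Ico_subset_Icc_self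
    (by rw [closure_Ico hb.ne]) (right_mem_Icc.2 hb.le)
  have h2 := DFunLike.congr_fun (hbd _ hp) (EuclideanSpace.single i 1)
  exact h1.symm.trans h2

/-- The derivative is continuous in `y` at a fixed boundary point, so vanishing at almost every
height is vanishing at every height. -/
theorem extDeriv_inl_eq_zero_of_mem_frontier (S : Setting Ω ρ a u) {R : ℝ}
    (h : ∀ᵐ y ∂(volume : Measure ℝ).restrict (Ioo 0 R), ∀ p ∈ frontier Ω,
      extDeriv Ω u (p, y) ∘L ContinuousLinearMap.inl ℝ (E n) ℝ = 0) {p : E n}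
    (hp : p ∈ frontier Ω) {y : ℝ} (hy : y ∈ Ioo 0 R) :
    extDeriv Ω u (p, y) ∘L ContinuousLinearMap.inl ℝ (E n) ℝ = 0 := by
  refine Measure.eqOn_open_of_ae_eq (μ := volume) (g := fun _ => 0)
    (f := fun y => extDeriv Ω u (p, y) ∘L ContinuousLinearMap.inl ℝ (E n) ℝ)
    (h.mono fun y hy => hy p hp) isOpen_Ioo ?_ continuousOn_const hy
  exact (S.continuousOn_extDeriv.comp (f := fun y : ℝ => (p, y)) (by fun_prop)
    fun y hy => ⟨frontier_subset_closure hp, hy.1⟩).clm_comp continuousOn_const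

/-- Only first and second derivatives of `u` enter the parallelism relation. Both sides are
continuous, so it extends from almost every point to every point of the open strip. -/
theorem smul_grad_dx_eq_of_ae (S : Setting Ω ρ a u) {R : ℝ}
    (h : ∀ᵐ X ∂(volume : Measure (E n × ℝ)).restrict (Ω ×ˢ Ioo 0 R),
      hessianForm a u X - normForm a u X = 0) {X : E n × ℝ} (hX : X ∈ Ω ×ˢ Ioo 0 R) (i : Fin n) :
    ‖gradx u X‖ ^ 2 • grad (dx i u) X = dx i u X • ∑ j, dx j u X • grad (dx j u) X := by
  have hopen : IsOpen (Ω ×ˢ Ioo 0 R) := S.isOpen.prod isOpen_Ioo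
  have hsub : Ω ×ˢ Ioo 0 R ⊆ cyl Ω := IntegrableBelow.prod_Ioo_subset_cyl R
  refine Measure.eqOn_open_of_ae_eq (μ := volume)
    (f := fun X => ‖gradx u X‖ ^ 2 • grad (dx i u) X)
    (g := fun X => dx i u X • ∑ j, dx j u X • grad (dx j u) X) ?_ hopen ?_ ?_ hX
  · filter_upwards [h, ae_restrict_mem hopen.measurableSet] with X h1 h2
    exact S.smul_grad_dx_eq_of_defect_eq_zero (hsub h2) h1 i
  · exact ((S.continuousOn_gradx.norm.pow 2).smul (S.continuousOn_grad_dx i)).mono hsub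
  · exact ((S.contDiffOn_dx i).continuousOn.smul (continuousOn_finsetSum _ fun j _ =>
      (S.contDiffOn_dx j).continuousOn.smul (S.continuousOn_grad_dx j))).mono hsub

/-- Connectedness of `Ω` settles interior points at positive heights; the difference of two values
of `u` is continuous up to `∂Ω` and to the bottom, which covers the rest. -/
theorem eq_of_gradx_eq_zero (S : Setting Ω ρ a u)
    (h : ∀ x ∈ Ω, ∀ y > 0, gradx u (x, y) = 0) {x x' : E n} (hx : x ∈ closure Ω)
    (hx' : x' ∈ closure Ω) {y : ℝ} (hy : 0 ≤ y) : u (x, y) = u (x', y) := by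
  have hpos : ∀ y > 0, ∀ x ∈ Ω, ∀ x' ∈ Ω, u (x, y) = u (x', y) := fun y hy x hx x' hx' => by
    refine S.isOpen.is_const_of_fderiv_eq_zero (𝕜 := ℝ) (f := fun x => u (x, y))
      S.convex.isPreconnected
      (fun z hz => (S.hasFDerivAt_slice hz hy).differentiableAt.differentiableWithinAt)
      (fun z hz => ?_) hx hx'
    rw [(S.hasFDerivAt_slice hz hy).fderiv]
    ext v
    have h1 : extDeriv Ω u (z, y) (v, 0) = 0 := by
      rw [← sum_eX, map_sum]
      refine Finset.sum_eq_zero fun i _ => ?_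
      have h2 := congrArg (fun w : E n => w i) (h z hz y hy)
      rw [map_smul, ← S.dx_eq hz hy i, show dx i u (z, y) = 0 from h2, smul_zero]
    simpa using h1
  have hc : ContinuousOn (fun q : (E n × E n) × ℝ => u (q.1.1, q.2) - u (q.1.2, q.2))
      ((closure Ω ×ˢ closure Ω) ×ˢ Ici (0 : ℝ)) :=
    (S.regular.continuousOn.comp (f := fun q : (E n × E n) × ℝ => (q.1.1, q.2)) (by fun_prop)
      fun q hq => ⟨hq.1.1, hq.2⟩).sub
    (S.regular.continuousOn.comp (f := fun q : (E n × E n) × ℝ => (q.1.2, q.2)) (by fun_prop)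
      fun q hq => ⟨hq.1.2, hq.2⟩)
  have heq : EqOn (fun q : (E n × E n) × ℝ => u (q.1.1, q.2) - u (q.1.2, q.2)) (fun _ => 0)
      ((Ω ×ˢ Ω) ×ˢ Ioi (0 : ℝ)) := fun q hq =>
    sub_eq_zero.2 (hpos q.2 hq.2 _ hq.1.1 _ hq.1.2)
  exact sub_eq_zero.1 (heq.of_subset_closure hc continuousOn_const
    (prod_mono (prod_mono subset_closure subset_closure) Ioi_subset_Ici_self)
    (by rw [closure_prod_eq, closure_prod_eq, closure_Ioi])
    (show ((x, x'), y) ∈ _ from ⟨⟨hx, hx'⟩, hy⟩))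

end Setting

end Rigidity

end

end BoundaryReaction

/-! ### The theorem. -/

theorem theorem1p2 (n : ℕ) (hn : 2 ≤ n) (Ω : Set (E n))
    (hΩ_open : IsOpen Ω) (hΩ_bdd : Bornology.IsBounded Ω) (hΩ_convex : Convex ℝ Ω)
    (hΩ_reg : ∃ α : ℝ≥0, 0 < α ∧ α < 1 ∧ HasCkAlphaBoundary 4 α Ω)
    (hΩ_curv : ∀ p ∈ frontier Ω, ∀ κ : ℝ, IsPrincipalCurvature Ω p κ → 0 < κ)
    (a : ℝ → ℝ → ℝ) (ha : IsDiffusionCoefficient a)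
    (g : ℝ → ℝ → ℝ) (hg : IsInteriorReaction g)
    (f : ℝ → ℝ) (hf : ∃ α : ℝ≥0, 0 < α ∧ α < 1 ∧ IsCkAlpha 2 α f)
    (u : E n × ℝ → ℝ) (hu : IsStableSolution Ω a g f u)
    (h_energy : ∃ C > 0, ∀ R ≥ 1,
      ∫ X in Ω ×ˢ Ioo (0 : ℝ) R, a X.2 ‖grad u X‖ * ‖gradx u X‖ ^ 2 ≤ C * R ^ 2) :
    ∃ v : ℝ → ℝ, ∀ x ∈ closure Ω, ∀ y ≥ 0, u (x, y) = v y := by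
  rcases Ω.eq_empty_or_nonempty with rfl | ⟨x₀, hx₀⟩
  · exact ⟨0, fun x hx => by simp at hx⟩
  obtain ⟨α, -, -, hreg⟩ := hΩ_reg
  obtain ⟨β, -, -, hf2, -⟩ := hf
  obtain ⟨ρ, hρ⟩ := exists_isDefiningFunction hΩ_open hΩ_bdd hΩ_convex hx₀ fun p hp => by
    obtain ⟨ρ, hρ, hloc⟩ := hreg p hp
    exact ⟨ρ, hρ.1.of_le (by norm_num), hloc⟩
  have S : Setting Ω ρ a u := ⟨hΩ_open, hΩ_bdd, hΩ_convex, ⟨x₀, hx₀⟩, by omega, hρ, ha,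
    hu.solution.regular⟩
  obtain ⟨G, hG1, hG2⟩ := hu.solution.regular.integrable
  have hG : HasThirdDerivatives Ω a u G := ⟨hG1, hG2⟩
  have hz := fun (R : ℝ) (hR : 0 < R) => S.integral_slices_eq_zero hG hg
    (hf2.of_le (by norm_num)) hu hΩ_curv h_energy (R₀ := R) hR
  have hrel : ∀ X ∈ cyl Ω, ∀ i, ‖gradx u X‖ ^ 2 • grad (dx i u) X
      -- The vanishing statements concern strips of finite height; each point lies in the strip
      -- reaching one unit above it.
      = dx i u X • ∑ j, dx j u X • grad (dx j u) X := fun X hX i => by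
    have hX2 : 0 < X.2 := hX.2
    exact S.smul_grad_dx_eq_of_ae (hz (X.2 + 1) (by linarith)).1 ⟨hX.1, hX2, lt_add_one _⟩ i
  refine ⟨fun y => u (x₀, y), fun x hx y hy => S.eq_of_gradx_eq_zero
    (fun x hx y hy => S.gradx_eq_zero hn hrel hy (fun p hp => ?_) hx) hx (subset_closure hx₀) hy⟩
  exact S.extDeriv_inl_eq_zero_of_mem_frontier (hz (y + 1) (by linarith)).2 hp
    ⟨hy, lt_add_one _⟩
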